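/- \textbf{Model.} Let $(t_\alpha)_{\alpha\in\mathbb Z}$ be real couplings, finitely many but at least one of them non-zero. On the Fock space of a periodic chain of $L$ spinless fermionic modes $c_n$ (site labels modulo $L$) put $\gamma_n=c_n^\dagger+c_n$, $\tilde\gamma_n=\mathrm i(c_n^\dagger-c_n)$ and $$H=\frac{\mathrm i}{2}\sum_{\alpha}\sum_{n}t_\alpha\,\tilde\gamma_n\gamma_{n+\alpha},\qquad f(z)=\sum_\alpha t_\alpha z^\alpha .$$ Let $N_p$ be the order of the pole of $f$ at the origin ($0$ if there is none), and let $z_1,\dots,z_{N_z}$ and $Z_1,\dots,Z_{N_Z}$ be the zeros of $f$ (with multiplicity, a zero at the origin included) inside and outside the unit circle. Put $c=\tfrac12\#\{\text{zeros of } f \text{ on the unit circle}\}$, $\omega=N_z-N_p$ and, when $c=0$, $\Sigma=\operatorname{sign} f(1)\in\{1,-1\}$. The model is in the gapped phase $(\omega,c=0,\Sigma)$ if $c=0$ and its invariants are $\omega$ and $\Sigma$. For $\alpha\in\mathbb Z$ and $x=\lfloor|\alpha|/2\rfloor$ let $$\mathcal O_\alpha(n)=\begin{cases}\mathrm i^{x}\bigl(\prod_{m=1}^{n-1}\mathrm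 i\tilde\gamma_m\gamma_m\bigr)\gamma_n\gamma_{n+1}\cdots\gamma_{n+\alpha-1}&\alpha>0,\\ (-\mathrm i)^{x}\bigl(\prod_{m=1}^{n-1}\mathrm i\tilde\gamma_m\gamma_m\bigr)(-\mathrm i\tilde\gamma_n)\cdots(-\mathrm i\tilde\gamma_{n+|\alpha|-1})&\alpha<0,\\ \prod_{m=1}^{n-1}\mathrm i\tilde\gamma_m\gamma_m&\alpha=0.\end{cases}$$ \textbf{Theorem (string order parameters classify gapped phases).} Suppose the model is in the gapped phase $(\omega,c=0,\Sigma)$. For all $\alpha\in\mathbb Z$ and $N\ge 0$ the ground-state expectation values of $\mathcal O_\alpha(1)\mathcal O_\alpha(N+1)$ on the finite chains converge as $L\to\infty$, for any choice of normalised ground states, to a limit $\langle\mathcal O_\alpha(1)\mathcal O_\alpha(N+1)\rangle$; moreover, for each $\alpha$ the difference between the finite-chain value and this limit tends to $0$ in the double scaling limit $N\to\infty$, $L\to\infty$, $N/L\to0$. Furthermore: (i) for every $\alpha\in\mathbb Z$, $\displaystyle\lim_{N\to\infty}\bigl|\langle\mathcal O_\alpha(1)\mathcal O_\alpha(N+1)\rangle\bigr|=A\,\delta_{\alpha\omega}$,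 where $$A=\left(\frac{\prod_{i_1,i_2=1}^{N_z}(1-z_{i_1}z_{i_2})\prod_{j_1,j_2=1}^{N_Z}\bigl(1-\frac1{Z_{j_1}Z_{j_2}}\bigr)}{\prod_{i=1}^{N_z}\prod_{j=1}^{N_Z}\bigl(1-\frac{z_i}{Z_j}\bigr)^2}\right)^{1/4}>0 ,$$ the quantity under the root being a positive real number. Thus the limit is non-zero exactly when $\alpha=\omega$, and these correlators form a complete set of order parameters for $\omega$. (ii) $\Sigma\in\{1,-1\}$ can be read off from the presence or absence of a $(-1)^N$ oscillation in the correlator with $\alpha=\omega$: as $N\to\infty$, $\langle\mathcal O_\omega(1)\mathcal O_\omega(N+1)\rangle$ converges to a non-zero limit if and only if $\Sigma=(-1)^{\omega-1}$, and $(-1)^N\langle\mathcal O_\omega(1)\mathcal O_\omega(N+1)\rangle$ converges to a non-zero limit if and only if $\Sigma=-(-1)^{\omega-1}$. -/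

import Mathlib

open Filter Topology

noncomputable section

namespace BDI

/-! ### The periodic fermion chain with `L` sites -/

/-- The sites of a periodic chain of length `L`: site labels are integers taken modulo `L`. -/
abbrev Site (L : ℕ) : Type := ZMod L

/-- The occupation-number basis of the Fock space: a basis vector is the set of occupied sites. -/
abbrev Occ (L : ℕ) : Type := Finset (Site L)

/-- Vectors of the Fock space of `L` spinless fermionic modes, in the occupation-number basis. -/
abbrev FockVec (L : ℕ) : Type := Occ L → ℂ

/-- Linear operators on the Fock space, in the occupation-number basis. -/
abbrev FockOp (L : ℕ) : Type := Matrix (Occ L) (Occ L) ℂ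

variable (L : ℕ) [NeZero L]

/-- The fermionic annihilation operator `c_n`:
`c_n |S⟩ = (-1)^{#{m ∈ S : m < n}} |S ∖ {n}⟩` if `n ∈ S`, and `c_n |S⟩ = 0` otherwise. -/
def annihilation (n : Site L) : FockOp L :=
  Matrix.of fun S' S =>
    if n ∈ S ∧ S' = S.erase n then (-1 : ℂ) ^ (S.filter fun m => m.val < n.val).card else 0

/-- The creation operator `c_n†`. -/
def creation (n : Site L) : FockOp L := (annihilation L n).conjTranspose

/-- The real Majorana operator `γ_n = c_n† + c_n`. -/
def majorana (n : Site L) : FockOp L := creation L n + annihilation L n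

/-- The imaginary Majorana operator `γ̃_n = i (c_n† - c_n)`. -/
def majoranaTilde (n : Site L) : FockOp L :=
  Complex.I • (creation L n - annihilation L n)

/-- The Hamiltonian `H = (i/2) ∑_α ∑_n t_α γ̃_n γ_{n+α}`, for finitely many real couplings
`t_α`. -/
def hamiltonian (t : ℤ →₀ ℝ) : FockOp L :=
  t.sum fun α x =>
    ((Complex.I / 2) * (x : ℂ)) •
      ∑ n : Site L, majoranaTilde L n * majorana L (n + (α : Site L))

variable {L}

/-- The expectation value `⟨ψ| A |ψ⟩`. -/
def expectation (ψ : FockVec L) (A : FockOp L) : ℂ := star ψ ⬝ᵥ (A.mulVec ψ)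

/-- `ψ` is a normalised vector. -/
def IsState (ψ : FockVec L) : Prop := star ψ ⬝ᵥ ψ = 1

/-- `ψ` is a normalised ground state of the chain: it minimises the energy among all normalised
vectors. -/
def IsGroundState (t : ℤ →₀ ℝ) (ψ : FockVec L) : Prop :=
  IsState ψ ∧ ∀ φ : FockVec L, IsState φ →
    (expectation ψ (hamiltonian L t)).re ≤ (expectation φ (hamiltonian L t)).re

/-- Every finite chain has a ground state. -/
theorem exists_isGroundState (t : ℤ →₀ ℝ) : ∃ ψ : FockVec L, IsGroundState t ψ := by
  have key : ∀ ψ : FockVec L, star ψ ⬝ᵥ ψ = ((∑ S, ‖ψ S‖ ^ 2 : ℝ) : ℂ) := by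
    intro ψ
    simp only [dotProduct, Pi.star_apply, Complex.ofReal_sum]
    refine Finset.sum_congr rfl fun S _ => ?_
    have h := Complex.conj_mul' (ψ S)
    simpa using h
  have hcomp : IsCompact {ψ : FockVec L | IsState ψ} := by
    refine Metric.isCompact_of_isClosed_isBounded ?_ ?_
    · have : Continuous fun ψ : FockVec L => star ψ ⬝ᵥ ψ := by
        unfold dotProduct; fun_prop
      exact isClosed_eq this continuous_const
    · refine (Metric.isBounded_closedBall (x := (0 : FockVec L)) (r := 1)).subset ?_
      intro ψ hψ
      have h1 : (∑ S, ‖ψ S‖ ^ 2 : ℝ) = 1 := by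
        have := (key ψ).symm.trans hψ
        exact_mod_cast this
      rw [mem_closedBall_zero_iff, pi_norm_le_iff_of_nonneg zero_le_one]
      intro S
      have h2 : ‖ψ S‖ ^ 2 ≤ ∑ S, ‖ψ S‖ ^ 2 :=
        Finset.single_le_sum (f := fun S => ‖ψ S‖ ^ 2) (fun _ _ => by positivity)
          (Finset.mem_univ S)
      nlinarith [norm_nonneg (ψ S)]
  have hne : {ψ : FockVec L | IsState ψ}.Nonempty := by
    refine ⟨Pi.single ∅ 1, ?_⟩
    simp [IsState]
  have hcont : ContinuousOn (fun ψ : FockVec L => (expectation ψ (hamiltonian L t)).re)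
      {ψ : FockVec L | IsState ψ} := by
    refine Continuous.continuousOn ?_
    unfold expectation dotProduct Matrix.mulVec dotProduct
    fun_prop
  obtain ⟨ψ, hψ, hmin⟩ := hcomp.exists_isMinOn hne hcont
  exact ⟨ψ, hψ, fun φ hφ => hmin hφ⟩

variable (L)

/-- The fermion parity of the sites `1, …, n - 1`, that is `∏_{m=1}^{n-1} i γ̃_m γ_m`. -/
def parityString (n : ℕ) : FockOp L :=
  ((List.range' 1 (n - 1)).map fun m : ℕ =>
    Complex.I • (majoranaTilde L (m : Site L) * majorana L (m : Site L))).prod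

/-- The string operator `𝒪_α(n)` for `n ≥ 1`. With `x = ⌊|α|/2⌋` it is
`i^x (∏_{m<n} i γ̃_m γ_m) γ_n ⋯ γ_{n+α-1}` for `α > 0`,
`(-i)^x (∏_{m<n} i γ̃_m γ_m) (-i γ̃_n) ⋯ (-i γ̃_{n+|α|-1})` for `α < 0`,
and `∏_{m<n} i γ̃_m γ_m` for `α = 0`. -/
def stringOp (α : ℤ) (n : ℕ) : FockOp L :=
  if 0 < α then
    Complex.I ^ (α.natAbs / 2) •
      (parityString L n *
        ((List.range' n α.natAbs).map fun m : ℕ => majorana L (m : Site L)).prod)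
  else if α < 0 then
    (-Complex.I) ^ (α.natAbs / 2) •
      (parityString L n *
        ((List.range' n α.natAbs).map fun m : ℕ =>
          (-Complex.I) • majoranaTilde L (m : Site L)).prod)
  else parityString L n

variable {L}

/-- `⟨ψ| 𝒪_α(1) 𝒪_α(N+1) |ψ⟩` on the chain of length `L`. -/
def stringCorrelation (ψ : FockVec L) (α : ℤ) (N : ℕ) : ℂ :=
  expectation ψ (stringOp L α 1 * stringOp L α (N + 1))

/-- `g` is the thermodynamic limit `L → ∞` of the ground-state correlator
`⟨𝒪_α(1) 𝒪_α(N+1)⟩` (for whatever choice of ground states of the finite chains). -/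
def IsThermodynamicCorrelator (t : ℤ →₀ ℝ) (α : ℤ) (N : ℕ) (g : ℂ) : Prop :=
  ∀ ε : ℝ, 0 < ε → ∃ L₀ : ℕ, ∀ (L : ℕ) [NeZero L], L₀ ≤ L →
    ∀ ψ : FockVec L, IsGroundState t ψ → ‖stringCorrelation ψ α N - g‖ < ε

/-- In the double scaling limit `N → ∞`, `L → ∞`, `N / L → 0` the finite-size ground-state
correlator `⟨𝒪_α(1) 𝒪_α(N+1)⟩` approaches `G N`. -/
def IsDoubleScalingCorrelator (t : ℤ →₀ ℝ) (α : ℤ) (G : ℕ → ℂ) : Prop :=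
  ∀ ε : ℝ, 0 < ε → ∃ (N₀ : ℕ) (δ : ℝ), 0 < δ ∧ ∀ (N L : ℕ) [NeZero L],
    N₀ ≤ N → (N : ℝ) ≤ δ * L →
      ∀ ψ : FockVec L, IsGroundState t ψ → ‖stringCorrelation ψ α N - G N‖ < ε

/-! ### The function `f` and the invariants of the phase diagram -/

/-- `f(z) = ∑_α t_α z^α`. -/
def symbol (t : ℤ →₀ ℝ) (z : ℂ) : ℂ := t.sum fun α x => (x : ℂ) * z ^ α

/-- `N_p`, the order of the pole of `f` at the origin (`0` if there is no pole). -/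
def poleOrder (t : ℤ →₀ ℝ) : ℕ := t.support.sup fun α => (-α).toNat

/-- The polynomial `z ^ N_p * f(z)`. -/
def numerator (t : ℤ →₀ ℝ) : Polynomial ℂ :=
  t.sum fun α x => Polynomial.monomial (α + poleOrder t).toNat (x : ℂ)

theorem eval_numerator (t : ℤ →₀ ℝ) {z : ℂ} (hz : z ≠ 0) :
    (numerator t).eval z = z ^ poleOrder t * symbol t z := by
  unfold numerator symbol
  rw [Finsupp.sum, Finsupp.sum, Polynomial.eval_finsetSum, Finset.mul_sum]
  refine Finset.sum_congr rfl fun α hα => ?_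
  have h1 : (-α).toNat ≤ poleOrder t :=
    Finset.le_sup (f := fun α : ℤ => (-α).toNat) hα
  have h2 : ((α + poleOrder t).toNat : ℤ) = α + poleOrder t := Int.toNat_of_nonneg (by omega)
  rw [Polynomial.eval_monomial, ← zpow_natCast, h2, zpow_add₀ hz, zpow_natCast]
  ring

/-- The zeros of `f` inside the unit circle, with multiplicity. -/
def zerosInside (t : ℤ →₀ ℝ) : Multiset ℂ := (numerator t).roots.filter fun z => ‖z‖ < 1

/-- The zeros of `f` on the unit circle, with multiplicity. -/
def zerosOn (t : ℤ →₀ ℝ) : Multiset ℂ := (numerator t).roots.filter fun z => ‖z‖ = 1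

/-- The zeros of `f` outside the unit circle, with multiplicity. -/
def zerosOutside (t : ℤ →₀ ℝ) : Multiset ℂ := (numerator t).roots.filter fun z => 1 < ‖z‖

/-- `c`, half the number of zeros of `f` on the unit circle. -/
def centralCharge (t : ℤ →₀ ℝ) : ℚ := ((zerosOn t).card : ℚ) / 2

/-- `ω = N_z - N_p`. -/
def topologicalInvariant (t : ℤ →₀ ℝ) : ℤ := ((zerosInside t).card : ℤ) - (poleOrder t : ℤ)

/-- `Σ`, the sign of the real number `f(1)`. -/
def signInvariant (t : ℤ →₀ ℝ) : ℝ := Real.sign (symbol t 1).re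

/-- The chain with (not identically vanishing) couplings `t` lies in the gapped phase
`(ω, c = 0, Σ)`. -/
structure InGappedPhase (t : ℤ →₀ ℝ) (ω : ℤ) (σ : ℝ) : Prop where
  ne_zero : t ≠ 0
  centralCharge_eq : centralCharge t = 0
  invariant_eq : topologicalInvariant t = ω
  sign_eq : signInvariant t = σ

/-- The quantity
`∏_{i₁,i₂} (1 - z_{i₁} z_{i₂}) ∏_{j₁,j₂} (1 - 1 / (Z_{j₁} Z_{j₂})) / ∏_{i,j} (1 - z_i / Z_j) ^ 2`,
where the `z_i` are the zeros of `f` inside the unit circle and the `Z_j` those outside. -/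
def zeroProduct (t : ℤ →₀ ℝ) : ℂ :=
  ((zerosInside t ×ˢ zerosInside t).map fun p : ℂ × ℂ => 1 - p.1 * p.2).prod *
    ((zerosOutside t ×ˢ zerosOutside t).map fun p : ℂ × ℂ => 1 - 1 / (p.1 * p.2)).prod /
      ((zerosInside t ×ˢ zerosOutside t).map fun p : ℂ × ℂ => (1 - p.1 / p.2) ^ 2).prod

/-! ### Oscillation -/

/-- The sequence has a non-zero limit: there is no `(-1)^N` oscillation. -/
def NonOscillating (u : ℕ → ℂ) : Prop :=
  ∃ B : ℂ, B ≠ 0 ∧ Tendsto u atTop (𝓝 B)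

/-- The sequence behaves like a non-zero constant times `(-1)^N`. -/
def Oscillating (u : ℕ → ℂ) : Prop :=
  ∃ B : ℂ, B ≠ 0 ∧ Tendsto (fun N => (-1 : ℂ) ^ N * u N) atTop (𝓝 B)

end BDI

end

/-!
The proof reduces the string correlators to Toeplitz determinants of the phase `f / |f|` of the
symbol and evaluates these by the strong Szegő limit theorem.

*Ground states.* With `φ = f / |f|` and the Fourier modes `g_k`, `g̃_k` of the operators `γ_n`,
`γ̃_n`, the operators `A_k = g_k - i φ̄_k g̃_k` anticommute pairwise, and `4 L H` is
`∑_k |f_k| A_k† A_k` up to a constant (`hamiltonian_eq_sum_bogoliubov`). Pairwise anticommuting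
operators of square zero have a common null vector, so every ground state is annihilated by all the
`A_k` (`IsGroundState.bogoliubov_mulVec`), which means that on a ground state each `γ_m` acts as
`i ∑_n q(m - n) γ̃_n` with the discrete Fourier coefficients `q` of `φ`. No uniqueness of the ground
state is needed. Moving one such combination through a product of Majorana operators gives Wick's
theorem (`expectation_tildeProd_mul_revProd`). Since `𝒪_α(1) 𝒪_α(N+1)` is, up to a sign, a product
of `N` pairs `i γ̃_n γ_{n+α}`, its expectation value is a Toeplitz determinant with entries
`q(j - i + α)` (`stringCorrelation_eq_det`).

*The phase of the symbol.* On the unit circle `φ(z) = Σ z^ω h(z) / h(1/z)`, where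
`h = ∏_j (1 - z / Z_j)^{1/2} / ∏_i (1 - z_i z)^{1/2}` and its inverse are power series that converge
on a disc of radius `R > 1` (`symbol_eq_norm_mul_phase`). Hence the discrete Fourier coefficients
approach the Laurent coefficients exponentially fast in `L`, the determinants of size `N` differ
by at most `N² e (M + N e)^N` with `e = O(R^{-(L - N)})`, and this is small as soon as `L` is large
and `N / L` is below a fixed bound (`exists_correlation_sub_limitCorrelator_lt`). This covers both
the thermodynamic and the double scaling limit.

*Szegő's theorem.* The Banach algebra of bounded operators on `ℓ¹` takes the place of the trace
class theory: the operators `K` with `∑_j ‖K e_j‖ < ∞` form a left ideal, stable under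
multiplication on the right by upper triangular Toeplitz operators, and for them the determinants of
the sections of `1 + K` converge, because a determinant is bounded by the product of the `ℓ¹` norms
of its columns. For power series `u`, `w` with constant coefficient `1`, the upper and lower
triangular Toeplitz operators `U`, `W` are unipotent and `W⁻¹ U W S^κ U⁻¹ = S^κ + K`. Thus the
Toeplitz determinants of `u(z) w(1/z)` have a limit `E(u, w)` (`exists_hasSzegoLimit`), while those
of `z^κ u(z) w(1/z)` with `κ ≠ 0` tend to zero (`tendsto_det_toeplitzMatrix_of_ne`); the latter
gives the vanishing of the correlators with `α ≠ ω`. The limit `E` is symmetric and multiplicative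
in both arguments (`HasSzegoLimit.swap`, `HasSzegoLimit.mul`), and
`E((1 - x z)⁻¹, 1 - y z) = 1 - x y` is a triangular determinant. This determines
`E(h², h⁻²) = E(h, h⁻¹)⁴` as the product over the zeros (`szegoLimit_pow_four`).

For `α = ω` the remaining factor of the correlator is, up to a constant sign, the `N`-th power of
`(-1)^{ω-1} Σ`, from which the presence of the oscillation is read off.
-/
set_option linter.unusedSectionVars false

noncomputable section

namespace BDI

/-! ### The algebra of Majorana operators -/

section Majorana

variable {L : ℕ} [NeZero L]

/-- The operator that flips the occupation of the site `n` and multiplies the basis vector `S` by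
`s S`. The Majorana operators have this form. -/
def flipOp (n : Site L) (s : Occ L → ℂ) : FockOp L :=
  Matrix.of fun S' S => if S' = symmDiff S {n} then s S else 0

/-- The Jordan-Wigner sign `(-1)^{#{m ∈ S : m < n}}`. -/
def jwSign (n : Site L) (S : Occ L) : ℂ := (-1 : ℂ) ^ (S.filter fun m => m.val < n.val).card

theorem flipOp_mul_flipOp (m n : Site L) (s s' : Occ L → ℂ) :
    flipOp m s * flipOp n s' = Matrix.of fun S'' S =>
      if S'' = symmDiff (symmDiff S {n}) {m} then s (symmDiff S {n}) * s' S else 0 := by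
  ext S'' S
  simp only [flipOp, Matrix.mul_apply, Matrix.of_apply]
  rw [Finset.sum_eq_single (symmDiff S {n})]
  · simp
  · intro b _ hb
    simp [hb]
  · simp

theorem flipOp_anticommute {m n : Site L} {s s' : Occ L → ℂ}
    (h : ∀ S, s (symmDiff S {n}) * s' S + s' (symmDiff S {m}) * s S = 0) :
    flipOp m s * flipOp n s' + flipOp n s' * flipOp m s = 0 := by
  rw [flipOp_mul_flipOp, flipOp_mul_flipOp]
  ext S'' S
  simp only [Matrix.add_apply, Matrix.of_apply, Matrix.zero_apply]
  rw [symmDiff_right_comm S {m} {n}]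
  split_ifs
  · exact h S
  · simp

theorem flipOp_mul_self {n : Site L} {s : Occ L → ℂ}
    (h : ∀ S, s (symmDiff S {n}) * s S = 1) : flipOp n s * flipOp n s = 1 := by
  rw [flipOp_mul_flipOp]
  ext S'' S
  simp only [Matrix.of_apply, symmDiff_symmDiff_cancel_right, h, Matrix.one_apply]

theorem symmDiff_singleton_of_mem {S : Occ L} {n : Site L} (h : n ∈ S) :
    symmDiff S {n} = S.erase n := by
  ext x
  simp only [Finset.mem_symmDiff, Finset.mem_singleton, Finset.mem_erase]
  grind

theorem symmDiff_singleton_of_notMem {S : Occ L} {n : Site L} (h : n ∉ S) :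
    symmDiff S {n} = insert n S := by
  ext x
  simp only [Finset.mem_symmDiff, Finset.mem_singleton, Finset.mem_insert]
  grind

theorem jwSign_symmDiff (m n : Site L) (S : Occ L) :
    jwSign m (symmDiff S {n}) = (if n.val < m.val then -1 else 1) * jwSign m S := by
  unfold jwSign
  by_cases hn : n ∈ S
  · rw [symmDiff_singleton_of_mem hn, Finset.filter_erase]
    split_ifs with h
    · have hmem : n ∈ S.filter fun x => x.val < m.val := by simp [hn, h]
      rw [← Finset.card_erase_add_one hmem, pow_succ]
      ring
    · rw [Finset.erase_eq_of_notMem (by simp [h])]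
      simp
  · rw [symmDiff_singleton_of_notMem hn, Finset.filter_insert]
    split_ifs with h
    · rw [Finset.card_insert_of_notMem (by simp [hn]), pow_succ]
      ring
    · simp

theorem jwSign_mul_self (n : Site L) (S : Occ L) : jwSign n S * jwSign n S = 1 := by
  unfold jwSign
  rw [← mul_pow]
  simp

theorem star_jwSign (n : Site L) (S : Occ L) : star (jwSign n S) = jwSign n S := by
  simp [jwSign]

theorem annihilation_apply (n : Site L) (S' S : Occ L) :
    annihilation L n S' S =
      if S' = symmDiff S {n} then (if n ∈ S then jwSign n S else 0) else 0 := by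
  simp only [annihilation, Matrix.of_apply, jwSign]
  by_cases hn : n ∈ S
  · simp [hn, symmDiff_singleton_of_mem]
  · simp [hn]

theorem creation_apply (n : Site L) (S' S : Occ L) :
    creation L n S' S =
      if S' = symmDiff S {n} then (if n ∈ S then 0 else jwSign n S) else 0 := by
  have key : S = symmDiff S' {n} ↔ S' = symmDiff S {n} := by
    constructor <;> rintro rfl <;> simp
  rw [creation, Matrix.conjTranspose_apply, annihilation_apply]
  simp only [key]
  by_cases h1 : S' = symmDiff S {n}
  · subst h1
    have hmem : n ∈ symmDiff S {n} ↔ n ∉ S := by simp [Finset.mem_symmDiff]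
    by_cases h2 : n ∈ S
    · simp [hmem, h2]
    · simp only [hmem, h2, if_true, if_false, not_false_eq_true, jwSign_symmDiff]
      simpa using star_jwSign n S
  · simp [h1]

theorem majorana_eq_flipOp (n : Site L) : majorana L n = flipOp n (jwSign n) := by
  ext S' S
  simp only [majorana, Matrix.add_apply, creation_apply, annihilation_apply, flipOp,
    Matrix.of_apply]
  split_ifs <;> simp

theorem majoranaTilde_eq_flipOp (n : Site L) :
    majoranaTilde L n =
      flipOp n (fun S => Complex.I * ((if n ∈ S then -1 else 1) * jwSign n S)) := by
  ext S' S
  simp only [majoranaTilde, Matrix.smul_apply, Matrix.sub_apply, creation_apply,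
    annihilation_apply, flipOp, Matrix.of_apply]
  split_ifs <;> simp

theorem val_lt_or_gt {m n : Site L} (h : m ≠ n) :
    (m.val < n.val ∧ ¬ n.val < m.val) ∨ (n.val < m.val ∧ ¬ m.val < n.val) := by
  have : m.val ≠ n.val := fun h' => h (ZMod.val_injective L h')
  omega

theorem majorana_mul_self (n : Site L) : majorana L n * majorana L n = 1 := by
  rw [majorana_eq_flipOp]
  refine flipOp_mul_self fun S => ?_
  rw [jwSign_symmDiff]
  simp [jwSign_mul_self]

theorem majoranaTilde_mul_self (n : Site L) : majoranaTilde L n * majoranaTilde L n = 1 := by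
  rw [majoranaTilde_eq_flipOp]
  refine flipOp_mul_self fun S => ?_
  rw [jwSign_symmDiff]
  have h1 := jwSign_mul_self n S
  have h2 := Complex.I_mul_I
  by_cases hn : n ∈ S <;> simp only [Finset.mem_symmDiff, hn, Finset.mem_singleton] <;>
    simp <;> linear_combination h1 - (jwSign n S * jwSign n S) * Complex.I_mul_I

theorem majorana_anticommute {m n : Site L} (h : m ≠ n) :
    majorana L m * majorana L n + majorana L n * majorana L m = 0 := by
  rw [majorana_eq_flipOp, majorana_eq_flipOp]
  refine flipOp_anticommute fun S => ?_
  rw [jwSign_symmDiff, jwSign_symmDiff]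
  rcases val_lt_or_gt h with ⟨h1, h2⟩ | ⟨h1, h2⟩ <;> simp only [h1, h2, if_true, if_false] <;> ring

theorem majoranaTilde_anticommute {m n : Site L} (h : m ≠ n) :
    majoranaTilde L m * majoranaTilde L n + majoranaTilde L n * majoranaTilde L m = 0 := by
  rw [majoranaTilde_eq_flipOp, majoranaTilde_eq_flipOp]
  refine flipOp_anticommute fun S => ?_
  rw [jwSign_symmDiff, jwSign_symmDiff]
  have h' := h.symm
  rcases val_lt_or_gt h with ⟨h1, h2⟩ | ⟨h1, h2⟩ <;> by_cases hm : m ∈ S <;> by_cases hn : n ∈ S <;>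
    simp [h1, h2, Finset.mem_symmDiff, hm, hn, h, h'] <;> ring

theorem majoranaTilde_majorana_anticommute (m n : Site L) :
    majoranaTilde L m * majorana L n + majorana L n * majoranaTilde L m = 0 := by
  rw [majoranaTilde_eq_flipOp, majorana_eq_flipOp]
  refine flipOp_anticommute fun S => ?_
  rw [jwSign_symmDiff, jwSign_symmDiff]
  rcases eq_or_ne m n with rfl | h
  · by_cases hm : m ∈ S <;> simp [Finset.mem_symmDiff, hm] <;> ring
  · rcases val_lt_or_gt h with ⟨h1, h2⟩ | ⟨h1, h2⟩ <;> by_cases hm : m ∈ S <;>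
      simp [h1, h2, Finset.mem_symmDiff, hm, h] <;> ring

theorem conjTranspose_majorana (n : Site L) :
    (majorana L n).conjTranspose = majorana L n := by
  simp [majorana, creation, add_comm]

theorem conjTranspose_majoranaTilde (n : Site L) :
    (majoranaTilde L n).conjTranspose = majoranaTilde L n := by
  simp only [majoranaTilde, creation, Matrix.conjTranspose_smul, Matrix.conjTranspose_sub,
    Matrix.conjTranspose_conjTranspose]
  ext i j
  simp
  ring

theorem majorana_anticomm (m n : Site L) :
    majorana L m * majorana L n + majorana L n * majorana L m = if m = n then 2 else 0 := by
  split_ifs with h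
  · rw [h, majorana_mul_self, one_add_one_eq_two]
  · exact majorana_anticommute h

theorem majoranaTilde_anticomm (m n : Site L) :
    majoranaTilde L m * majoranaTilde L n + majoranaTilde L n * majoranaTilde L m =
      if m = n then 2 else 0 := by
  split_ifs with h
  · rw [h, majoranaTilde_mul_self, one_add_one_eq_two]
  · exact majoranaTilde_anticommute h

end Majorana

/-! ### Fourier modes and the energy -/

section Fourier

variable {L : ℕ} [NeZero L]

/-- The additive character `j ↦ exp (2 π i j / L)` of `ℤ / L`. -/
abbrev chi (L : ℕ) [NeZero L] : AddChar (Site L) ℂ := ZMod.stdAddChar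

theorem star_chi (x : Site L) : star (chi L x) = chi L (-x) := by
  rw [ZMod.stdAddChar_apply, ZMod.stdAddChar_apply, AddChar.map_neg_eq_inv, Circle.coe_inv_eq_conj]
  rfl

theorem sum_chi_mul (b : Site L) : ∑ k, chi L (k * b) = if b = 0 then (L : ℂ) else 0 := by
  rw [AddChar.sum_mulShift _ (ZMod.isPrimitive_stdAddChar L), ZMod.card]
  split_ifs <;> simp

theorem chi_zpow (k : Site L) (α : ℤ) : chi L k ^ α = chi L (k * (α : Site L)) := by
  rw [← AddChar.map_zsmul_eq_zpow, zsmul_eq_mul, mul_comm]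

theorem norm_chi (k : Site L) : ‖chi L k‖ = 1 := by
  rw [ZMod.stdAddChar_apply]; exact Circle.norm_coe _

/-- The Fourier mode `∑_m e^{-2 π i k m / L} X_m` of a family of operators. -/
def fourierOp (X : Site L → FockOp L) (k : Site L) : FockOp L :=
  ∑ m, chi L (-(k * m)) • X m

theorem conjTranspose_fourierOp {X : Site L → FockOp L} (hX : ∀ m, (X m).conjTranspose = X m)
    (k : Site L) : (fourierOp X k).conjTranspose = fourierOp X (-k) := by
  simp only [fourierOp, Matrix.conjTranspose_sum, Matrix.conjTranspose_smul, hX, star_chi, neg_mul]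

theorem fourierOp_mul (X Y : Site L → FockOp L) (k k' : Site L) :
    fourierOp X k * fourierOp Y k' =
      ∑ m, ∑ n, (chi L (-(k * m)) * chi L (-(k' * n))) • (X m * Y n) := by
  simp only [fourierOp, Finset.sum_mul_sum, smul_mul_smul_comm]

theorem fourierOp_anticomm_of_clifford {X : Site L → FockOp L}
    (hX : ∀ m n, X m * X n + X n * X m = if m = n then 2 else 0) (k k' : Site L) :
    fourierOp X k * fourierOp X k' + fourierOp X k' * fourierOp X k =
      if k + k' = 0 then ((2 * L : ℂ)) • (1 : FockOp L) else 0 := by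
  rw [fourierOp_mul, fourierOp_mul, Finset.sum_comm (f := fun m n =>
    (chi L (-(k' * m)) * chi L (-(k * n))) • (X m * X n)), ← Finset.sum_add_distrib]
  have h1 : ∀ m, (∑ n, (chi L (-(k * m)) * chi L (-(k' * n))) • (X m * X n)) +
      ∑ n, (chi L (-(k' * n)) * chi L (-(k * m))) • (X n * X m) =
      (2 * chi L (m * (-(k + k')))) • (1 : FockOp L) := by
    intro m
    rw [← Finset.sum_add_distrib, Finset.sum_eq_single m]
    · rw [mul_comm (chi L (-(k' * m))), ← smul_add, hX, if_pos rfl, ← AddChar.map_add_eq_mul,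
        ← one_add_one_eq_two, smul_add, ← add_smul]
      congr 1
      rw [show -(k * m) + -(k' * m) = m * (-(k + k')) by ring]
      ring
    · intro n _ hn
      rw [mul_comm (chi L (-(k' * n))), ← smul_add, hX, if_neg (Ne.symm hn), smul_zero]
    · simp
  rw [Finset.sum_congr rfl fun m _ => h1 m, ← Finset.sum_smul, ← Finset.mul_sum, sum_chi_mul]
  simp only [neg_eq_zero]
  split_ifs <;> simp

theorem fourierOp_anticomm_of_anticommute {X Y : Site L → FockOp L}
    (hXY : ∀ m n, X m * Y n + Y n * X m = 0) (k k' : Site L) :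
    fourierOp X k * fourierOp Y k' + fourierOp Y k' * fourierOp X k = 0 := by
  rw [fourierOp_mul, fourierOp_mul, Finset.sum_comm (f := fun m n =>
    (chi L (-(k' * m)) * chi L (-(k * n))) • (Y m * X n)), ← Finset.sum_add_distrib]
  refine Finset.sum_eq_zero fun m _ => ?_
  rw [← Finset.sum_add_distrib]
  refine Finset.sum_eq_zero fun n _ => ?_
  rw [mul_comm (chi L (-(k' * n))), ← smul_add, hXY, smul_zero]

theorem sum_chi_smul_fourierOp (X : Site L → FockOp L) (m : Site L) :
    ∑ k, chi L (k * m) • fourierOp X k = (L : ℂ) • X m := by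
  simp only [fourierOp, Finset.smul_sum, smul_smul]
  rw [Finset.sum_comm]
  simp only [← AddChar.map_add_eq_mul, ← Finset.sum_smul]
  have : ∀ n, (∑ k, chi L (k * m + -(k * n))) = if n = m then (L : ℂ) else 0 := by
    intro n
    have h : ∑ k, chi L (k * m + -(k * n)) = ∑ k, chi L (k * (m - n)) :=
      Finset.sum_congr rfl fun k _ => by congr 1; ring
    rw [h, sum_chi_mul]
    simp only [sub_eq_zero, eq_comm]
  simp [this]

/-- The polar decomposition `f(e^{2 π i k / L}) = r_k φ_k`, with `r_k > 0` and `|φ_k| = 1`, of the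
symbol at the `L`-th roots of unity. -/
structure IsPolar (t : ℤ →₀ ℝ) (r : Site L → ℝ) (φ : Site L → ℂ) : Prop where
  pos : ∀ k, 0 < r k
  unit : ∀ k, star (φ k) * φ k = 1
  even : ∀ k, r (-k) = r k
  star_phase : ∀ k, φ (-k) = star (φ k)
  eq : ∀ k, symbol t (chi L k) = r k * φ k

/-- The operator `g_k - i φ̄_k g̃_k`, where `g_k` and `g̃_k` are the Fourier modes of the two kinds
of Majorana operators. Up to normalisation, these are the Bogoliubov modes that annihilate the
ground state. -/
def bogoliubov (φ : Site L → ℂ) (k : Site L) : FockOp L :=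
  fourierOp (majorana L) k - (Complex.I * star (φ k)) • fourierOp (majoranaTilde L) k

/-- The contributions of the two kinds of Majorana operators to the anticommutator cancel, as
`φ̄_k φ̄_{-k} = 1`. -/
theorem bogoliubov_anticommute {t : ℤ →₀ ℝ} {r : Site L → ℝ} {φ : Site L → ℂ}
    (h : IsPolar t r φ) (k k' : Site L) :
    bogoliubov φ k * bogoliubov φ k' + bogoliubov φ k' * bogoliubov φ k = 0 := by
  have h1 := fourierOp_anticomm_of_clifford (majorana_anticomm (L := L)) k k'
  have h2 := fourierOp_anticomm_of_clifford (majoranaTilde_anticomm (L := L)) k k'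
  have h3 := fourierOp_anticomm_of_anticommute (majoranaTilde_majorana_anticommute (L := L)) k k'
  have h4 := fourierOp_anticomm_of_anticommute (majoranaTilde_majorana_anticommute (L := L)) k' k
  unfold bogoliubov
  set g := fourierOp (majorana L)
  set g' := fourierOp (majoranaTilde L)
  have e : (g k - (Complex.I * star (φ k)) • g' k) * (g k' - (Complex.I * star (φ k')) • g' k') +
      (g k' - (Complex.I * star (φ k')) • g' k') * (g k - (Complex.I * star (φ k)) • g' k) =
      (g k * g k' + g k' * g k) - (Complex.I * star (φ k)) • (g' k * g k' + g k' * g' k)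
      - (Complex.I * star (φ k')) • (g' k' * g k + g k * g' k') -
      (star (φ k) * star (φ k')) • (g' k * g' k' + g' k' * g' k) := by
    have hI : (Complex.I * star (φ k)) * (Complex.I * star (φ k')) =
        -(star (φ k) * star (φ k')) := by
      linear_combination (star (φ k) * star (φ k')) * Complex.I_mul_I
    simp only [sub_mul, mul_sub, smul_mul_assoc, mul_smul_comm, smul_add, smul_sub, smul_smul]
    rw [mul_comm (Complex.I * star (φ k')), hI]
    simp only [neg_smul]
    abel
  rw [e, h1, h2, h3, h4]
  split_ifs with hk
  · have : k' = -k := by rw [eq_neg_iff_add_eq_zero, add_comm]; exact hk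
    rw [this, h.star_phase, star_star, h.unit]
    simp
  · simp

theorem hamiltonian_eq_sum_fourierOp (t : ℤ →₀ ℝ) :
    (L : ℂ) • hamiltonian L t = (Complex.I / 2) •
      ∑ k, symbol t (chi L k) •
        (fourierOp (majoranaTilde L) (-k) * fourierOp (majorana L) k) := by
  have key : ∀ α : ℤ, ∑ k : Site L, chi L k ^ α •
      (fourierOp (majoranaTilde L) (-k) * fourierOp (majorana L) k) =
      (L : ℂ) • ∑ n : Site L, majoranaTilde L n * majorana L (n + (α : Site L)) := by
    intro α
    have h1 : ∀ n : Site L, (L : ℂ) • (majoranaTilde L n * majorana L (n + (α : Site L))) =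
        ∑ k : Site L, (chi L (k * α) * chi L (k * n)) •
          (majoranaTilde L n * fourierOp (majorana L) k) := by
      intro n
      rw [← mul_smul_comm, ← sum_chi_smul_fourierOp, Finset.mul_sum]
      refine Finset.sum_congr rfl fun k _ => ?_
      rw [mul_smul_comm, ← AddChar.map_add_eq_mul, mul_add, add_comm]
    rw [Finset.smul_sum, Finset.sum_congr rfl fun n _ => h1 n, Finset.sum_comm]
    refine Finset.sum_congr rfl fun k _ => ?_
    rw [chi_zpow]
    conv_lhs => rw [fourierOp]
    rw [Finset.sum_mul, Finset.smul_sum]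
    refine Finset.sum_congr rfl fun n _ => ?_
    rw [smul_mul_assoc, smul_smul, neg_mul, neg_neg]
  unfold hamiltonian symbol Finsupp.sum
  simp only [Finset.sum_smul]
  rw [Finset.sum_comm, Finset.smul_sum, Finset.smul_sum]
  refine Finset.sum_congr rfl fun α _ => ?_
  simp only [mul_smul]
  rw [← Finset.smul_sum, key]
  simp only [smul_smul]
  congr 1
  ring

/-- Up to a constant, the Hamiltonian is a positive combination of the operators `A_k† A_k`, where
`A_k` are the Bogoliubov modes. -/
theorem hamiltonian_eq_sum_bogoliubov {t : ℤ →₀ ℝ} {r : Site L → ℝ} {φ : Site L → ℂ}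
    (h : IsPolar t r φ) :
    (4 * L : ℂ) • hamiltonian L t =
      ∑ k, (r k : ℂ) • ((bogoliubov φ k).conjTranspose * bogoliubov φ k) -
        (2 * L * ∑ k, (r k : ℂ)) • (1 : FockOp L) := by
  set g := fourierOp (majorana L) with hg
  set g' := fourierOp (majoranaTilde L) with hg'
  have hA : ∀ k, (bogoliubov φ k).conjTranspose * bogoliubov φ k =
      g (-k) * g k + g' (-k) * g' k + (Complex.I * φ k) • (g' (-k) * g k) -
        (Complex.I * star (φ k)) • (g (-k) * g' k) := by
    intro k
    have hI : (Complex.I * φ k) * (Complex.I * star (φ k)) = -1 := by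
      have := h.unit k
      linear_combination (star (φ k) * φ k) * Complex.I_mul_I - this
    rw [bogoliubov, Matrix.conjTranspose_sub, Matrix.conjTranspose_smul,
      conjTranspose_fourierOp conjTranspose_majorana,
      conjTranspose_fourierOp conjTranspose_majoranaTilde]
    have : star (Complex.I * star (φ k)) = -(Complex.I * φ k) := by
      simp [mul_comm]
    rw [this, ← hg, ← hg']
    simp only [add_mul, mul_sub, smul_mul_assoc, mul_smul_comm, smul_smul, smul_add, neg_smul,
      sub_neg_eq_add]
    rw [mul_comm (Complex.I * star (φ k)), hI]
    simp only [neg_smul, one_smul]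
    abel
  have hneg : ∀ F : Site L → FockOp L, ∑ k, F (-k) = ∑ k, F k := fun F =>
    Equiv.sum_comp (Equiv.neg _) F
  have hdiag : ∀ X : Site L → FockOp L,
      (∀ m n, X m * X n + X n * X m = if m = n then 2 else 0) →
      ∑ k, (r k : ℂ) • (fourierOp X (-k) * fourierOp X k) =
        (L * ∑ k, (r k : ℂ)) • (1 : FockOp L) := by
    intro X hX
    have h2 : (2 : ℂ) • ∑ k, (r k : ℂ) • (fourierOp X (-k) * fourierOp X k) =
        (2 : ℂ) • (L * ∑ k, (r k : ℂ)) • (1 : FockOp L) := by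
      rw [two_smul]
      nth_rewrite 2 [← hneg]
      rw [← Finset.sum_add_distrib, smul_smul, Finset.mul_sum, Finset.mul_sum, Finset.sum_smul]
      refine Finset.sum_congr rfl fun k _ => ?_
      rw [h.even, neg_neg, ← smul_add, fourierOp_anticomm_of_clifford hX, if_pos (by simp),
        smul_smul]
      congr 1
      ring
    exact smul_right_injective _ (two_ne_zero) h2
  have hcross : ∑ k, (r k : ℂ) • ((Complex.I * star (φ k)) • (g (-k) * g' k)) =
      -∑ k, (r k : ℂ) • ((Complex.I * φ k) • (g' (-k) * g k)) := by
    rw [← hneg, ← Finset.sum_neg_distrib]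
    refine Finset.sum_congr rfl fun k _ => ?_
    have h3 :=
      fourierOp_anticomm_of_anticommute (majoranaTilde_majorana_anticommute (L := L)) (-k) k
    rw [h.even, h.star_phase, star_star, neg_neg, hg, hg', eq_neg_of_add_eq_zero_right h3]
    simp
  have hH := hamiltonian_eq_sum_fourierOp (L := L) t
  rw [mul_smul, hH]
  simp only [hA, smul_add, smul_sub, Finset.sum_add_distrib, Finset.sum_sub_distrib]
  rw [hdiag _ majorana_anticomm, hdiag _ majoranaTilde_anticomm, hcross, sub_neg_eq_add]
  have e : ∀ k, symbol t (chi L k) • (g' (-k) * g k) =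
      (-Complex.I) • ((r k : ℂ) • ((Complex.I * φ k) • (g' (-k) * g k))) := by
    intro k
    rw [h.eq, smul_smul, smul_smul]
    congr 1
    linear_combination ((r k : ℂ) * φ k) * Complex.I_mul_I
  simp only [← hg, ← hg', e]
  rw [← Finset.smul_sum, smul_smul, smul_smul]
  have : (4 : ℂ) * (Complex.I / 2) * -Complex.I = 2 := by
    linear_combination (-2 : ℂ) * Complex.I_mul_I
  rw [this, two_smul]
  have h2L : (2 * L * ∑ k, (r k : ℂ)) • (1 : FockOp L) =
      (L * ∑ k, (r k : ℂ)) • (1 : FockOp L) + (L * ∑ k, (r k : ℂ)) • (1 : FockOp L) := by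
    rw [← add_smul]; congr 1; ring
  rw [h2L]
  abel

end Fourier

/-! ### The ground state and Wick's theorem -/

section Wick

variable {L : ℕ} [NeZero L]

theorem expectation_add (ψ : FockVec L) (A B : FockOp L) :
    expectation ψ (A + B) = expectation ψ A + expectation ψ B := by
  simp [expectation, Matrix.add_mulVec]

theorem expectation_sub (ψ : FockVec L) (A B : FockOp L) :
    expectation ψ (A - B) = expectation ψ A - expectation ψ B := by
  simp [expectation, Matrix.sub_mulVec]

theorem expectation_smul (ψ : FockVec L) (c : ℂ) (A : FockOp L) :
    expectation ψ (c • A) = c * expectation ψ A := by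
  simp [expectation, Matrix.smul_mulVec]

theorem expectation_sum {ι : Type*} (s : Finset ι) (ψ : FockVec L) (A : ι → FockOp L) :
    expectation ψ (∑ i ∈ s, A i) = ∑ i ∈ s, expectation ψ (A i) := by
  classical
  induction s using Finset.induction with
  | empty => simp [expectation]
  | insert a s ha ih => rw [Finset.sum_insert ha, Finset.sum_insert ha, expectation_add, ih]

theorem expectation_conjTranspose_mul (ψ : FockVec L) (A B : FockOp L) :
    expectation ψ (A.conjTranspose * B) = star (A.mulVec ψ) ⬝ᵥ B.mulVec ψ := by
  rw [expectation, ← Matrix.mulVec_mulVec, Matrix.star_mulVec, Matrix.dotProduct_mulVec]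

theorem star_dotProduct_self (ψ : FockVec L) :
    star ψ ⬝ᵥ ψ = ((∑ S, ‖ψ S‖ ^ 2 : ℝ) : ℂ) := by
  simp only [dotProduct, Pi.star_apply, Complex.ofReal_sum]
  refine Finset.sum_congr rfl fun S _ => ?_
  simpa using Complex.conj_mul' (ψ S)

theorem exists_isState_smul {ψ : FockVec L} (hψ : ψ ≠ 0) : ∃ c : ℂ, IsState (c • ψ) := by
  have hpos : 0 < ∑ S, ‖ψ S‖ ^ 2 := by
    obtain ⟨S, hS⟩ := Function.ne_iff.mp hψ
    exact Finset.sum_pos' (fun _ _ => by positivity)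
      ⟨S, Finset.mem_univ S, by have := norm_pos_iff.mpr hS; positivity⟩
  refine ⟨((√(∑ S, ‖ψ S‖ ^ 2))⁻¹ : ℝ), ?_⟩
  rw [IsState, star_smul, smul_dotProduct, dotProduct_smul, star_dotProduct_self]
  simp only [smul_eq_mul, Complex.star_def, Complex.conj_ofReal]
  norm_cast
  rw [← mul_assoc, ← mul_inv, Real.mul_self_sqrt hpos.le, inv_mul_cancel₀ hpos.ne']

/-- Pairwise anticommuting operators with square zero have a common null vector: apply to a common
null vector of the first ones the next one, unless it already annihilates it. -/
theorem exists_common_null_vector {ι : Type*} [Fintype ι] (A : ι → FockOp L)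
    (hA : ∀ k k', A k * A k' + A k' * A k = 0) :
    ∃ v : FockVec L, v ≠ 0 ∧ ∀ k, (A k).mulVec v = 0 := by
  classical
  suffices H : ∀ s : Finset ι, ∃ v : FockVec L, v ≠ 0 ∧ ∀ k ∈ s, (A k).mulVec v = 0 by
    simpa using H Finset.univ
  intro s
  induction s using Finset.induction with
  | empty => exact ⟨Pi.single ∅ 1, by simp, by simp⟩
  | insert a s ha ih =>
    obtain ⟨v, hv, hs⟩ := ih
    by_cases h0 : (A a).mulVec v = 0
    · exact ⟨v, hv, by simpa [h0] using hs⟩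
    · refine ⟨(A a).mulVec v, h0, fun k hk => ?_⟩
      have e : (A k).mulVec ((A a).mulVec v) = -(A a).mulVec ((A k).mulVec v) := by
        rw [Matrix.mulVec_mulVec, Matrix.mulVec_mulVec, ← Matrix.neg_mulVec,
          eq_neg_of_add_eq_zero_left (hA k a)]
      rcases Finset.mem_insert.mp hk with rfl | hk
      · have : (2 : ℂ) • (A k).mulVec ((A k).mulVec v) = 0 := by
          rw [two_smul]
          nth_rewrite 1 [e]
          simp
        exact (smul_eq_zero.mp this).resolve_left two_ne_zero
      · rw [e, hs k hk, Matrix.mulVec_zero, neg_zero]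

theorem energy_eq {t : ℤ →₀ ℝ} {r : Site L → ℝ} {φ : Site L → ℂ} (h : IsPolar t r φ)
    {ψ : FockVec L} (hψ : IsState ψ) :
    4 * L * (expectation ψ (hamiltonian L t)).re =
      ∑ k, r k * ∑ S, ‖(bogoliubov φ k).mulVec ψ S‖ ^ 2 - 2 * L * ∑ k, r k := by
  have h1 := congrArg (expectation ψ) (hamiltonian_eq_sum_bogoliubov (L := L) h)
  rw [expectation_smul, expectation_sub, expectation_sum, expectation_smul] at h1
  have h2 : expectation ψ 1 = 1 := by rw [expectation, Matrix.one_mulVec]; exact hψ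
  simp only [expectation_smul, expectation_conjTranspose_mul, star_dotProduct_self, h2] at h1
  have h3 := congrArg Complex.re h1
  have e1 : (4 * L * expectation ψ (hamiltonian L t)).re =
      4 * L * (expectation ψ (hamiltonian L t)).re := by
    rw [← Complex.re_ofReal_mul]; push_cast; rfl
  rw [e1] at h3
  rw [h3]
  have e2 : (∑ k, (r k : ℂ) * ((∑ S, ‖(bogoliubov φ k).mulVec ψ S‖ ^ 2 : ℝ) : ℂ) -
      2 * L * (∑ k, (r k : ℂ)) * 1) =
      ((∑ k, r k * ∑ S, ‖(bogoliubov φ k).mulVec ψ S‖ ^ 2 - 2 * L * ∑ k, r k : ℝ) : ℂ) := by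
    push_cast; ring
  rw [e2, Complex.ofReal_re]

/-- A common null vector of the Bogoliubov modes has the least possible energy, and every vector of
that energy is such a null vector. -/
theorem IsGroundState.bogoliubov_mulVec {t : ℤ →₀ ℝ} {r : Site L → ℝ} {φ : Site L → ℂ}
    (h : IsPolar t r φ) {ψ : FockVec L} (hψ : IsGroundState t ψ) (k : Site L) :
    (bogoliubov φ k).mulVec ψ = 0 := by
  obtain ⟨v, hv, hnull⟩ := exists_common_null_vector _ (bogoliubov_anticommute h)
  obtain ⟨c, hc⟩ := exists_isState_smul hv
  have hle := hψ.2 _ hc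
  have e1 := energy_eq h hψ.1
  have e2 := energy_eq h hc
  simp only [Matrix.mulVec_smul, hnull, smul_zero, Pi.zero_apply, norm_zero] at e2
  have hL : (0 : ℝ) < L := by exact_mod_cast Nat.pos_of_ne_zero (NeZero.ne L)
  have hsum : ∑ k, r k * ∑ S, ‖(bogoliubov φ k).mulVec ψ S‖ ^ 2 ≤ 0 := by
    have := mul_le_mul_of_nonneg_left hle (by positivity : (0 : ℝ) ≤ 4 * L)
    rw [e1, e2] at this
    simpa using this
  have hnn : ∀ k ∈ Finset.univ, 0 ≤ r k * ∑ S, ‖(bogoliubov φ k).mulVec ψ S‖ ^ 2 := fun k _ =>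
    mul_nonneg (h.pos k).le (Finset.sum_nonneg fun _ _ => by positivity)
  have h0 := (Finset.sum_eq_zero_iff_of_nonneg hnn).mp
    (le_antisymm hsum (Finset.sum_nonneg hnn)) k (Finset.mem_univ k)
  have h1 := (mul_eq_zero.mp h0).resolve_left (h.pos k).ne'
  funext S
  have h2 := (Finset.sum_eq_zero_iff_of_nonneg (fun _ _ => by positivity)).mp h1 S
    (Finset.mem_univ S)
  simpa using h2

/-- The `d`-th discrete Fourier coefficient `L⁻¹ ∑_k φ_k e^{-2 π i k d / L}` of `φ`. -/
def phaseCoeff (φ : Site L → ℂ) (d : Site L) : ℂ :=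
  (L : ℂ)⁻¹ * ∑ k, φ k * chi L (-(k * d))

theorem star_phaseCoeff {φ : Site L → ℂ} (hφ : ∀ k, φ (-k) = star (φ k)) (d : Site L) :
    star (phaseCoeff φ d) = phaseCoeff φ d := by
  unfold phaseCoeff
  rw [star_mul', star_sum]
  congr 1
  · simp
  · rw [← Equiv.sum_comp (Equiv.neg _)]
    refine Finset.sum_congr rfl fun k _ => ?_
    rw [star_mul', star_chi, Equiv.neg_apply, hφ, star_star]
    simp

/-- The combination of the operators `γ̃_n` that `-i γ_m` agrees with on the ground state. -/
def rotated (φ : Site L → ℂ) (m : Site L) : FockOp L :=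
  ∑ n, phaseCoeff φ (m - n) • majoranaTilde L n

theorem conjTranspose_rotated {φ : Site L → ℂ} (hφ : ∀ k, φ (-k) = star (φ k)) (m : Site L) :
    (rotated φ m).conjTranspose = rotated φ m := by
  simp only [rotated, Matrix.conjTranspose_sum, Matrix.conjTranspose_smul,
    conjTranspose_majoranaTilde, star_phaseCoeff hφ]

theorem rotated_anticomm (φ : Site L → ℂ) (m n : Site L) :
    rotated φ m * majoranaTilde L n + majoranaTilde L n * rotated φ m =
      (2 * phaseCoeff φ (m - n)) • (1 : FockOp L) := by
  simp only [rotated, Finset.sum_mul, Finset.mul_sum, smul_mul_assoc, mul_smul_comm]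
  rw [← Finset.sum_add_distrib, Finset.sum_eq_single n]
  · rw [← smul_add, majoranaTilde_anticomm, if_pos rfl, mul_comm, mul_smul]
    congr 1
    rw [two_smul, one_add_one_eq_two]
  · intro k _ hk
    rw [← smul_add, majoranaTilde_anticomm, if_neg hk, smul_zero]
  · simp

theorem rotated_majorana_anticommute (φ : Site L → ℂ) (m n : Site L) :
    rotated φ m * majorana L n = -(majorana L n * rotated φ m) := by
  rw [eq_neg_iff_add_eq_zero]
  simp only [rotated, Finset.sum_mul, Finset.mul_sum, smul_mul_assoc, mul_smul_comm]
  rw [← Finset.sum_add_distrib]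
  refine Finset.sum_eq_zero fun k _ => ?_
  rw [← smul_add, majoranaTilde_majorana_anticommute, smul_zero]

theorem IsGroundState.majorana_mulVec {t : ℤ →₀ ℝ} {r : Site L → ℝ} {φ : Site L → ℂ}
    (h : IsPolar t r φ) {ψ : FockVec L} (hψ : IsGroundState t ψ) (m : Site L) :
    (majorana L m).mulVec ψ = Complex.I • (rotated φ m).mulVec ψ := by
  have hL : (L : ℂ) ≠ 0 := by exact_mod_cast NeZero.ne L
  have h1 : ∀ k, (fourierOp (majorana L) k).mulVec ψ =
      (Complex.I * star (φ k)) • (fourierOp (majoranaTilde L) k).mulVec ψ := by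
    intro k
    have := hψ.bogoliubov_mulVec h k
    rw [bogoliubov, Matrix.sub_mulVec, Matrix.smul_mulVec, sub_eq_zero] at this
    exact this
  have h2 : (L : ℂ) • (majorana L m).mulVec ψ =
      (L : ℂ) • Complex.I • (rotated φ m).mulVec ψ := by
    rw [← Matrix.smul_mulVec, ← sum_chi_smul_fourierOp, Matrix.sum_mulVec]
    simp only [Matrix.smul_mulVec, h1]
    simp only [Matrix.smul_mulVec, rotated, fourierOp, Matrix.sum_mulVec, Finset.smul_sum,
      smul_smul]
    rw [Finset.sum_comm]
    refine Finset.sum_congr rfl fun n _ => ?_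
    rw [← Finset.sum_smul, ← star_phaseCoeff h.star_phase, phaseCoeff, star_mul', star_sum,
      star_inv₀, star_natCast]
    congr 1
    rw [mul_left_comm (L : ℂ), mul_inv_cancel_left₀ hL, Finset.mul_sum]
    refine Finset.sum_congr rfl fun k _ => ?_
    rw [star_mul', star_chi, neg_neg, mul_sub, sub_eq_add_neg, AddChar.map_add_eq_mul]
    ring
  exact smul_right_injective _ hL h2

/-- The product `γ̃_{x_0} γ̃_{x_1} ⋯`. -/
def tildeProd {N : ℕ} (x : Fin N → Site L) : FockOp L :=
  (List.ofFn fun i => majoranaTilde L (x i)).prod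

/-- The product `⋯ γ_{y_1} γ_{y_0}`, in reversed order. -/
def revProd {N : ℕ} (y : Fin N → Site L) : FockOp L :=
  (List.ofFn fun i => majorana L (y i)).reverse.prod

theorem tildeProd_succ {N : ℕ} (x : Fin (N + 1) → Site L) :
    tildeProd x = majoranaTilde L (x 0) * tildeProd (fun i => x i.succ) := by
  simp [tildeProd, List.ofFn_succ]

theorem revProd_succ {N : ℕ} (y : Fin (N + 1) → Site L) :
    revProd y = revProd (fun i => y i.succ) * majorana L (y 0) := by
  simp [revProd, List.ofFn_succ]

theorem mul_list_prod_of_anticommute {b : FockOp L} (l : List (FockOp L))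
    (h : ∀ a ∈ l, b * a = -(a * b)) : b * l.prod = (-1 : ℂ) ^ l.length • (l.prod * b) := by
  induction l with
  | nil => simp
  | cons a l ih =>
    rw [List.prod_cons, ← mul_assoc, h a (by simp), neg_mul, mul_assoc,
      ih fun a' ha' => h a' (by simp [ha']), mul_smul_comm, List.length_cons, pow_succ]
    simp [mul_assoc]

/-- Moving `b` through the product leaves one contraction for each factor; the `match` supplies the
product without the `j`-th factor, which only exists for `N > 0`. -/
theorem mul_tildeProd_of_anticomm {b : FockOp L} {c : Site L → ℂ}
    (h : ∀ n, b * majoranaTilde L n + majoranaTilde L n * b = c n • (1 : FockOp L)) {N : ℕ}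
    (x : Fin N → Site L) :
    (b * tildeProd x = ∑ j : Fin N, ((-1 : ℂ) ^ (j : ℕ) * c (x j)) •
      (match N, x, j with | _ + 1, x, j => tildeProd fun i => x (j.succAbove i)) +
      (-1 : ℂ) ^ N • (tildeProd x * b)) := by
  induction N with
  | zero => simp [tildeProd]
  | succ N ih =>
    have h0 : b * majoranaTilde L (x 0) = c (x 0) • 1 - majoranaTilde L (x 0) * b :=
      eq_sub_of_add_eq (h _)
    rw [tildeProd_succ, ← mul_assoc, h0, sub_mul, smul_mul_assoc, one_mul, mul_assoc, ih,
      Fin.sum_univ_succ]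
    rcases N with _ | N
    · simp [tildeProd]
      abel
    · simp only [mul_add, Finset.mul_sum, mul_smul_comm, Fin.succAbove_zero, Fin.val_zero, pow_zero,
        one_mul, Fin.val_succ]
      rw [sub_eq_add_neg, neg_add, ← add_assoc, ← Finset.sum_neg_distrib]
      congr 1
      · congr 1
        refine Finset.sum_congr rfl fun j _ => ?_
        rw [tildeProd_succ (fun i => x (j.succ.succAbove i)), ← neg_smul]
        simp only [Fin.succ_succAbove_zero, Fin.succ_succAbove_succ]
        congr 1
        ring
      · rw [← neg_smul, mul_assoc, pow_succ (-1 : ℂ) (N + 1)]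
        congr 1
        ring

theorem majorana_mul_tildeProd (n : Site L) {N : ℕ} (x : Fin N → Site L) :
    majorana L n * tildeProd x = (-1 : ℂ) ^ N • (tildeProd x * majorana L n) := by
  have := mul_list_prod_of_anticommute (b := majorana L n)
    (List.ofFn fun i => majoranaTilde L (x i)) fun a ha => by
      obtain ⟨i, rfl⟩ := List.mem_ofFn.mp ha
      exact eq_neg_of_add_eq_zero_right (majoranaTilde_majorana_anticommute _ _)
  simpa [tildeProd] using this

theorem mul_revProd_of_anticommute {b : FockOp L} {N : ℕ} (y : Fin N → Site L)
    (h : ∀ i, b * majorana L (y i) = -(majorana L (y i) * b)) :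
    b * revProd y = (-1 : ℂ) ^ N • (revProd y * b) := by
  have := mul_list_prod_of_anticommute (b := b)
    (List.ofFn fun i => majorana L (y i)).reverse fun a ha => by
      obtain ⟨i, rfl⟩ := List.mem_ofFn.mp (List.mem_reverse.mp ha)
      exact h i
  simpa [revProd] using this

/-- Wick's theorem. The last operator `γ_{y_0}` equals `i b` on the right and, after it is moved
to the left of the others, `-i b` on the left, where `b` is a combination of the `γ̃_n`. Moving `b`
through the product therefore leaves only its contractions with the `γ̃_{x_j}`, which is the
Laplace expansion of the determinant along the first column. -/
theorem expectation_tildeProd_mul_revProd {t : ℤ →₀ ℝ} {r : Site L → ℝ} {φ : Site L → ℂ}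
    (h : IsPolar t r φ) {ψ : FockVec L} (hψ : IsGroundState t ψ) {N : ℕ} (x y : Fin N → Site L)
    (hy : Function.Injective y) :
    expectation ψ (tildeProd x * revProd y) =
      (Matrix.of fun i j => Complex.I * phaseCoeff φ (y j - x i)).det := by
  induction N with
  | zero =>
    have := hψ.1
    rw [IsState] at this
    simpa [tildeProd, revProd, expectation] using this
  | succ N ih =>
    set y' : Fin N → Site L := fun i => y i.succ with hy'
    set b := rotated φ (y 0) with hb
    set X := tildeProd x * revProd y' with hX
    have hne : ∀ i, y 0 ≠ y' i := fun i hi => Fin.succ_ne_zero i (hy hi).symm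
    have hright : expectation ψ (X * majorana L (y 0)) = Complex.I * expectation ψ (X * b) := by
      rw [expectation, expectation, ← Matrix.mulVec_mulVec, hψ.majorana_mulVec h,
        Matrix.mulVec_smul, Matrix.mulVec_mulVec, dotProduct_smul, smul_eq_mul]
    have hleft : expectation ψ (majorana L (y 0) * X) = -Complex.I * expectation ψ (b * X) := by
      have e : expectation ψ (b * X) = star (b.mulVec ψ) ⬝ᵥ X.mulVec ψ := by
        rw [← expectation_conjTranspose_mul, hb, conjTranspose_rotated h.star_phase]
      rw [← conjTranspose_majorana, expectation_conjTranspose_mul, hψ.majorana_mulVec h, e,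
        star_smul, smul_dotProduct]
      simp [hb]
    have hmove : majorana L (y 0) * X = -(X * majorana L (y 0)) := by
      rw [hX, ← mul_assoc, majorana_mul_tildeProd, smul_mul_assoc, mul_assoc (tildeProd x),
        mul_revProd_of_anticommute y' fun i =>
          eq_neg_of_add_eq_zero_left (majorana_anticommute (hne i)),
        mul_smul_comm, smul_smul, ← pow_add, ← mul_assoc, show N + 1 + N = 2 * N + 1 by ring,
        pow_succ, pow_mul]
      simp
    have hb1 : b * X = ∑ j : Fin (N + 1), ((-1 : ℂ) ^ (j : ℕ) * (2 * phaseCoeff φ (y 0 - x j))) •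
        (tildeProd (fun i => x (j.succAbove i)) * revProd y') - X * b := by
      rw [hX, ← mul_assoc, mul_tildeProd_of_anticomm (rotated_anticomm φ (y 0)), add_mul,
        smul_mul_assoc, mul_assoc (tildeProd x), mul_revProd_of_anticommute y' fun i =>
          rotated_majorana_anticommute φ _ _, mul_smul_comm, smul_smul, ← pow_add,
        show N + 1 + N = 2 * N + 1 by ring, pow_succ, pow_mul, Finset.sum_mul]
      simp [sub_eq_add_neg, mul_assoc, hb]
    have hsum := congrArg (expectation ψ) hb1
    rw [expectation_sub, expectation_sum] at hsum
    have hmove' := congrArg (expectation ψ) hmove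
    rw [hleft, ← neg_one_smul ℂ (X * _), expectation_smul] at hmove'
    rw [revProd_succ, ← mul_assoc, ← hX, Matrix.det_succ_column_zero]
    have hcol : ∀ j : Fin (N + 1), (-1 : ℂ) ^ (j : ℕ) *
        (Matrix.of fun i j => Complex.I * phaseCoeff φ (y j - x i)) j 0 *
        ((Matrix.of fun i j => Complex.I * phaseCoeff φ (y j - x i)).submatrix j.succAbove
          Fin.succ).det =
        (Complex.I / 2) * expectation ψ (((-1 : ℂ) ^ (j : ℕ) * (2 * phaseCoeff φ (y 0 - x j))) •
          (tildeProd (fun i => x (j.succAbove i)) * revProd y')) := by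
      intro j
      rw [expectation_smul, ih _ _ fun i i' hii => Fin.succ_injective _ (hy hii)]
      have : ((Matrix.of fun i j => Complex.I * phaseCoeff φ (y j - x i)).submatrix j.succAbove
          Fin.succ) = Matrix.of fun i i' => Complex.I * phaseCoeff φ (y' i' - x (j.succAbove i)) :=
        rfl
      rw [this, Matrix.of_apply]
      ring
    rw [Finset.sum_congr rfl fun j _ => hcol j, ← Finset.mul_sum]
    linear_combination (1 / 2 : ℂ) * hright + (1 / 2 : ℂ) * hmove' + (Complex.I / 2) * hsum

theorem prod_pairs_eq {N : ℕ} (x y : Fin N → Site L) (hy : Function.Injective y) :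
    (List.ofFn fun i => Complex.I • (majoranaTilde L (x i) * majorana L (y i))).prod =
      Complex.I ^ N • (tildeProd x * revProd y) := by
  induction N with
  | zero => simp [tildeProd, revProd]
  | succ N ih =>
    rw [List.ofFn_succ, List.prod_cons, ih _ _ fun i i' hii => Fin.succ_injective _ (hy hii),
      tildeProd_succ, revProd_succ]
    set T := tildeProd fun i => x i.succ
    set R := revProd fun i => y i.succ
    have h1 : majorana L (y 0) * (T * R) = T * R * majorana L (y 0) := by
      rw [← mul_assoc, majorana_mul_tildeProd, smul_mul_assoc, mul_assoc T,
        mul_revProd_of_anticommute _ fun i => eq_neg_of_add_eq_zero_left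
          (majorana_anticommute fun hi => Fin.succ_ne_zero i (hy hi).symm),
        mul_smul_comm, smul_smul, ← pow_add, ← mul_assoc, ← two_mul, pow_mul]
      simp [R]
    rw [smul_mul_smul_comm, ← pow_succ', mul_assoc, h1]
    simp only [mul_assoc]

theorem expectation_prod_pairs {t : ℤ →₀ ℝ} {r : Site L → ℝ} {φ : Site L → ℂ}
    (h : IsPolar t r φ) {ψ : FockVec L} (hψ : IsGroundState t ψ) {N : ℕ} (x y : Fin N → Site L)
    (hy : Function.Injective y) :
    expectation ψ (List.ofFn fun i => Complex.I • (majoranaTilde L (x i) * majorana L (y i))).prod =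
      (-1) ^ N * (Matrix.of fun i j => phaseCoeff φ (y j - x i)).det := by
  rw [prod_pairs_eq x y hy, expectation_smul, expectation_tildeProd_mul_revProd h hψ x y hy]
  have : (Matrix.of fun i j => Complex.I * phaseCoeff φ (y j - x i)) =
      Complex.I • (Matrix.of fun i j => phaseCoeff φ (y j - x i)) := by
    ext i j; simp
  rw [this, Matrix.det_smul, Fintype.card_fin, ← mul_assoc, ← mul_pow, Complex.I_mul_I]

end Wick

/-! ### String correlators as determinants -/

section Strings

variable {L : ℕ} [NeZero L]

theorem list_range'_one_succ_prod (F : ℕ → FockOp L) (N : ℕ) :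
    ((List.range' 1 (N + 1)).map F).prod = ((List.range' 1 N).map F).prod * F (N + 1) := by
  rw [List.range'_1_concat, List.map_append, List.prod_append, add_comm]
  simp

/-- The string `X_{n+1} ⋯ X_{n+a}` becomes `X_n ⋯ X_{n+a-1}` by exchanging one factor at either
end. -/
theorem mul_list_range'_prod (X : ℕ → FockOp L) (n a : ℕ) :
    X n * ((List.range' (n + 1) a).map X).prod = ((List.range' n a).map X).prod * X (n + a) := by
  have h1 : X n * ((List.range' (n + 1) a).map X).prod = ((List.range' n (a + 1)).map X).prod := by
    rw [List.range'_succ, List.map_cons, List.prod_cons]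
  rw [h1, List.range'_1_concat, List.map_append, List.prod_append]
  simp

theorem list_prod_mul_of_anticommute {b : FockOp L} (l : List (FockOp L))
    (h : ∀ a ∈ l, b * a = -(a * b)) : l.prod * b = (-1 : ℂ) ^ l.length • (b * l.prod) := by
  rw [mul_list_prod_of_anticommute l h, smul_smul, ← mul_pow]
  simp

/-- Inserting a string `X_1 ⋯ X_a` before and a translated one after a product of `N` pairs
`Y_m X_m`, all factors `Y` anticommuting with all factors `X`, moves each `X_m` to `X_{m+a}`. -/
theorem string_mul_pairs_mul_string (X Y : ℕ → FockOp L) (hXY : ∀ m n, Y m * X n = -(X n * Y m))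
    (a N : ℕ) :
    ((List.range' 1 a).map X).prod * (((List.range' 1 N).map fun m => Y m * X m).prod *
      ((List.range' (N + 1) a).map X).prod) =
      (-1 : ℂ) ^ (a * N) • (((List.range' 1 a).map X).prod * ((List.range' 1 a).map X).prod *
        ((List.range' 1 N).map fun m => Y m * X (m + a)).prod) := by
  set G := ((List.range' 1 a).map X).prod
  induction N with
  | zero => simp [G]
  | succ N ih =>
    have h1 : ((List.range' (N + 1) a).map X).prod * Y (N + 1) =
        (-1 : ℂ) ^ a • (Y (N + 1) * ((List.range' (N + 1) a).map X).prod) := by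
      have := list_prod_mul_of_anticommute (b := Y (N + 1)) ((List.range' (N + 1) a).map X)
        fun x hx => by
          obtain ⟨m, _, rfl⟩ := List.mem_map.mp hx
          exact hXY _ _
      simpa using this
    have h2 : Y (N + 1) * ((List.range' (N + 1) a).map X).prod =
        (-1 : ℂ) ^ a • (((List.range' (N + 1) a).map X).prod * Y (N + 1)) := by
      rw [h1, smul_smul, ← mul_pow]
      simp
    rw [list_range'_one_succ_prod, list_range'_one_succ_prod, mul_assoc (List.prod _),
      mul_assoc (Y (N + 1)), mul_list_range'_prod, ← mul_assoc (Y (N + 1)), h2]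
    simp only [smul_mul_assoc, mul_smul_comm]
    rw [mul_assoc _ (Y (N + 1)), ← mul_assoc (List.prod _) (List.prod _), ← mul_assoc,
      mul_assoc (List.prod _) (List.prod _), ih,
      smul_mul_assoc, smul_smul, ← pow_add]
    congr 1
    · ring
    · simp only [mul_assoc]

/-- The square of a product of `a` pairwise anticommuting operators with square `c` is
`c ^ a (-1) ^ (a (a - 1) / 2)`, and the sign only depends on `a / 2`. -/
theorem list_range'_prod_mul_self (X : ℕ → FockOp L) (c : ℂ) (a : ℕ) (hX : ∀ m, X m * X m = c • 1)
    (hXX : ∀ m n, 1 ≤ m → m < n → n ≤ a → X n * X m = -(X m * X n)) :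
    ((List.range' 1 a).map X).prod * ((List.range' 1 a).map X).prod =
      (c ^ a * (-1 : ℂ) ^ (a / 2)) • (1 : FockOp L) := by
  induction a with
  | zero => simp
  | succ a ih =>
    set G := ((List.range' 1 a).map X).prod
    have h1 : X (a + 1) * G = (-1 : ℂ) ^ a • (G * X (a + 1)) := by
      have := mul_list_prod_of_anticommute (b := X (a + 1)) ((List.range' 1 a).map X)
        fun x hx => by
          obtain ⟨m, hm, rfl⟩ := List.mem_map.mp hx
          rw [List.mem_range'_1] at hm
          exact hXX m (a + 1) hm.1 (by omega) le_rfl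
      simpa using this
    rw [list_range'_one_succ_prod, mul_assoc G, ← mul_assoc (X (a + 1)), h1, smul_mul_assoc,
      mul_smul_comm, mul_assoc G (X (a + 1)), hX, mul_smul_comm, mul_smul_comm, mul_one,
      ih fun m n hm hmn hn => hXX m n hm hmn (by omega), smul_smul, smul_smul]
    congr 1
    have h2 : (-1 : ℂ) ^ a * (-1) ^ (a / 2) = (-1) ^ ((a + 1) / 2) := by
      rcases Nat.even_or_odd' a with ⟨b, rfl | rfl⟩
      · rw [show 2 * b / 2 = b by omega, show (2 * b + 1) / 2 = b by omega, pow_mul]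
        simp
      · rw [show (2 * b + 1) / 2 = b by omega, show (2 * b + 1 + 1) / 2 = b + 1 by omega,
          pow_succ, pow_mul, pow_succ (-1 : ℂ) b]
        simp
    rw [← h2]
    ring

theorem natCast_site_injOn {m n : ℕ} (hm : 1 ≤ m) (hn : 1 ≤ n) (hmL : m ≤ L) (hnL : n ≤ L)
    (h : (m : Site L) = n) : m = n := by
  rw [ZMod.natCast_eq_natCast_iff] at h
  rcases le_total m n with h' | h'
  · have := (Nat.modEq_iff_dvd' h').mp h
    have := Nat.eq_zero_of_dvd_of_lt this (by omega)
    omega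
  · have := (Nat.modEq_iff_dvd' h').mp h.symm
    have := Nat.eq_zero_of_dvd_of_lt this (by omega)
    omega

/-- The sign by which `𝒪_α(1) 𝒪_α(N+1)` differs from a product of pairs of Majorana operators. -/
def stringSign (α : ℤ) (N : ℕ) : ℂ :=
  (if α < 0 then (-1) ^ α.natAbs else 1) * (-1) ^ (α.natAbs * N)

theorem map_range'_one_eq_ofFn (F : ℕ → FockOp L) (N : ℕ) :
    (List.range' 1 N).map F = List.ofFn fun i : Fin N => F (i + 1) := by
  refine List.ext_getElem (by simp) fun i h1 h2 => ?_
  simp [add_comm]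

theorem pairs_mul_strings (X Y : ℕ → FockOp L) (hXY : ∀ m n, Y m * X n = -(X n * Y m)) (c s : ℂ)
    (a N : ℕ) (hX : ∀ m, X m * X m = c • 1)
    (hXX : ∀ m n, 1 ≤ m → m < n → n ≤ a → X n * X m = -(X m * X n)) :
    s • (1 * ((List.range' 1 a).map X).prod) *
      s • (((List.range' 1 N).map fun m => Y m * X m).prod *
        ((List.range' (N + 1) a).map X).prod) =
      (s * s * (c ^ a * (-1 : ℂ) ^ (a / 2)) * (-1) ^ (a * N)) •
        (List.ofFn fun i : Fin N => Y (i + 1) * X (i + 1 + a)).prod := by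
  rw [smul_mul_smul_comm, one_mul, string_mul_pairs_mul_string X Y hXY,
    list_range'_prod_mul_self X c a hX hXX, smul_mul_assoc, one_mul, smul_smul, smul_smul,
    map_range'_one_eq_ofFn]
  congr 1
  ring

/-- For `α > 0` the pairs are formed by `i γ̃_m` and the string operators `γ_m`, which moves each
`γ_m` by `α`; for `α < 0` they are formed by `γ_m` and the string operators `-i γ̃_m`, which moves
each `γ̃_m` by `|α|`. -/
theorem stringOp_mul_stringOp (α : ℤ) (N : ℕ) (hL : α.natAbs ≤ L) :
    stringOp L α 1 * stringOp L α (N + 1) = stringSign α N •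
      (List.ofFn fun i : Fin N => Complex.I •
        (majoranaTilde L (((i + 1 + (-α).toNat : ℕ)) : Site L) *
          majorana L (((i + 1 + α.toNat : ℕ)) : Site L))).prod := by
  have hpar1 : parityString L 1 = 1 := by simp [parityString]
  have hsign : ∀ b : ℕ, (-1 : ℂ) ^ b * (-1) ^ b = 1 := fun b => by rw [← mul_pow]; simp
  rcases lt_trichotomy α 0 with h | h | h
  · set a := α.natAbs with ha
    have e1 : (-α).toNat = a := by omega
    have e2 : α.toNat = 0 := by omega
    set X : ℕ → FockOp L := fun m => (-Complex.I) • majoranaTilde L (m : Site L) with hX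
    set Y : ℕ → FockOp L := fun m => majorana L (m : Site L) with hY
    have hpair : ∀ m n, Y m * X n = Complex.I • (majoranaTilde L (n : Site L) * majorana L m) := by
      intro m n
      simp only [hX, hY, mul_smul_comm]
      rw [eq_neg_of_add_eq_zero_right (majoranaTilde_majorana_anticommute (n : Site L) m)]
      simp
    have key := pairs_mul_strings X Y (fun m n => by rw [hpair]; simp [hX, hY]) (-1)
      ((-Complex.I) ^ (a / 2)) a N
      (fun m => by
        simp only [hX, smul_mul_smul_comm, majoranaTilde_mul_self, neg_mul_neg, Complex.I_mul_I])
      (fun m n hm hmn hn => by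
        simp only [hX, smul_mul_smul_comm]
        rw [eq_neg_of_add_eq_zero_right (majoranaTilde_anticommute fun h' =>
          hmn.ne (natCast_site_injOn hm (by omega) (by omega) (by omega) h'))]
        simp)
    simp only [hpair] at key
    simp only [stringOp, if_neg (not_lt.mpr h.le), if_pos h, hpar1]
    simp only [parityString, Nat.add_sub_cancel, e1, e2, add_zero, stringSign, if_pos h, ← ha]
    rw [key]
    congr 1
    rw [← mul_pow, neg_mul_neg, Complex.I_mul_I]
    linear_combination (-1 : ℂ) ^ a * (-1) ^ (a * N) * hsign (a / 2)
  · subst h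
    simp [stringOp, stringSign, parityString, map_range'_one_eq_ofFn]
  · set a := α.natAbs with ha
    have e1 : (-α).toNat = 0 := by omega
    have e2 : α.toNat = a := by omega
    set X : ℕ → FockOp L := fun m => majorana L (m : Site L) with hX
    set Y : ℕ → FockOp L := fun m => Complex.I • majoranaTilde L (m : Site L) with hY
    have hpair : ∀ m n, Y m * X n = Complex.I • (majoranaTilde L (m : Site L) * majorana L n) :=
      fun m n => smul_mul_assoc _ _ _
    have key := pairs_mul_strings X Y (fun m n => by
        simp only [hX, hY, smul_mul_assoc, mul_smul_comm]
        rw [eq_neg_of_add_eq_zero_left (majoranaTilde_majorana_anticommute _ _), smul_neg]) 1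
      (Complex.I ^ (a / 2)) a N
      (fun m => by simp [hX, majorana_mul_self])
      (fun m n hm hmn hn => by
        rw [eq_neg_of_add_eq_zero_right (majorana_anticommute fun h' =>
          hmn.ne (natCast_site_injOn hm (by omega) (by omega) (by omega) h'))])
    simp only [hpair] at key
    simp only [stringOp, if_pos h, hpar1]
    simp only [parityString, Nat.add_sub_cancel, e1, e2, add_zero, stringSign,
      if_neg (not_lt.mpr h.le), ← ha]
    rw [key]
    congr 1
    rw [← mul_pow, Complex.I_mul_I]
    linear_combination (-1 : ℂ) ^ (a * N) * hsign (a / 2)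

theorem stringCorrelation_eq_det {t : ℤ →₀ ℝ} {r : Site L → ℝ} {φ : Site L → ℂ}
    (h : IsPolar t r φ) {ψ : FockVec L} (hψ : IsGroundState t ψ) (α : ℤ) (N : ℕ)
    (hL : N + α.natAbs ≤ L) :
    stringCorrelation ψ α N = stringSign α N * ((-1) ^ N *
      (Matrix.of fun i j : Fin N =>
        phaseCoeff φ ((((j : ℕ) : ℤ) - ((i : ℕ) : ℤ) + α : ℤ) : Site L)).det) := by
  rw [stringCorrelation, stringOp_mul_stringOp α N (by omega), expectation_smul,
    expectation_prod_pairs h hψ]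
  · congr 4
    ext i j
    have : (α : ℤ) = (α.toNat : ℤ) - ((-α).toNat : ℤ) := by omega
    conv_rhs => rw [this]
    push_cast
    congr 1
    ring
  · intro i j hij
    have := natCast_site_injOn (L := L) (by omega) (by omega) (by omega) (by omega) hij
    exact Fin.ext (by omega)

end Strings

/-! ### Determinants and the `ℓ¹` norms of the columns -/

section DetBound

variable {N : ℕ}

theorem norm_det_le (M : Matrix (Fin N) (Fin N) ℂ) : ‖M.det‖ ≤ ∏ j, ∑ i, ‖M i j‖ := by
  rw [Matrix.det_apply]
  calc ‖∑ σ : Equiv.Perm (Fin N), Equiv.Perm.sign σ • ∏ i, M (σ i) i‖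
      ≤ ∑ σ : Equiv.Perm (Fin N), ∏ i, ‖M (σ i) i‖ := by
        refine (norm_sum_le _ _).trans (Finset.sum_le_sum fun σ _ => ?_)
        rcases Int.units_eq_one_or (Equiv.Perm.sign σ) with h | h <;> simp [h, norm_prod]
    _ ≤ ∑ f : Fin N → Fin N, ∏ i, ‖M (f i) i‖ := by
        rw [← Finset.sum_image (f := fun f : Fin N → Fin N => ∏ i, ‖M (f i) i‖)
          (g := fun σ : Equiv.Perm (Fin N) => (σ : Fin N → Fin N))
          (fun σ _ τ _ h => Equiv.coe_fn_injective h)]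
        exact Finset.sum_le_sum_of_subset_of_nonneg (Finset.subset_univ _)
          fun _ _ _ => Finset.prod_nonneg fun _ _ => norm_nonneg _
    _ = ∏ j, ∑ i, ‖M i j‖ := (Finset.prod_univ_sum (fun _ => Finset.univ)
        (fun j i => ‖M i j‖)).symm ▸ by simp

/-- The determinant is a multilinear map of norm at most `1` for the `ℓ¹` norm on the columns. -/
theorem norm_det_sub_det_le (M M' : Matrix (Fin N) (Fin N) ℂ) (c : Fin N → ℝ) (hc : ∀ j, 1 ≤ c j)
    (hM : ∀ j, ∑ i, ‖M i j‖ ≤ c j) (hM' : ∀ j, ∑ i, ‖M' i j‖ ≤ c j) :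
    ‖M.det - M'.det‖ ≤ (∑ j, ∑ i, ‖M i j - M' i j‖) * ∏ j, c j := by
  set f : MultilinearMap ℂ (fun _ : Fin N => PiLp 1 fun _ : Fin N => ℂ) ℂ :=
    (Matrix.detRowAlternating (n := Fin N) (R := ℂ)).toMultilinearMap.compLinearMap
      (fun _ => (WithLp.linearEquiv 1 ℂ (Fin N → ℂ)).toLinearMap) with hf
  have hval : ∀ A : Matrix (Fin N) (Fin N) ℂ,
      f (fun j => WithLp.toLp 1 fun i => A i j) = A.det := by
    intro A
    rw [← Matrix.det_transpose]
    rfl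
  have hbound : ∀ m, ‖f m‖ ≤ 1 * ∏ j, ‖m j‖ := by
    intro m
    have h1 := hval (Matrix.of fun i j => m j i)
    have h2 := norm_det_le (Matrix.of fun i j => m j i)
    rw [← h1] at h2
    simp only [PiLp.norm_eq_of_L1, one_mul]
    exact h2
  have h := f.norm_image_sub_le_of_bound' zero_le_one hbound
    (fun j => WithLp.toLp 1 fun i => M i j) (fun j => WithLp.toLp 1 fun i => M' i j)
  rw [hval, hval, one_mul] at h
  refine h.trans ?_
  rw [Finset.sum_mul]
  refine Finset.sum_le_sum fun j _ => ?_
  rw [← Finset.mul_prod_erase _ _ (Finset.mem_univ j), if_pos rfl]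
  have e1 : ‖(WithLp.toLp 1 fun i => M i j) - (WithLp.toLp 1 fun i => M' i j : PiLp 1 fun _ => ℂ)‖ =
      ∑ i, ‖M i j - M' i j‖ := by
    rw [PiLp.norm_eq_of_L1]; rfl
  rw [e1]
  refine mul_le_mul_of_nonneg_left ?_ (Finset.sum_nonneg fun _ _ => norm_nonneg _)
  calc _ ≤ ∏ k ∈ Finset.univ.erase j, c k := by
        refine Finset.prod_le_prod (fun k hk => ?_) fun k hk => ?_
        · rw [if_neg (Finset.ne_of_mem_erase hk)]
          exact (norm_nonneg _).trans (le_max_left _ _)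
        · rw [if_neg (Finset.ne_of_mem_erase hk), PiLp.norm_eq_of_L1, PiLp.norm_eq_of_L1]
          exact max_le (hM k) (hM' k)
    _ ≤ c j * ∏ k ∈ Finset.univ.erase j, c k :=
        le_mul_of_one_le_left (Finset.prod_nonneg fun k _ => zero_le_one.trans (hc k)) (hc j)
    _ = ∏ k, c k := Finset.mul_prod_erase _ _ (Finset.mem_univ j)

end DetBound

/-! ### Power series that converge in a Banach algebra -/

section Series

open PowerSeries

/-- The power series `u` converges absolutely on the closed disc of radius `R`. -/
def RSummable (R : ℝ) (u : PowerSeries ℂ) : Prop := Summable fun n => ‖coeff n u‖ * R ^ n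

theorem RSummable.norm_coeff {R : ℝ} (hR : 1 ≤ R) {u : PowerSeries ℂ} (hu : RSummable R u) :
    Summable fun n => ‖coeff n u‖ :=
  Summable.of_nonneg_of_le (fun _ => norm_nonneg _)
    (fun _ => le_mul_of_one_le_right (norm_nonneg _) (one_le_pow₀ hR)) hu

theorem RSummable.mul {R : ℝ} (hR : 0 ≤ R) {u v : PowerSeries ℂ} (hu : RSummable R u)
    (hv : RSummable R v) : RSummable R (u * v) := by
  have h := summable_norm_sum_mul_antidiagonal_of_summable_norm
    (f := fun n => coeff n u * (R : ℂ) ^ n) (g := fun n => coeff n v * (R : ℂ) ^ n)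
    (by simpa [RSummable, abs_of_nonneg hR] using hu)
    (by simpa [RSummable, abs_of_nonneg hR] using hv)
  refine h.congr fun n => ?_
  have : ∑ kl ∈ Finset.HasAntidiagonal.antidiagonal n,
      coeff kl.1 u * (R : ℂ) ^ kl.1 * (coeff kl.2 v * (R : ℂ) ^ kl.2) =
      coeff n (u * v) * (R : ℂ) ^ n := by
    rw [coeff_mul, Finset.sum_mul]
    refine Finset.sum_congr rfl fun kl hkl => ?_
    rw [← Finset.HasAntidiagonal.mem_antidiagonal.mp hkl, pow_add]
    ring
  rw [this, norm_mul, norm_pow, Complex.norm_real, Real.norm_of_nonneg hR]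

theorem rSummable_of_finite {R : ℝ} {u : PowerSeries ℂ} (N : ℕ) (hu : ∀ n, N ≤ n → coeff n u = 0) :
    RSummable R u :=
  summable_of_ne_finset_zero (s := Finset.range N) fun n hn => by
    rw [hu n (by simpa using hn)]; simp

theorem rSummable_one (R : ℝ) : RSummable R 1 :=
  rSummable_of_finite 1 fun n hn => by rw [coeff_one, if_neg (by omega)]

theorem rSummable_X_pow (R : ℝ) (k : ℕ) : RSummable R (X ^ k) :=
  rSummable_of_finite (k + 1) fun n hn => by rw [coeff_X_pow, if_neg (by omega)]

variable {𝔸 : Type*} [NormedRing 𝔸] [NormedAlgebra ℂ 𝔸] [CompleteSpace 𝔸]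

/-- The value `∑ u_n x ^ n` of a power series at an element of a Banach algebra. -/
def ev (u : PowerSeries ℂ) (x : 𝔸) : 𝔸 := ∑' n, coeff n u • x ^ n

theorem summable_norm_ev {R : ℝ} (hR : 1 ≤ R) {u : PowerSeries ℂ} (hu : RSummable R u) {x : 𝔸}
    (hx : ∀ n, ‖x ^ n‖ ≤ 1) : Summable fun n => ‖coeff n u • x ^ n‖ :=
  Summable.of_nonneg_of_le (fun _ => norm_nonneg _)
    (fun n => by
      rw [norm_smul]
      exact mul_le_of_le_one_right (norm_nonneg _) (hx n)) (hu.norm_coeff hR)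

theorem ev_mul {R : ℝ} (hR : 1 ≤ R) {u v : PowerSeries ℂ} (hu : RSummable R u)
    (hv : RSummable R v) {x : 𝔸} (hx : ∀ n, ‖x ^ n‖ ≤ 1) :
    ev (u * v) x = ev u x * ev v x := by
  rw [ev, ev, ev, tsum_mul_tsum_eq_tsum_sum_antidiagonal_of_summable_norm
    (summable_norm_ev hR hu hx) (summable_norm_ev hR hv hx)]
  refine tsum_congr fun n => ?_
  rw [coeff_mul, Finset.sum_smul]
  refine Finset.sum_congr rfl fun kl hkl => ?_
  rw [smul_mul_smul_comm, ← pow_add, Finset.HasAntidiagonal.mem_antidiagonal.mp hkl]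

theorem ev_X_pow (x : 𝔸) (k : ℕ) : ev (X ^ k) x = x ^ k := by
  rw [ev, tsum_eq_single k]
  · simp [coeff_X_pow]
  · intro n hn
    simp [coeff_X_pow, hn]

theorem ev_one (x : 𝔸) : ev 1 x = 1 := by
  simpa using ev_X_pow x 0

theorem ev_one_sub_C_mul_X (x : 𝔸) (a : ℂ) : ev (1 - C a * X) x = 1 - a • x := by
  rw [ev, tsum_eq_sum (s := Finset.range 2)]
  · simp [Finset.sum_range_succ, coeff_one, coeff_X, sub_eq_add_neg]
  · intro n hn
    have h : 1 < n := by simpa using hn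
    rw [map_sub, coeff_one, if_neg (by omega), coeff_C_mul, coeff_X, if_neg (by omega)]
    simp

/-- The group of power series with constant coefficient `1` that converge, together with their
inverses, on the closed disc of radius `R`. -/
structure IsUnitSeries (R : ℝ) (u : PowerSeries ℂ) : Prop where
  const : constantCoeff u = 1
  summable : RSummable R u
  summable_inv : RSummable R u⁻¹

theorem IsUnitSeries.mul_inv {R : ℝ} {u : PowerSeries ℂ} (hu : IsUnitSeries R u) : u * u⁻¹ = 1 :=
  PowerSeries.mul_inv_cancel u (by rw [hu.const]; exact one_ne_zero)

theorem IsUnitSeries.inv_mul {R : ℝ} {u : PowerSeries ℂ} (hu : IsUnitSeries R u) : u⁻¹ * u = 1 :=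
  PowerSeries.inv_mul_cancel u (by rw [hu.const]; exact one_ne_zero)

theorem IsUnitSeries.inv_inv {R : ℝ} {u : PowerSeries ℂ} (hu : IsUnitSeries R u) : u⁻¹⁻¹ = u := by
  rw [PowerSeries.inv_eq_iff_mul_eq_one (by simp [hu.const]), hu.mul_inv]

theorem IsUnitSeries.inv {R : ℝ} {u : PowerSeries ℂ} (hu : IsUnitSeries R u) :
    IsUnitSeries R u⁻¹ where
  const := by simp [hu.const]
  summable := hu.summable_inv
  summable_inv := by
    rw [hu.inv_inv]
    exact hu.summable

theorem IsUnitSeries.mul {R : ℝ} (hR : 0 ≤ R) {u v : PowerSeries ℂ} (hu : IsUnitSeries R u)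
    (hv : IsUnitSeries R v) : IsUnitSeries R (u * v) where
  const := by simp [hu.const, hv.const]
  summable := hu.summable.mul hR hv.summable
  summable_inv := by
    rw [PowerSeries.mul_inv_rev]
    exact hv.summable_inv.mul hR hu.summable_inv

theorem isUnitSeries_one (R : ℝ) : IsUnitSeries R 1 where
  const := by simp
  summable := rSummable_one R
  summable_inv := by
    have : (1 : PowerSeries ℂ)⁻¹ = 1 := by
      rw [PowerSeries.inv_eq_iff_mul_eq_one (by simp), one_mul]
    rw [this]
    exact rSummable_one R

/-- The coefficient of `z ^ d` in `u(z) w(1 / z)`. -/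
def toeplitzCoeff (u w : PowerSeries ℂ) (d : ℤ) : ℂ :=
  ∑' p : ℕ × ℕ, if (p.1 : ℤ) - p.2 = d then coeff p.1 u * coeff p.2 w else 0

theorem toeplitzCoeff_swap (u w : PowerSeries ℂ) (d : ℤ) :
    toeplitzCoeff u w d = toeplitzCoeff w u (-d) := by
  rw [toeplitzCoeff, toeplitzCoeff, ← (Equiv.prodComm ℕ ℕ).tsum_eq]
  refine tsum_congr fun p => ?_
  have : (p.2 : ℤ) - p.1 = d ↔ (p.1 : ℤ) - p.2 = -d := by omega
  simp [this, mul_comm]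

/-- The Toeplitz matrix of size `N` whose `d`-th superdiagonal holds the coefficient of
`z ^ (d + κ)` in `u(z) w(1 / z)`. -/
def toeplitzMatrix (u w : PowerSeries ℂ) (κ : ℤ) (N : ℕ) : Matrix (Fin N) (Fin N) ℂ :=
  Matrix.of fun i j => toeplitzCoeff u w (((j : ℕ) : ℤ) - ((i : ℕ) : ℤ) + κ)

theorem det_toeplitzMatrix_swap (u w : PowerSeries ℂ) (κ : ℤ) (N : ℕ) :
    (toeplitzMatrix u w κ N).det = (toeplitzMatrix w u (-κ) N).det := by
  rw [← Matrix.det_transpose]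
  congr 1
  ext i j
  simp only [toeplitzMatrix, Matrix.transpose_apply, Matrix.of_apply]
  rw [toeplitzCoeff_swap]
  congr 1
  ring

end Series

/-! ### Toeplitz operators on `ℓ¹` -/

section Operators

open PowerSeries

/-- The Banach space `ℓ¹` of absolutely summable sequences. -/
abbrev Ell : Type := lp (fun _ : ℕ => ℂ) 1

/-- The Banach algebra of bounded operators on `ℓ¹`. -/
abbrev EllOp : Type := Ell →L[ℂ] Ell

theorem ell_hasSum_norm (x : Ell) : HasSum (fun i => ‖x i‖) ‖x‖ := by
  simpa using lp.hasSum_norm (p := 1) (by simp) x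

theorem ell_norm_eq (x : Ell) : ‖x‖ = ∑' i, ‖x i‖ := (ell_hasSum_norm x).tsum_eq.symm

theorem memℓp_one_of_summable {x : ℕ → ℂ} (h : Summable fun i => ‖x i‖) :
    Memℓp (E := fun _ : ℕ => ℂ) x 1 := by
  refine memℓp_gen ?_
  simpa using h

/-- The standard unit vectors of `ℓ¹`. -/
def unitVec (j : ℕ) : Ell := lp.single 1 j (1 : ℂ)

theorem unitVec_apply (j i : ℕ) : unitVec j i = if i = j then 1 else 0 := by
  rw [unitVec, lp.single_apply, Pi.single_apply]

theorem norm_unitVec (j : ℕ) : ‖unitVec j‖ = 1 := by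
  rw [unitVec, lp.norm_single (by simp), norm_one]

theorem ell_hasSum (x : Ell) : HasSum (fun i => x i • unitVec i) x := by
  have h : ∀ i, x i • unitVec i = lp.single 1 i (x i) := fun i => by
    rw [unitVec, ← lp.single_smul, smul_eq_mul, mul_one]
  simp only [h]
  exact lp.hasSum_single (by simp) x

/-- The coordinate functionals. -/
def coord (i : ℕ) : Ell →L[ℂ] ℂ := lp.evalCLM ℂ (fun _ : ℕ => ℂ) 1 i

theorem coord_apply (i : ℕ) (x : Ell) : coord i x = x i := rfl

theorem sum_norm_coord_le (x : Ell) (N : ℕ) : ∑ i : Fin N, ‖x i‖ ≤ ‖x‖ := by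
  rw [Fin.sum_univ_eq_sum_range (fun i => ‖x i‖)]
  exact sum_le_hasSum _ (fun _ _ => norm_nonneg _) (ell_hasSum_norm x)

theorem shiftRight_summable (x : Ell) :
    Summable fun i => ‖(match i with | 0 => 0 | i + 1 => x i : ℂ)‖ :=
  (summable_nat_add_iff 1).mp (ell_hasSum_norm x).summable

/-- The shift `S e_j = e_{j+1}`. -/
def shiftRight : EllOp :=
  LinearMap.mkContinuous
    { toFun := fun x => ⟨fun i => match i with | 0 => 0 | i + 1 => x i,
        memℓp_one_of_summable (shiftRight_summable x)⟩
      map_add' := fun x y => by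
        ext i
        cases i
        · exact (add_zero _).symm
        · rfl
      map_smul' := fun c x => by
        ext i
        cases i <;> simp } 1 fun x => by
    rw [one_mul, ell_norm_eq, ell_norm_eq]
    exact ((shiftRight_summable x).tsum_eq_zero_add.trans (by simp)).le

/-- The backward shift `S* e_{j+1} = e_j`, `S* e_0 = 0`. -/
def shiftLeft : EllOp :=
  LinearMap.mkContinuous
    { toFun := fun x => ⟨fun i => x (i + 1),
        memℓp_one_of_summable ((summable_nat_add_iff 1).mpr (ell_hasSum_norm x).summable)⟩
      map_add' := fun x y => by
        ext i
        rfl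
      map_smul' := fun c x => by
        ext i
        simp } 1 fun x => by
    rw [one_mul, ell_norm_eq, ell_norm_eq, (ell_hasSum_norm x).summable.tsum_eq_zero_add]
    exact le_add_of_nonneg_left (norm_nonneg _)

theorem shiftLeft_apply (x : Ell) (i : ℕ) : shiftLeft x i = x (i + 1) := rfl

theorem shiftRight_unitVec (j : ℕ) : shiftRight (unitVec j) = unitVec (j + 1) := by
  ext i
  have : shiftRight (unitVec j) i = (match i with | 0 => 0 | i + 1 => unitVec j i : ℂ) := rfl
  rw [this]
  cases i <;> simp [unitVec_apply]

theorem shiftLeft_mul_shiftRight : shiftLeft * shiftRight = 1 := by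
  ext x i
  rfl

theorem norm_pow_le_one {A : EllOp} (h : ‖A‖ ≤ 1) (n : ℕ) : ‖A ^ n‖ ≤ 1 := by
  induction n with
  | zero => exact ContinuousLinearMap.norm_id_le
  | succ n ih =>
    rw [pow_succ]
    exact (norm_mul_le _ _).trans (mul_le_one₀ ih (norm_nonneg _) h)

theorem norm_shiftRight_pow_le (n : ℕ) : ‖shiftRight ^ n‖ ≤ 1 :=
  norm_pow_le_one (LinearMap.mkContinuous_norm_le _ zero_le_one _) n

theorem norm_shiftLeft_pow_le (n : ℕ) : ‖shiftLeft ^ n‖ ≤ 1 :=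
  norm_pow_le_one (LinearMap.mkContinuous_norm_le _ zero_le_one _) n

theorem shiftRight_pow_unitVec (n j : ℕ) : (shiftRight ^ n) (unitVec j) = unitVec (j + n) := by
  induction n with
  | zero => simp
  | succ n ih => rw [pow_succ', mul_apply_eq_comp, ih, shiftRight_unitVec]; rfl

theorem shiftLeft_pow_apply (n : ℕ) (x : Ell) (i : ℕ) : (shiftLeft ^ n) x i = x (i + n) := by
  induction n generalizing x with
  | zero => simp
  | succ n ih =>
    rw [pow_succ, mul_apply_eq_comp, ih, shiftLeft_apply]; rfl

theorem shiftLeft_pow_unitVec_of_le {n j : ℕ} (h : n ≤ j) :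
    (shiftLeft ^ n) (unitVec j) = unitVec (j - n) := by
  ext i
  rw [shiftLeft_pow_apply, unitVec_apply, unitVec_apply]
  congr 1
  simp only [eq_iff_iff]
  omega

theorem shiftLeft_pow_unitVec_of_lt {n j : ℕ} (h : j < n) : (shiftLeft ^ n) (unitVec j) = 0 := by
  ext i
  rw [shiftLeft_pow_apply, unitVec_apply, if_neg (by omega)]
  rfl

/-- The `N × N` section of an operator. -/
def sec (N : ℕ) (A : EllOp) : Matrix (Fin N) (Fin N) ℂ := Matrix.of fun i j => A (unitVec j) i

/-- The matrix of the operator is lower triangular. -/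
def IsLower (A : EllOp) : Prop := ∀ i j, i < j → A (unitVec j) i = 0

/-- The operator maps the span of the first `N` unit vectors into itself. -/
def IsReduced (N : ℕ) (A : EllOp) : Prop := ∀ i j, j < N → N ≤ i → A (unitVec j) i = 0

theorem ell_eq_sum {N : ℕ} {x : Ell} (h : ∀ i, N ≤ i → x i = 0) :
    x = ∑ l : Fin N, x l • unitVec l := by
  rw [Fin.sum_univ_eq_sum_range (fun l => x l • unitVec l)]
  exact (ell_hasSum x).unique (hasSum_sum_of_ne_finset_zero fun i hi => by
    rw [h i (by simpa using hi), zero_smul])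

theorem sec_mul_of_isReduced {N : ℕ} (A : EllOp) {B : EllOp} (hB : IsReduced N B) :
    sec N (A * B) = sec N A * sec N B := by
  ext i j
  rw [Matrix.mul_apply]
  simp only [sec, Matrix.of_apply, mul_apply_eq_comp]
  conv_lhs => rw [ell_eq_sum (N := N) (x := B (unitVec j)) fun i hi => hB i j j.2 hi]
  rw [map_sum, ← coord_apply, map_sum]
  refine Finset.sum_congr rfl fun l _ => ?_
  rw [map_smul, map_smul, smul_eq_mul, coord_apply, mul_comm]

theorem sec_mul_of_isLower {N : ℕ} {A : EllOp} (hA : IsLower A) (B : EllOp) :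
    sec N (A * B) = sec N A * sec N B := by
  ext i j
  rw [Matrix.mul_apply]
  simp only [sec, Matrix.of_apply, mul_apply_eq_comp]
  have h := (((ell_hasSum (B (unitVec j))).mapL A).mapL (coord i))
  simp only [map_smul, coord_apply, smul_eq_mul] at h
  rw [← h.tsum_eq, tsum_eq_sum (s := Finset.range N),
    ← Fin.sum_univ_eq_sum_range (fun l => B (unitVec j) l * A (unitVec l) i)]
  · exact Finset.sum_congr rfl fun l _ => mul_comm _ _
  · intro l hl
    have : N ≤ l := by simpa using hl
    rw [hA i l (by omega), mul_zero]

variable {R : ℝ} {u v w : PowerSeries ℂ}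

theorem summable_ev_shiftRight (hR : 1 ≤ R) (hw : RSummable R w) :
    Summable fun n => coeff n w • shiftRight ^ n :=
  (summable_norm_ev hR hw norm_shiftRight_pow_le).of_norm

theorem summable_ev_shiftLeft (hR : 1 ≤ R) (hu : RSummable R u) :
    Summable fun n => coeff n u • shiftLeft ^ n :=
  (summable_norm_ev hR hu norm_shiftLeft_pow_le).of_norm

theorem hasSum_ev_apply {A : EllOp} (h : Summable fun n => coeff n u • A ^ n) (x : Ell) :
    HasSum (fun n => coeff n u • (A ^ n) x) (ev u A x) := by
  have := h.hasSum.mapL (ContinuousLinearMap.apply ℂ Ell x)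
  exact this

theorem ev_shiftRight_apply (hR : 1 ≤ R) (hw : RSummable R w) (i j : ℕ) :
    ev w shiftRight (unitVec j) i = if j ≤ i then coeff (i - j) w else 0 := by
  have h := (hasSum_ev_apply (summable_ev_shiftRight hR hw) (unitVec j)).mapL (coord i)
  simp only [map_smul, coord_apply, shiftRight_pow_unitVec, unitVec_apply, smul_eq_mul] at h
  rw [← h.tsum_eq]
  split_ifs with hij
  · rw [tsum_eq_single (i - j)]
    · rw [if_pos (by omega), mul_one]
    · intro n hn
      rw [if_neg (by omega), mul_zero]
  · refine (tsum_congr fun n => ?_).trans tsum_zero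
    rw [if_neg (by omega), mul_zero]

theorem ev_shiftLeft_apply (hR : 1 ≤ R) (hu : RSummable R u) (i j : ℕ) :
    ev u shiftLeft (unitVec j) i = if i ≤ j then coeff (j - i) u else 0 := by
  have h := (hasSum_ev_apply (summable_ev_shiftLeft hR hu) (unitVec j)).mapL (coord i)
  simp only [map_smul, coord_apply, shiftLeft_pow_apply, unitVec_apply, smul_eq_mul] at h
  rw [← h.tsum_eq]
  split_ifs with hij
  · rw [tsum_eq_single (j - i)]
    · rw [if_pos (by omega), mul_one]
    · intro n hn
      rw [if_neg (by omega), mul_zero]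
  · refine (tsum_congr fun n => ?_).trans tsum_zero
    rw [if_neg (by omega), mul_zero]

theorem isLower_ev_shiftRight (hR : 1 ≤ R) (hw : RSummable R w) : IsLower (ev w shiftRight) := by
  intro i j hij
  rw [ev_shiftRight_apply hR hw, if_neg (by omega)]

theorem isReduced_ev_shiftLeft (hR : 1 ≤ R) (hu : RSummable R u) (N : ℕ) :
    IsReduced N (ev u shiftLeft) := by
  intro i j hj hi
  rw [ev_shiftLeft_apply hR hu, if_neg (by omega)]

theorem det_sec_ev_shiftRight (hR : 1 ≤ R) (hw : RSummable R w) (hw1 : constantCoeff w = 1)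
    (N : ℕ) : (sec N (ev w shiftRight)).det = 1 := by
  rw [Matrix.det_of_isLowerTriangular]
  · refine Finset.prod_eq_one fun i _ => ?_
    simp [sec, ev_shiftRight_apply hR hw, hw1]
  · intro i j hij
    exact isLower_ev_shiftRight hR hw _ _ hij

theorem det_sec_ev_shiftLeft (hR : 1 ≤ R) (hu : RSummable R u) (hu1 : constantCoeff u = 1)
    (N : ℕ) : (sec N (ev u shiftLeft)).det = 1 := by
  rw [Matrix.det_of_isUpperTriangular]
  · refine Finset.prod_eq_one fun i _ => ?_
    simp [sec, ev_shiftLeft_apply hR hu, hu1]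
  · intro i j hij
    simp only [sec, Matrix.of_apply]
    have : (j : ℕ) < i := hij
    rw [ev_shiftLeft_apply hR hu, if_neg (by omega)]

/-- The Toeplitz operator, the product of an upper and a lower triangular one. -/
theorem ev_shiftLeft_mul_ev_shiftRight_apply (hR : 1 ≤ R) (hu : RSummable R u)
    (hw : RSummable R w) (i j : ℕ) :
    (ev u shiftLeft * ev w shiftRight) (unitVec j) i = toeplitzCoeff u w ((j : ℤ) - i) := by
  have hs1 := summable_norm_ev hR hu norm_shiftLeft_pow_le
  have hs2 := summable_norm_ev hR hw norm_shiftRight_pow_le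
  have h := (((summable_mul_of_summable_norm hs1 hs2).hasSum.mapL
    (ContinuousLinearMap.apply ℂ Ell (unitVec j))).mapL (coord i))
  rw [← tsum_mul_tsum_of_summable_norm hs1 hs2] at h
  have h' : (ev u shiftLeft * ev w shiftRight) (unitVec j) i = _ := h.tsum_eq.symm
  rw [h', toeplitzCoeff]
  refine tsum_congr fun p => ?_
  simp only [smul_mul_smul_comm, ContinuousLinearMap.apply_apply, mul_apply_eq_comp, map_smul,
    coord_apply, shiftRight_pow_unitVec, shiftLeft_pow_apply, unitVec_apply, smul_eq_mul]
  have : i + p.1 = j + p.2 ↔ (p.1 : ℤ) - p.2 = j - i := by omega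
  simp [this]

end Operators

/-! ### Operators with summable columns and their determinants -/

section Nuclear

open PowerSeries

/-- The operators whose columns have a summable family of `ℓ¹` norms. They form a left ideal that
plays the role of the trace class. -/
def IsNuclear (K : EllOp) : Prop := Summable fun j => ‖K (unitVec j)‖

/-- The sum of the `ℓ¹` norms of the columns. -/
def nuclearNorm (K : EllOp) : ℝ := ∑' j, ‖K (unitVec j)‖

theorem nuclearNorm_nonneg (K : EllOp) : 0 ≤ nuclearNorm K := tsum_nonneg fun _ => norm_nonneg _

theorem IsNuclear.mul_left {K : EllOp} (hK : IsNuclear K) (A : EllOp) : IsNuclear (A * K) :=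
  Summable.of_nonneg_of_le (fun _ => norm_nonneg _) (fun j => A.le_opNorm (K (unitVec j)))
    (Summable.mul_left ‖A‖ hK)

theorem nuclearNorm_mul_le {K : EllOp} (hK : IsNuclear K) (A : EllOp) :
    nuclearNorm (A * K) ≤ ‖A‖ * nuclearNorm K := by
  rw [nuclearNorm, nuclearNorm, ← tsum_mul_left]
  exact (hK.mul_left A).tsum_le_tsum (fun j => A.le_opNorm (K (unitVec j)))
    (Summable.mul_left ‖A‖ hK)

theorem IsNuclear.add {K K' : EllOp} (hK : IsNuclear K) (hK' : IsNuclear K') :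
    IsNuclear (K + K') :=
  Summable.of_nonneg_of_le (fun _ => norm_nonneg _) (fun _ => norm_add_le _ _) (Summable.add hK hK')

theorem nuclearNorm_add_le {K K' : EllOp} (hK : IsNuclear K) (hK' : IsNuclear K') :
    nuclearNorm (K + K') ≤ nuclearNorm K + nuclearNorm K' := by
  rw [nuclearNorm, nuclearNorm, nuclearNorm, ← Summable.tsum_add hK hK']
  exact (hK.add hK').tsum_le_tsum (fun _ => norm_add_le _ _) (Summable.add hK hK')

variable {R : ℝ} {u v w : PowerSeries ℂ}

theorem ev_shiftLeft_unitVec (hR : 1 ≤ R) (hu : RSummable R u) (j : ℕ) :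
    ev u shiftLeft (unitVec j) =
      ∑ p ∈ Finset.HasAntidiagonal.antidiagonal j, coeff p.1 u • unitVec p.2 := by
  have h := hasSum_ev_apply (summable_ev_shiftLeft hR hu) (unitVec j)
  rw [Finset.Nat.sum_antidiagonal_eq_sum_range_succ fun m l => coeff m u • unitVec l]
  refine h.unique ?_
  have h2 : ∀ n ∈ Finset.range (j + 1), coeff n u • unitVec (j - n) =
      coeff n u • (shiftLeft ^ n) (unitVec j) := fun n hn => by
    rw [shiftLeft_pow_unitVec_of_le (by have := Finset.mem_range.mp hn; omega)]
  rw [Finset.sum_congr rfl h2]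
  exact hasSum_sum_of_ne_finset_zero fun n hn => by
    rw [shiftLeft_pow_unitVec_of_lt (by simpa using hn), smul_zero]

theorem norm_mul_ev_shiftLeft_unitVec_le (hR : 1 ≤ R) (hu : RSummable R u) (K : EllOp) (j : ℕ) :
    ‖(K * ev u shiftLeft) (unitVec j)‖ ≤
      ∑ p ∈ Finset.HasAntidiagonal.antidiagonal j, ‖coeff p.1 u‖ * ‖K (unitVec p.2)‖ := by
  rw [mul_apply_eq_comp, ev_shiftLeft_unitVec hR hu, map_sum]
  refine (norm_sum_le _ _).trans_eq (Finset.sum_congr rfl fun p _ => ?_)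
  rw [map_smul, norm_smul]

theorem summable_antidiagonal {a b : ℕ → ℝ} (ha : Summable a) (hb : Summable b)
    (ha0 : ∀ n, 0 ≤ a n) (hb0 : ∀ n, 0 ≤ b n) :
    Summable fun n => ∑ p ∈ Finset.HasAntidiagonal.antidiagonal n, a p.1 * b p.2 :=
  summable_sum_mul_antidiagonal_of_summable_mul (ha.mul_of_nonneg hb ha0 hb0)

theorem IsNuclear.mul_ev (hR : 1 ≤ R) (hu : RSummable R u) {K : EllOp} (hK : IsNuclear K) :
    IsNuclear (K * ev u shiftLeft) :=
  Summable.of_nonneg_of_le (fun _ => norm_nonneg _) (norm_mul_ev_shiftLeft_unitVec_le hR hu K)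
    (summable_antidiagonal (a := fun n => ‖coeff n u‖) (b := fun j => ‖K (unitVec j)‖)
      (hu.norm_coeff hR) hK (fun _ => norm_nonneg _) fun _ => norm_nonneg _)

theorem tsum_le_tsum_mul_tsum {a b c : ℕ → ℝ} (ha : Summable a) (hb : Summable b)
    (hc : Summable c) (ha0 : ∀ n, 0 ≤ a n) (hb0 : ∀ n, 0 ≤ b n)
    (h : ∀ n, c n ≤ ∑ p ∈ Finset.HasAntidiagonal.antidiagonal n, a p.1 * b p.2) :
    ∑' n, c n ≤ (∑' n, a n) * ∑' n, b n := by
  rw [Summable.tsum_mul_tsum_eq_tsum_sum_antidiagonal ha hb (ha.mul_of_nonneg hb ha0 hb0)]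
  exact hc.tsum_le_tsum h (summable_antidiagonal ha hb ha0 hb0)

theorem nuclearNorm_mul_ev_le (hR : 1 ≤ R) (hu : RSummable R u) {K : EllOp} (hK : IsNuclear K) :
    nuclearNorm (K * ev u shiftLeft) ≤ (∑' n, ‖coeff n u‖) * nuclearNorm K :=
  tsum_le_tsum_mul_tsum (a := fun n => ‖coeff n u‖) (b := fun j => ‖K (unitVec j)‖)
    (c := fun j => ‖(K * ev u shiftLeft) (unitVec j)‖) (hu.norm_coeff hR) hK (hK.mul_ev hR hu)
    (fun _ => norm_nonneg _) (fun _ => norm_nonneg _) (norm_mul_ev_shiftLeft_unitVec_le hR hu K)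

/-- The projection onto the span of the first `N` unit vectors. -/
def proj (N : ℕ) : EllOp := ∑ l ∈ Finset.range N, (coord l).smulRight (unitVec l)

theorem proj_apply (N : ℕ) (x : Ell) : proj N x = ∑ l ∈ Finset.range N, x l • unitVec l := by
  simp only [proj, sum_apply]
  rfl

theorem proj_apply_apply (N : ℕ) (x : Ell) (i : ℕ) : proj N x i = if i < N then x i else 0 := by
  rw [proj_apply, ← coord_apply, map_sum]
  simp only [map_smul, coord_apply, unitVec_apply, smul_eq_mul, mul_ite, mul_one, mul_zero]
  simp

theorem tendsto_proj (x : Ell) : Tendsto (fun N => proj N x) atTop (𝓝 x) := by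
  simp only [proj_apply]
  exact (ell_hasSum x).tendsto_sum_nat

theorem norm_proj_apply_le (N : ℕ) (x : Ell) : ‖proj N x‖ ≤ ‖x‖ := by
  rw [ell_norm_eq, ell_norm_eq]
  refine (ell_hasSum_norm _).summable.tsum_le_tsum (fun i => ?_) (ell_hasSum_norm x).summable
  rw [proj_apply_apply]
  split_ifs <;> simp

theorem proj_unitVec (N j : ℕ) : proj N (unitVec j) = if j < N then unitVec j else 0 := by
  ext i
  rw [proj_apply_apply, unitVec_apply]
  split_ifs <;> simp [unitVec_apply] <;> omega

/-- The truncation of an operator to the span of the first `N` unit vectors. -/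
def trunc (N : ℕ) (K : EllOp) : EllOp := proj N * K * proj N

theorem trunc_unitVec (N : ℕ) (K : EllOp) (j : ℕ) :
    trunc N K (unitVec j) = if j < N then proj N (K (unitVec j)) else 0 := by
  rw [trunc, mul_apply_eq_comp, mul_apply_eq_comp, proj_unitVec]
  split_ifs <;> simp

theorem norm_trunc_unitVec_le (N : ℕ) (K : EllOp) (j : ℕ) :
    ‖trunc N K (unitVec j)‖ ≤ ‖K (unitVec j)‖ := by
  rw [trunc_unitVec]
  split_ifs
  · exact norm_proj_apply_le _ _
  · simp

theorem IsNuclear.trunc {K : EllOp} (hK : IsNuclear K) (N : ℕ) : IsNuclear (trunc N K) :=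
  Summable.of_nonneg_of_le (fun _ => norm_nonneg _) (norm_trunc_unitVec_le N K) hK

theorem nuclearNorm_trunc_le {K : EllOp} (hK : IsNuclear K) (N : ℕ) :
    nuclearNorm (BDI.trunc N K) ≤ nuclearNorm K :=
  (hK.trunc N).tsum_le_tsum (norm_trunc_unitVec_le N K) hK

theorem IsNuclear.neg {K : EllOp} (hK : IsNuclear K) : IsNuclear (-K) := by
  simpa [IsNuclear] using hK

theorem IsNuclear.sub {K K' : EllOp} (hK : IsNuclear K) (hK' : IsNuclear K') :
    IsNuclear (K - K') := by
  rw [sub_eq_add_neg]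
  exact hK.add hK'.neg

theorem tendsto_nuclearNorm_sub_trunc {K : EllOp} (hK : IsNuclear K) :
    Tendsto (fun N => nuclearNorm (K - trunc N K)) atTop (𝓝 0) := by
  have h := tendsto_tsum_of_dominated_convergence (𝓕 := atTop)
    (f := fun N j => ‖(K - trunc N K) (unitVec j)‖) (g := fun _ => (0 : ℝ))
    (bound := fun j => 2 * ‖K (unitVec j)‖) (Summable.mul_left 2 hK) (fun j => ?_)
    (Eventually.of_forall fun N j => ?_)
  · simpa [nuclearNorm] using h
  · have h1 : Tendsto (fun N => ‖K (unitVec j) - proj N (K (unitVec j))‖) atTop (𝓝 0) := by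
      have := ((tendsto_const_nhds (x := K (unitVec j))).sub (tendsto_proj (K (unitVec j)))).norm
      simpa using this
    refine h1.congr' ?_
    filter_upwards [eventually_gt_atTop j] with N hN
    rw [sub_apply, trunc_unitVec, if_pos hN]
  · rw [norm_norm, sub_apply, two_mul]
    exact (norm_sub_le _ _).trans (add_le_add_right (norm_trunc_unitVec_le N K j) _)

theorem prod_one_add_le_exp {K : EllOp} (hK : IsNuclear K) (N : ℕ) :
    ∏ j : Fin N, (1 + ‖K (unitVec j)‖) ≤ Real.exp (nuclearNorm K) := by
  calc ∏ j : Fin N, (1 + ‖K (unitVec j)‖) ≤ ∏ j : Fin N, Real.exp ‖K (unitVec j)‖ :=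
        Finset.prod_le_prod (fun _ _ => by positivity) fun j _ => by
          rw [add_comm]; exact Real.add_one_le_exp _
    _ = Real.exp (∑ j : Fin N, ‖K (unitVec j)‖) := (Real.exp_sum _ _).symm
    _ ≤ _ := by
        rw [Real.exp_le_exp, Fin.sum_univ_eq_sum_range (fun j => ‖K (unitVec j)‖)]
        exact hK.sum_le_tsum _ fun _ _ => norm_nonneg _

theorem sum_norm_sec_le (N : ℕ) (A : EllOp) (j : Fin N) :
    ∑ i, ‖sec N A i j‖ ≤ ‖A (unitVec j)‖ := sum_norm_coord_le _ N

theorem norm_one_add_unitVec_le (K : EllOp) (j : ℕ) :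
    ‖(1 + K) (unitVec j)‖ ≤ 1 + ‖K (unitVec j)‖ := by
  rw [add_apply, one_apply_eq_self]
  exact (norm_add_le _ _).trans_eq (by rw [norm_unitVec])

/-- The determinants of the sections of `1 + K` are continuous in `K`, uniformly in the size. -/
theorem norm_det_sec_sub_le {K K' : EllOp} (hK : IsNuclear K) (hK' : IsNuclear K') (N : ℕ) :
    ‖(sec N (1 + K)).det - (sec N (1 + K')).det‖ ≤
      nuclearNorm (K - K') * (Real.exp (nuclearNorm K) * Real.exp (nuclearNorm K')) := by
  refine (norm_det_sub_det_le _ _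
    (fun j => (1 + ‖K (unitVec j)‖) * (1 + ‖K' (unitVec j)‖)) (fun j => ?_) (fun j => ?_)
    fun j => ?_).trans ?_
  · exact one_le_mul_of_one_le_of_one_le (by simp) (by simp)
  · exact ((sum_norm_sec_le N _ j).trans (norm_one_add_unitVec_le K j)).trans
      (le_mul_of_one_le_right (by positivity) (by simp))
  · exact ((sum_norm_sec_le N _ j).trans (norm_one_add_unitVec_le K' j)).trans
      (le_mul_of_one_le_left (by positivity) (by simp))
  · rw [Finset.prod_mul_distrib]
    refine mul_le_mul ?_ (mul_le_mul (prod_one_add_le_exp hK N) (prod_one_add_le_exp hK' N)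
      (Finset.prod_nonneg fun _ _ => by positivity) (Real.exp_nonneg _))
      (mul_nonneg (Finset.prod_nonneg fun _ _ => by positivity)
        (Finset.prod_nonneg fun _ _ => by positivity)) (nuclearNorm_nonneg _)
    have h1 : ∀ j : Fin N, ∑ i, ‖sec N (1 + K) i j - sec N (1 + K') i j‖ ≤
        ‖(K - K') (unitVec j)‖ := by
      intro j
      refine le_trans (le_of_eq ?_) (sum_norm_sec_le N (K - K') j)
      refine Finset.sum_congr rfl fun i _ => ?_
      have : sec N (1 + K) - sec N (1 + K') = sec N (K - K') := by
        ext i j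
        simp [sec]
      rw [← this]
      rfl
    refine (Finset.sum_le_sum fun j _ => h1 j).trans ?_
    rw [Fin.sum_univ_eq_sum_range (fun j => ‖(K - K') (unitVec j)‖)]
    exact (hK.sub hK').sum_le_tsum _ fun _ _ => norm_nonneg _

theorem det_sec_one_add_trunc {M N : ℕ} (h : M ≤ N) (K : EllOp) :
    (sec N (1 + trunc M K)).det = (sec M (1 + trunc M K)).det := by
  induction N, h using Nat.le_induction with
  | base => rfl
  | succ N hN ih =>
    rw [← ih, Matrix.det_succ_column _ (Fin.last N), Finset.sum_eq_single (Fin.last N)]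
    · have h1 : sec (N + 1) (1 + trunc M K) (Fin.last N) (Fin.last N) = 1 := by
        simp [sec, trunc_unitVec, if_neg (not_lt.mpr hN), unitVec_apply]
      rw [h1, ← two_mul, pow_mul]
      simp only [neg_one_sq, one_pow, one_mul, Fin.succAbove_last]
      rfl
    · intro i _ hi
      have h1 : sec (N + 1) (1 + trunc M K) i (Fin.last N) = 0 := by
        have : (i : ℕ) ≠ N := fun h => hi (Fin.ext h)
        simp [sec, trunc_unitVec, if_neg (not_lt.mpr hN), unitVec_apply, this]
      rw [h1]
      ring
    · simp

theorem sec_trunc (N : ℕ) (K : EllOp) : sec N (1 + trunc N K) = sec N (1 + K) := by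
  ext i j
  simp [sec, trunc_unitVec, proj_apply_apply]

theorem isReduced_one_add_trunc (N : ℕ) (K : EllOp) : IsReduced N (1 + trunc N K) := by
  intro i j hj hi
  simp [trunc_unitVec, hj, proj_apply_apply, unitVec_apply, not_lt.mpr hi, (hj.trans_le hi).ne']

/-- The determinant of `1 + K`, as the limit of the determinants of the sections, exists. -/
theorem exists_tendsto_det_sec {K : EllOp} (hK : IsNuclear K) :
    ∃ E, Tendsto (fun N => (sec N (1 + K)).det) atTop (𝓝 E) := by
  refine cauchySeq_tendsto_of_complete ?_
  have h0 := (tendsto_nuclearNorm_sub_trunc hK).mul_const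
    (Real.exp (nuclearNorm K) * Real.exp (nuclearNorm K))
  rw [zero_mul] at h0
  refine cauchySeq_of_le_tendsto_0' (fun N => nuclearNorm (K - trunc N K) *
    (Real.exp (nuclearNorm K) * Real.exp (nuclearNorm K))) (fun M N hMN => ?_) h0
  rw [dist_comm, dist_eq_norm, ← sec_trunc M, ← det_sec_one_add_trunc hMN]
  refine (norm_det_sec_sub_le hK (hK.trunc M) N).trans ?_
  refine mul_le_mul_of_nonneg_left ?_ (nuclearNorm_nonneg _)
  exact mul_le_mul_of_nonneg_left (Real.exp_le_exp.mpr (nuclearNorm_trunc_le hK M))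
    (Real.exp_nonneg _)

/-- The commutator of an upper and a lower triangular Toeplitz operator has summable columns: on
`e_j` with `m ≤ j` the power `S* ^ m` of the backward shift commutes with the powers of the shift,
so that only the coefficients `u_m` with `m > j` contribute to the `j`-th column. -/
theorem isNuclear_commutator (hR : 1 < R) (hu : RSummable R u) (hw : RSummable R w) :
    IsNuclear (ev u shiftLeft * ev w shiftRight - ev w shiftRight * ev u shiftLeft) := by
  have hR0 : 0 < R := zero_lt_one.trans hR
  set W : EllOp := ev w shiftRight with hW
  have hWpow : ∀ j, W * shiftRight ^ j = shiftRight ^ j * W := by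
    intro j
    rw [hW, ← ev_X_pow shiftRight j, ← ev_mul hR.le hw (rSummable_X_pow R j) norm_shiftRight_pow_le,
      ← ev_mul hR.le (rSummable_X_pow R j) hw norm_shiftRight_pow_le, mul_comm]
  have hcancel : ∀ m n, shiftLeft ^ m * shiftRight ^ (m + n) = shiftRight ^ n := by
    intro m
    induction m with
    | zero => intro n; simp
    | succ m ih =>
      intro n
      rw [pow_succ, show m + 1 + n = (m + n) + 1 by ring, pow_succ' shiftRight, mul_assoc,
        ← mul_assoc shiftLeft shiftRight, shiftLeft_mul_shiftRight, one_mul, ih]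
  have hunit : ∀ j, unitVec j = (shiftRight ^ j) (unitVec 0) := fun j => by
    rw [shiftRight_pow_unitVec, zero_add]
  have hterm : ∀ m j, m ≤ j → (shiftLeft ^ m) (W (unitVec j)) =
      W ((shiftLeft ^ m) (unitVec j)) := by
    intro m j hmj
    obtain ⟨n, rfl⟩ := Nat.exists_eq_add_of_le hmj
    rw [hunit]
    simp only [← mul_apply_eq_comp]
    rw [hWpow, ← mul_assoc, hcancel, hWpow]
  have hbound : ∀ m j, ‖(shiftLeft ^ m) (W (unitVec j)) - W ((shiftLeft ^ m) (unitVec j))‖ ≤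
      2 * ‖W‖ := by
    intro m j
    have h1 : ‖W (unitVec j)‖ ≤ ‖W‖ := by
      simpa [norm_unitVec] using W.le_opNorm (unitVec j)
    have h2 : ‖(shiftLeft ^ m) (W (unitVec j))‖ ≤ ‖W‖ :=
      ((shiftLeft ^ m).le_of_opNorm_le (norm_shiftLeft_pow_le m) _).trans (by rwa [one_mul])
    have h3 : ‖(shiftLeft ^ m) (unitVec j)‖ ≤ 1 := by
      simpa [norm_unitVec] using
        (shiftLeft ^ m).le_of_opNorm_le (norm_shiftLeft_pow_le m) (unitVec j)
    have h4 : ‖W ((shiftLeft ^ m) (unitVec j))‖ ≤ ‖W‖ :=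
      (W.le_opNorm _).trans (mul_le_of_le_one_right (norm_nonneg _) h3)
    exact (norm_sub_le _ _).trans (by linarith)
  have hcol : ∀ j, ‖(ev u shiftLeft * W - W * ev u shiftLeft) (unitVec j)‖ ≤
      2 * ‖W‖ * (∑' n, ‖coeff n u‖ * R ^ n) * (R⁻¹) ^ j := by
    intro j
    have hs := summable_ev_shiftLeft hR.le hu
    have h1 := (hasSum_ev_apply hs (W (unitVec j))).sub ((hasSum_ev_apply hs (unitVec j)).mapL W)
    rw [sub_apply, mul_apply_eq_comp, mul_apply_eq_comp, ← h1.tsum_eq]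
    have hle : ∀ m, ‖coeff m u • (shiftLeft ^ m) (W (unitVec j)) -
        W (coeff m u • (shiftLeft ^ m) (unitVec j))‖ ≤
        2 * ‖W‖ * (R⁻¹) ^ j * (‖coeff m u‖ * R ^ m) := by
      intro m
      rw [map_smul, ← smul_sub, norm_smul]
      rcases le_or_gt m j with hm | hm
      · rw [hterm m j hm, sub_self, norm_zero, mul_zero]
        positivity
      · have h2 : 1 ≤ (R⁻¹) ^ j * R ^ m := by
          rw [inv_pow, ← div_eq_inv_mul, one_le_div (by positivity)]
          exact pow_le_pow_right₀ hR.le hm.le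
        calc ‖coeff m u‖ * _ ≤ ‖coeff m u‖ * (2 * ‖W‖) :=
              mul_le_mul_of_nonneg_left (hbound m j) (norm_nonneg _)
          _ ≤ ‖coeff m u‖ * (2 * ‖W‖) * ((R⁻¹) ^ j * R ^ m) :=
              le_mul_of_one_le_right (by positivity) h2
          _ = _ := by ring
    refine (tsum_of_norm_bounded (Summable.hasSum (Summable.mul_left _ hu)) hle).trans_eq ?_
    rw [tsum_mul_left]
    ring
  exact Summable.of_nonneg_of_le (fun _ => norm_nonneg _) hcol
    (Summable.mul_left _ (summable_geometric_of_lt_one (by positivity) (inv_lt_one_of_one_lt₀ hR)))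

end Nuclear

/-! ### The strong Szegő limit theorem -/

section Szego

open PowerSeries

variable {R : ℝ} {u v w : PowerSeries ℂ}

/-- The operator `S ^ κ + corner u w κ` is `W⁻¹ U W S ^ κ U⁻¹`, where `U` and `W` are the upper and
lower triangular Toeplitz operators of `u` and `w`. -/
def corner (u w : PowerSeries ℂ) (κ : ℕ) : EllOp :=
  ev w⁻¹ shiftRight * (ev u shiftLeft * ev (w * X ^ κ) shiftRight -
    ev (w * X ^ κ) shiftRight * ev u shiftLeft) * ev u⁻¹ shiftLeft

theorem ev_inv_mul {A : EllOp} (hA : ∀ n, ‖A ^ n‖ ≤ 1) (hR : 1 ≤ R) (hu : IsUnitSeries R u) :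
    ev u⁻¹ A * ev u A = 1 := by
  rw [← ev_mul hR hu.summable_inv hu.summable hA, hu.inv_mul, ev_one]

theorem ev_mul_inv {A : EllOp} (hA : ∀ n, ‖A ^ n‖ ≤ 1) (hR : 1 ≤ R) (hu : IsUnitSeries R u) :
    ev u A * ev u⁻¹ A = 1 := by
  rw [← ev_mul hR hu.summable hu.summable_inv hA, hu.mul_inv, ev_one]

theorem isNuclear_corner (hR : 1 < R) (hu : IsUnitSeries R u) (hw : IsUnitSeries R w) (κ : ℕ) :
    IsNuclear (corner u w κ) :=
  ((isNuclear_commutator hR hu.summable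
    (hw.summable.mul (zero_le_one.trans hR.le) (rSummable_X_pow R κ))).mul_left _).mul_ev hR.le
      hu.summable_inv

theorem shiftRight_pow_add_corner (hR : 1 ≤ R) (hu : IsUnitSeries R u) (hw : IsUnitSeries R w)
    (κ : ℕ) : shiftRight ^ κ + corner u w κ = ev w⁻¹ shiftRight *
      (ev u shiftLeft * ev (w * X ^ κ) shiftRight) * ev u⁻¹ shiftLeft := by
  have h1 := ev_inv_mul norm_shiftRight_pow_le hR hw
  have h2 := ev_mul_inv norm_shiftLeft_pow_le hR hu
  have h3 : ev w⁻¹ shiftRight * ev (w * X ^ κ) shiftRight = shiftRight ^ κ := by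
    rw [ev_mul hR hw.summable (rSummable_X_pow R κ) norm_shiftRight_pow_le, ← mul_assoc, h1,
      one_mul, ev_X_pow]
  rw [corner, mul_sub, sub_mul]
  have h4 : ev w⁻¹ shiftRight * (ev (w * X ^ κ) shiftRight * ev u shiftLeft) * ev u⁻¹ shiftLeft =
      shiftRight ^ κ := by
    rw [← mul_assoc, h3, mul_assoc, h2, mul_one]
  rw [h4]
  abel

theorem sec_mul_ev_shiftRight (hR : 1 ≤ R) (hu : RSummable R u) (hw : RSummable R w) (κ N : ℕ) :
    sec N (ev u shiftLeft * ev (w * X ^ κ) shiftRight) = toeplitzMatrix u w κ N := by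
  ext i j
  rw [ev_mul hR hw (rSummable_X_pow R κ) norm_shiftRight_pow_le, ev_X_pow, ← mul_assoc]
  simp only [sec, toeplitzMatrix, Matrix.of_apply]
  rw [mul_apply_eq_comp, shiftRight_pow_unitVec, ev_shiftLeft_mul_ev_shiftRight_apply hR hu hw]
  congr 1
  push_cast
  ring

/-- Multiplication by unipotent triangular matrices turns a Toeplitz determinant into the
determinant of a section of a perturbation of a shift by an operator with summable columns. -/
theorem det_toeplitzMatrix_eq (hR : 1 ≤ R) (hu : IsUnitSeries R u) (hw : IsUnitSeries R w)
    (κ N : ℕ) :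
    (toeplitzMatrix u w κ N).det = (sec N (shiftRight ^ κ + corner u w κ)).det := by
  rw [shiftRight_pow_add_corner hR hu hw,
    sec_mul_of_isReduced _ (isReduced_ev_shiftLeft hR hu.summable_inv N),
    sec_mul_of_isLower (isLower_ev_shiftRight hR hw.summable_inv), Matrix.det_mul, Matrix.det_mul,
    det_sec_ev_shiftRight hR hw.summable_inv hw.inv.const,
    det_sec_ev_shiftLeft hR hu.summable_inv hu.inv.const, one_mul, mul_one,
    sec_mul_ev_shiftRight hR hu.summable hw.summable]

/-- The Toeplitz determinants of `u(z) w(1 / z)` converge to `E`. -/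
def HasSzegoLimit (u w : PowerSeries ℂ) (E : ℂ) : Prop :=
  Tendsto (fun N => (toeplitzMatrix u w 0 N).det) atTop (𝓝 E)

theorem det_toeplitzMatrix_zero_eq (hR : 1 ≤ R) (hu : IsUnitSeries R u) (hw : IsUnitSeries R w)
    (N : ℕ) : (toeplitzMatrix u w 0 N).det = (sec N (1 + corner u w 0)).det := by
  simpa using det_toeplitzMatrix_eq hR hu hw 0 N

theorem exists_hasSzegoLimit (hR : 1 < R) (hu : IsUnitSeries R u) (hw : IsUnitSeries R w) :
    ∃ E, HasSzegoLimit u w E := by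
  obtain ⟨E, hE⟩ := exists_tendsto_det_sec (isNuclear_corner hR hu hw 0)
  exact ⟨E, hE.congr fun N => (det_toeplitzMatrix_zero_eq hR.le hu hw N).symm⟩

theorem HasSzegoLimit.swap {E : ℂ} (h : HasSzegoLimit u w E) : HasSzegoLimit w u E := by
  refine h.congr fun N => ?_
  rw [det_toeplitzMatrix_swap, neg_zero]

/-- The limit is multiplicative in `u`. For `B(u) = W⁻¹ U W U⁻¹` one has
`B(u v) = B(u) (U B(v) U⁻¹)`, and the sections of this product have asymptotically the product of
the determinants: the truncation of `B(v) - 1` makes this an identity. -/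
theorem HasSzegoLimit.mul (hR : 1 < R) (hu : IsUnitSeries R u) (hv : IsUnitSeries R v)
    (hw : IsUnitSeries R w) {E E' : ℂ} (h : HasSzegoLimit u w E) (h' : HasSzegoLimit v w E') :
    HasSzegoLimit (u * v) w (E * E') := by
  have hR0 : 0 ≤ R := zero_le_one.trans hR.le
  set U : EllOp := ev u shiftLeft with hU
  set Ui : EllOp := ev u⁻¹ shiftLeft with hUi
  set K := corner u w 0 with hK
  set K' := corner v w 0 with hK'
  set K'' := corner (u * v) w 0 with hK''
  have nK : IsNuclear K := isNuclear_corner hR hu hw 0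
  have nK' : IsNuclear K' := isNuclear_corner hR hv hw 0
  have nK'' : IsNuclear K'' := isNuclear_corner hR (hu.mul hR0 hv) hw 0
  have hUU : U * Ui = 1 := ev_mul_inv norm_shiftLeft_pow_le hR.le hu
  have key : 1 + K'' = (1 + K) * U * (1 + K') * Ui := by
    have e1 := shiftRight_pow_add_corner hR.le hu hw 0
    have e2 := shiftRight_pow_add_corner hR.le hv hw 0
    have e3 := shiftRight_pow_add_corner hR.le (hu.mul hR0 hv) hw 0
    simp only [pow_zero, mul_one, ← hK, ← hK', ← hK''] at e1 e2 e3
    rw [e1, e2, e3, ← hU, ← hUi, PowerSeries.mul_inv_rev,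
      ev_mul hR.le hu.summable hv.summable norm_shiftLeft_pow_le,
      ev_mul hR.le hv.summable_inv hu.summable_inv norm_shiftLeft_pow_le, ← hU, ← hUi]
    have hUU' : Ui * U = 1 := ev_inv_mul norm_shiftLeft_pow_le hR.le hu
    have hWW : ev w shiftRight * ev w⁻¹ shiftRight = (1 : EllOp) :=
      ev_mul_inv norm_shiftRight_pow_le hR.le hw
    set W : EllOp := ev w shiftRight
    set Wi : EllOp := ev w⁻¹ shiftRight
    set V : EllOp := ev v shiftLeft
    set Vi : EllOp := ev v⁻¹ shiftLeft
    calc Wi * (U * V * W) * (Vi * Ui) = Wi * U * 1 * V * W * Vi * Ui := by noncomm_ring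
      _ = Wi * U * (W * Wi) * V * W * Vi * Ui := by rw [hWW]
      _ = Wi * U * W * 1 * Wi * V * W * Vi * Ui := by noncomm_ring
      _ = Wi * U * W * (Ui * U) * Wi * V * W * Vi * Ui := by rw [hUU']
      _ = Wi * (U * W) * Ui * U * (Wi * (V * W) * Vi) * Ui := by noncomm_ring
  have hexp : ∀ T : EllOp, (1 + K) * U * (1 + T) * Ui = 1 + (K + (1 + K) * U * T * Ui) := by
    intro T
    have : (1 + K) * U * (1 + T) * Ui = (1 + K) * (U * Ui) + (1 + K) * U * T * Ui := by
      noncomm_ring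
    rw [this, hUU, mul_one, add_assoc]
  have hKeq : K'' = K + (1 + K) * U * K' * Ui := by
    rw [hexp] at key
    exact add_left_cancel key
  have hsec : ∀ N, (sec N (1 + (K + (1 + K) * U * trunc N K' * Ui))).det =
      (sec N (1 + K)).det * (sec N (1 + K')).det := by
    intro N
    rw [← hexp, sec_mul_of_isReduced _ (isReduced_ev_shiftLeft hR.le hu.summable_inv N),
      sec_mul_of_isReduced _ (isReduced_one_add_trunc N K'),
      sec_mul_of_isReduced _ (isReduced_ev_shiftLeft hR.le hu.summable N), sec_trunc,
      Matrix.det_mul, Matrix.det_mul, Matrix.det_mul,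
      det_sec_ev_shiftLeft hR.le hu.summable_inv hu.inv.const,
      det_sec_ev_shiftLeft hR.le hu.summable hu.const, mul_one, mul_one]
  set c := ‖(1 + K) * U‖ with hc
  set s := ∑' n, ‖coeff n u⁻¹‖ with hs
  have hs0 : 0 ≤ s := tsum_nonneg fun _ => norm_nonneg _
  have hT : ∀ T, IsNuclear T → IsNuclear ((1 + K) * U * T * Ui) ∧
      nuclearNorm ((1 + K) * U * T * Ui) ≤ s * (c * nuclearNorm T) := fun T hT =>
    ⟨(hT.mul_left _).mul_ev hR.le hu.summable_inv,
      (nuclearNorm_mul_ev_le hR.le hu.summable_inv (hT.mul_left _)).trans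
        (mul_le_mul_of_nonneg_left (nuclearNorm_mul_le hT _) hs0)⟩
  have hdiff : Tendsto (fun N => (sec N (1 + K'')).det -
      (sec N (1 + K)).det * (sec N (1 + K')).det) atTop (𝓝 0) := by
    set M := Real.exp (nuclearNorm K'') *
      Real.exp (nuclearNorm K + s * (c * nuclearNorm K')) with hM
    have h0 : Tendsto (fun N => s * (c * nuclearNorm (K' - trunc N K')) * M) atTop (𝓝 0) := by
      have := (((tendsto_nuclearNorm_sub_trunc nK').const_mul c).const_mul s).mul_const M
      simpa using this
    refine squeeze_zero_norm (fun N => ?_) h0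
    rw [← hsec N]
    have n1 := hT _ (nK'.trunc N)
    have n2 := hT _ (nK'.sub (nK'.trunc N))
    refine (norm_det_sec_sub_le nK'' (nK.add n1.1) N).trans ?_
    have e : K'' - (K + (1 + K) * U * trunc N K' * Ui) =
        (1 + K) * U * (K' - trunc N K') * Ui := by
      rw [hKeq]; noncomm_ring
    rw [e]
    refine mul_le_mul n2.2 (mul_le_mul_of_nonneg_left (Real.exp_le_exp.mpr ?_) (Real.exp_nonneg _))
      (by positivity) (by have := nuclearNorm_nonneg (K' - trunc N K'); positivity)
    refine (nuclearNorm_add_le nK n1.1).trans (add_le_add_right (n1.2.trans ?_) _)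
    exact mul_le_mul_of_nonneg_left (mul_le_mul_of_nonneg_left (nuclearNorm_trunc_le nK' N)
      (norm_nonneg _)) hs0
  have := hdiff.add (Filter.Tendsto.mul h h')
  rw [zero_add] at this
  refine this.congr fun N => ?_
  rw [det_toeplitzMatrix_zero_eq hR.le hu hw, det_toeplitzMatrix_zero_eq hR.le hv hw,
    det_toeplitzMatrix_zero_eq hR.le (hu.mul hR0 hv) hw]
  ring

theorem HasSzegoLimit.one_left (hR : 1 ≤ R) (hw : IsUnitSeries R w) : HasSzegoLimit 1 w 1 := by
  refine tendsto_const_nhds.congr fun N => ?_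
  have h := sec_mul_ev_shiftRight hR (rSummable_one R) hw.summable 0 N
  rw [pow_zero, mul_one, ev_one, one_mul] at h
  rw [← Nat.cast_zero, ← h, det_sec_ev_shiftRight hR hw.summable hw.const]

theorem HasSzegoLimit.inv_left (hR : 1 < R) (hu : IsUnitSeries R u) (hw : IsUnitSeries R w) {E : ℂ}
    (h : HasSzegoLimit u w E) : HasSzegoLimit u⁻¹ w E⁻¹ := by
  obtain ⟨E', h'⟩ := exists_hasSzegoLimit hR hu.inv hw
  have h1 := h.mul hR hu hu.inv hw h'
  rw [hu.mul_inv] at h1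
  have h2 := tendsto_nhds_unique h1 (HasSzegoLimit.one_left hR.le hw)
  rwa [← eq_inv_of_mul_eq_one_right h2]

theorem HasSzegoLimit.pow_left (hR : 1 < R) (hu : IsUnitSeries R u) (hw : IsUnitSeries R w) {E : ℂ}
    (h : HasSzegoLimit u w E) : HasSzegoLimit (u ^ 2) w (E ^ 2) := by
  rw [sq, sq]
  exact h.mul hR hu hu hw h

/-- For `κ > 0` the shift `S ^ κ` does not reach the last column of the section, which therefore is
small. -/
theorem tendsto_det_toeplitzMatrix_of_pos (hR : 1 < R) (hu : IsUnitSeries R u)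
    (hw : IsUnitSeries R w) {κ : ℕ} (hκ : 0 < κ) :
    Tendsto (fun N => (toeplitzMatrix u w κ N).det) atTop (𝓝 0) := by
  set K := corner u w κ with hK
  have nK : IsNuclear K := isNuclear_corner hR hu hw κ
  rw [← tendsto_add_atTop_iff_nat 1]
  have h0 : Tendsto (fun N => Real.exp (nuclearNorm K) * ‖K (unitVec N)‖) atTop (𝓝 0) := by
    simpa using (Summable.tendsto_atTop_zero nK).const_mul (Real.exp (nuclearNorm K))
  refine squeeze_zero_norm (fun N => ?_) h0
  rw [det_toeplitzMatrix_eq hR.le hu hw]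
  refine (norm_det_le _).trans ?_
  rw [Fin.prod_univ_castSucc]
  refine mul_le_mul ((Finset.prod_le_prod (fun _ _ => Finset.sum_nonneg fun _ _ => norm_nonneg _)
    fun j _ => ?_).trans (prod_one_add_le_exp nK N)) ?_
    (Finset.sum_nonneg fun _ _ => norm_nonneg _) (Real.exp_nonneg _)
  · refine (sum_norm_sec_le _ _ _).trans ?_
    rw [add_apply, shiftRight_pow_unitVec]
    exact (norm_add_le _ _).trans_eq (by rw [norm_unitVec]; rfl)
  · refine le_trans (le_of_eq ?_) (sum_norm_sec_le (N + 1) K (Fin.last N))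
    refine Finset.sum_congr rfl fun i _ => ?_
    have : (i : ℕ) ≠ N + κ := by omega
    rw [sec, sec, Matrix.of_apply, Matrix.of_apply, ← coord_apply, ← coord_apply, ← hK, add_apply,
      map_add, shiftRight_pow_unitVec, Fin.val_last, coord_apply i, unitVec_apply, if_neg this,
      zero_add]

theorem tendsto_det_toeplitzMatrix_of_ne (hR : 1 < R) (hu : IsUnitSeries R u)
    (hw : IsUnitSeries R w) {κ : ℤ} (hκ : κ ≠ 0) :
    Tendsto (fun N => (toeplitzMatrix u w κ N).det) atTop (𝓝 0) := by
  rcases lt_or_gt_of_ne hκ with h | h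
  · obtain ⟨k, hk⟩ := Int.eq_ofNat_of_zero_le (a := -κ) (by omega)
    simp only [det_toeplitzMatrix_swap u w, hk]
    exact tendsto_det_toeplitzMatrix_of_pos hR hw hu (by omega)
  · obtain ⟨k, rfl⟩ := Int.eq_ofNat_of_zero_le h.le
    exact tendsto_det_toeplitzMatrix_of_pos hR hu hw (by omega)

/-- The determinants for two linear factors: `U W U⁻¹ = 1 - y S - x y (1 - S S*)` is lower
triangular. -/
theorem hasSzegoLimit_linear (hR : 1 < R) {x y : ℂ} (hx : IsUnitSeries R (1 - C x * X))
    (hy : IsUnitSeries R (1 - C y * X)) :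
    HasSzegoLimit (1 - C x * X)⁻¹ (1 - C y * X) (1 - x * y) := by
  refine tendsto_const_nhds.congr' ?_
  filter_upwards [eventually_gt_atTop 0] with N hN
  obtain ⟨N, rfl⟩ := Nat.exists_eq_add_of_lt hN
  rw [zero_add]
  set V : EllOp := ev (1 - C x * X) shiftLeft with hV
  set U : EllOp := ev (1 - C x * X)⁻¹ shiftLeft with hU
  set W : EllOp := ev (1 - C y * X) shiftRight with hW
  have hUV : U * V = 1 := ev_inv_mul norm_shiftLeft_pow_le hR.le hx
  have hV1 : V = 1 - x • shiftLeft := ev_one_sub_C_mul_X _ _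
  have hW1 : W = 1 - y • shiftRight := ev_one_sub_C_mul_X _ _
  set Z : EllOp := 1 - y • shiftRight - (x * y) • (1 - shiftRight * shiftLeft) with hZ
  have hWV : W * V = V * Z := by
    have h1 := shiftLeft_mul_shiftRight
    rw [hV1, hW1, hZ]
    simp only [sub_mul, mul_sub, one_mul, mul_one, smul_mul_assoc, mul_smul_comm, smul_sub,
      smul_smul, ← mul_assoc, h1]
    rw [mul_comm y x]
    abel
  have hUWV : U * W * V = Z := by
    rw [mul_assoc, hWV, ← mul_assoc, hUV, one_mul]
  have h := sec_mul_ev_shiftRight hR.le hx.inv.summable hy.summable 0 (N + 1)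
  rw [pow_zero, mul_one, ← hU, ← hW] at h
  have h2 : (toeplitzMatrix (1 - C x * X)⁻¹ (1 - C y * X) 0 (N + 1)).det = (sec (N + 1) Z).det := by
    rw [← hUWV, sec_mul_of_isReduced _ (isReduced_ev_shiftLeft hR.le hx.summable (N + 1)),
      Matrix.det_mul, det_sec_ev_shiftLeft hR.le hx.summable hx.const, mul_one, h, Nat.cast_zero]
  have hZ0 : ∀ i : ℕ, Z (unitVec 0) i =
      (if i = 0 then 1 - x * y else 0) - (if i = 1 then y else 0) := by
    intro i
    have e1 : shiftLeft (unitVec 0) = 0 := by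
      simpa using shiftLeft_pow_unitVec_of_lt (n := 1) (j := 0) (by omega)
    simp only [hZ, sub_apply, smul_apply, mul_apply_eq_comp, e1, map_zero, one_apply_eq_self,
      shiftRight_unitVec, sub_zero]
    rw [← coord_apply, map_sub, map_sub, map_smul, map_smul]
    simp only [coord_apply, unitVec_apply, smul_eq_mul]
    split_ifs <;> simp_all
  have hZs : ∀ j i : ℕ, Z (unitVec (j + 1)) i =
      (if i = j + 1 then 1 else 0) - (if i = j + 2 then y else 0) := by
    intro j i
    have e1 : shiftLeft (unitVec (j + 1)) = unitVec j := by
      simpa using shiftLeft_pow_unitVec_of_le (n := 1) (j := j + 1) (by omega)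
    simp only [hZ, sub_apply, smul_apply, mul_apply_eq_comp, e1, one_apply_eq_self,
      shiftRight_unitVec, sub_self, smul_zero, sub_zero]
    rw [← coord_apply, map_sub, map_smul]
    simp only [coord_apply, unitVec_apply, smul_eq_mul]
    split_ifs <;> simp_all
  rw [h2, Matrix.det_of_isLowerTriangular]
  · rw [Fin.prod_univ_succ, Finset.prod_eq_one]
    · simp [sec, hZ0]
    · intro i _
      simp [sec, hZs]
  · intro i j hij
    have hij' : (i : ℕ) < j := hij
    simp only [sec, Matrix.of_apply]
    obtain ⟨k, hk⟩ : ∃ k, (j : ℕ) = k + 1 := ⟨j - 1, by omega⟩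
    rw [hk, hZs, if_neg (by omega), if_neg (by omega), sub_zero]

end Szego

/-! ### Square roots of linear factors and the Szegő constant -/

section SquareRoot

open PowerSeries

theorem ringChoose_succ (r : ℚ) (n : ℕ) :
    Ring.choose r (n + 1) * (n + 1) = Ring.choose r n * (r - n) := by
  have h1 := Ring.descPochhammer_eq_factorial_smul_choose r (n + 1)
  have h2 := Ring.descPochhammer_eq_factorial_smul_choose r n
  rw [descPochhammer_succ_right, Polynomial.smeval_mul, h2, Polynomial.smeval_sub,
    Polynomial.smeval_X, Polynomial.smeval_natCast, Nat.factorial_succ] at h1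
  simp only [nsmul_eq_mul, pow_one, pow_zero, mul_one] at h1
  have h3 : (n.factorial : ℚ) ≠ 0 := by exact_mod_cast n.factorial_ne_zero
  push_cast at h1
  refine mul_left_cancel₀ h3 ?_
  linear_combination -h1

theorem abs_ringChoose_le_one {r : ℚ} (hr : |r| ≤ 1) (n : ℕ) : |Ring.choose r n| ≤ 1 := by
  induction n with
  | zero => simp
  | succ n ih =>
    have h1 := congrArg abs (ringChoose_succ r n)
    rw [abs_mul, abs_mul, abs_of_nonneg (by positivity : (0 : ℚ) ≤ n + 1)] at h1
    have h2 : |r - n| ≤ n + 1 := by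
      rw [abs_le] at hr ⊢
      have : (0 : ℚ) ≤ n := by positivity
      constructor <;> linarith [hr.1, hr.2]
    have h3 : |Ring.choose r (n + 1)| * (n + 1) ≤ 1 * (n + 1) := by
      rw [h1]
      exact mul_le_mul ih h2 (abs_nonneg _) zero_le_one
    exact le_of_mul_le_mul_right h3 (by positivity)

/-- The binomial series `(1 - a X) ^ r`. -/
def binomialPow (r : ℚ) (a : ℂ) : PowerSeries ℂ := rescale (-a) (binomialSeries ℂ r)

theorem coeff_binomialPow (r : ℚ) (a : ℂ) (n : ℕ) :
    coeff n (binomialPow r a) = (-a) ^ n * ((Ring.choose r n : ℚ) : ℂ) := by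
  rw [binomialPow, coeff_rescale, binomialSeries_coeff, Rat.smul_def, mul_one]

theorem constantCoeff_binomialPow (r : ℚ) (a : ℂ) : constantCoeff (binomialPow r a) = 1 := by
  rw [← coeff_zero_eq_constantCoeff_apply, coeff_binomialPow]
  simp

theorem binomialPow_add (r s : ℚ) (a : ℂ) :
    binomialPow (r + s) a = binomialPow r a * binomialPow s a := by
  rw [binomialPow, binomialSeries_add, map_mul]; rfl

theorem binomialPow_one (a : ℂ) : binomialPow 1 a = 1 - C a * X := by
  have h := binomialSeries_nat (R := ℚ) (A := ℂ) 1
  rw [Nat.cast_one, pow_one] at h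
  rw [binomialPow, h, map_add, map_one, rescale_X]
  simp [sub_eq_add_neg]

theorem rSummable_binomialPow {R : ℝ} (hR : 0 ≤ R) {r : ℚ} (hr : |r| ≤ 1) {a : ℂ}
    (ha : ‖a‖ * R < 1) : RSummable R (binomialPow r a) := by
  refine Summable.of_nonneg_of_le (fun n => by positivity) (fun n => ?_)
    (summable_geometric_of_lt_one (by positivity) ha)
  rw [coeff_binomialPow, norm_mul, norm_pow, norm_neg, mul_pow]
  have h : ‖((Ring.choose r n : ℚ) : ℂ)‖ ≤ 1 := by
    have := abs_ringChoose_le_one hr n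
    have h' : ‖((Ring.choose r n : ℚ) : ℂ)‖ = ((|Ring.choose r n| : ℚ) : ℝ) := by
      rw [← Complex.ofReal_ratCast, Complex.norm_real, Real.norm_eq_abs, Rat.cast_abs]
    rw [h']
    exact_mod_cast this
  exact mul_le_mul_of_nonneg_right (mul_le_of_le_one_right (by positivity) h) (by positivity)

theorem isUnitSeries_binomialPow {R : ℝ} (hR : 0 ≤ R) {r : ℚ} (hr : |r| ≤ 1) {a : ℂ}
    (ha : ‖a‖ * R < 1) : IsUnitSeries R (binomialPow r a) where
  const := constantCoeff_binomialPow r a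
  summable := rSummable_binomialPow hR hr ha
  summable_inv := by
    have : (binomialPow r a)⁻¹ = binomialPow (-r) a := by
      rw [PowerSeries.inv_eq_iff_mul_eq_one (by simp [constantCoeff_binomialPow]),
        ← binomialPow_add, neg_add_cancel, binomialPow, binomialSeries_zero, map_one]
    rw [this]
    exact rSummable_binomialPow hR (by rwa [abs_neg]) ha

/-- The power series `(1 - a X) ^ (1 / 2)`. -/
def sqrtSeries (a : ℂ) : PowerSeries ℂ := binomialPow (1 / 2) a

theorem sqrtSeries_sq (a : ℂ) : sqrtSeries a ^ 2 = 1 - C a * X := by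
  rw [sq, sqrtSeries, ← binomialPow_add, ← binomialPow_one]
  norm_num

theorem map_conj_sqrtSeries (a : ℂ) :
    PowerSeries.map (starRingEnd ℂ) (sqrtSeries a) = sqrtSeries (starRingEnd ℂ a) := by
  ext n
  rw [coeff_map, sqrtSeries, sqrtSeries, coeff_binomialPow, coeff_binomialPow]
  simp

theorem isUnitSeries_multiset_prod {R : ℝ} (hR : 0 ≤ R) (F : ℂ → PowerSeries ℂ) {A : Multiset ℂ}
    (hA : ∀ a ∈ A, IsUnitSeries R (F a)) : IsUnitSeries R (A.map F).prod := by
  induction A using Multiset.induction with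
  | empty => simpa using isUnitSeries_one R
  | cons a A ih =>
    rw [Multiset.map_cons, Multiset.prod_cons]
    exact (hA a (by simp)).mul hR (ih fun b hb => hA b (by simp [hb]))

/-- The power series `∏_a (1 - a X)`. -/
def linProd (A : Multiset ℂ) : PowerSeries ℂ := (A.map fun a => 1 - C a * X).prod

/-- The power series `∏_a (1 - a X) ^ (1 / 2)`. -/
def sqrtProd (A : Multiset ℂ) : PowerSeries ℂ := (A.map sqrtSeries).prod

theorem sqrtProd_sq (A : Multiset ℂ) : sqrtProd A ^ 2 = linProd A := by
  rw [sqrtProd, linProd, ← Multiset.prod_map_pow]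
  simp only [sqrtSeries_sq]

theorem map_conj_sqrtProd {A : Multiset ℂ} (hA : A.map (starRingEnd ℂ) = A) :
    PowerSeries.map (starRingEnd ℂ) (sqrtProd A) = sqrtProd A := by
  rw [sqrtProd, map_multiset_prod, Multiset.map_map]
  conv_rhs => rw [← hA, Multiset.map_map]
  simp only [Function.comp_def, map_conj_sqrtSeries]

variable {R : ℝ} {A B : Multiset ℂ}

theorem isUnitSeries_sqrtProd (hR : 0 ≤ R) (hA : ∀ a ∈ A, ‖a‖ * R < 1) :
    IsUnitSeries R (sqrtProd A) :=
  isUnitSeries_multiset_prod hR _ fun a ha =>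
    isUnitSeries_binomialPow hR (by norm_num [abs_le]) (hA a ha)

theorem isUnitSeries_lin (hR : 0 ≤ R) {a : ℂ} (ha : ‖a‖ * R < 1) :
    IsUnitSeries R (1 - C a * X) := by
  rw [← binomialPow_one]
  exact isUnitSeries_binomialPow hR (by norm_num) ha

theorem isUnitSeries_linProd (hR : 0 ≤ R) (hA : ∀ a ∈ A, ‖a‖ * R < 1) :
    IsUnitSeries R (linProd A) :=
  isUnitSeries_multiset_prod hR _ fun a ha => isUnitSeries_lin hR (hA a ha)

/-- The double product `∏_{a, b} (1 - a b)`. -/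
def pairProd (A B : Multiset ℂ) : ℂ := (A.map fun a => (B.map fun b => 1 - a * b).prod).prod

theorem pairProd_comm (A B : Multiset ℂ) : pairProd A B = pairProd B A := by
  rw [pairProd, Multiset.prod_map_prod_map]
  simp only [pairProd, mul_comm]

theorem hasSzegoLimit_linProd_lin (hR : 1 < R) (hA : ∀ a ∈ A, ‖a‖ * R < 1) {b : ℂ}
    (hb : ‖b‖ * R < 1) :
    HasSzegoLimit (linProd A)⁻¹ (1 - C b * X) (A.map fun a => 1 - a * b).prod := by
  have hR0 : 0 ≤ R := zero_le_one.trans hR.le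
  have hb' := isUnitSeries_lin hR0 hb
  induction A using Multiset.induction with
  | empty =>
    have : (linProd 0)⁻¹ = 1 := by
      rw [PowerSeries.inv_eq_iff_mul_eq_one (by simp [linProd])]
      simp [linProd]
    rw [this]
    simpa using HasSzegoLimit.one_left hR.le hb'
  | cons a A ih =>
    have ha' := isUnitSeries_lin hR0 (hA a (by simp))
    have hA' := isUnitSeries_linProd hR0 (A := A) fun c hc => hA c (by simp [hc])
    have e : (linProd (a ::ₘ A))⁻¹ = (linProd A)⁻¹ * (1 - C a * X)⁻¹ := by
      rw [← PowerSeries.mul_inv_rev, linProd, linProd, Multiset.map_cons, Multiset.prod_cons]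
    rw [e, Multiset.map_cons, Multiset.prod_cons, mul_comm (1 - a * b)]
    exact (ih fun c hc => hA c (by simp [hc])).mul hR hA'.inv ha'.inv hb'
      (hasSzegoLimit_linear hR ha' hb')

theorem hasSzegoLimit_linProd (hR : 1 < R) (hA : ∀ a ∈ A, ‖a‖ * R < 1)
    (hB : ∀ b ∈ B, ‖b‖ * R < 1) :
    HasSzegoLimit (linProd A)⁻¹ (linProd B) (pairProd A B) := by
  have hR0 : 0 ≤ R := zero_le_one.trans hR.le
  have hA' := isUnitSeries_linProd hR0 hA
  rw [pairProd_comm]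
  refine HasSzegoLimit.swap ?_
  induction B using Multiset.induction with
  | empty => simpa [linProd, pairProd] using HasSzegoLimit.one_left hR.le hA'.inv
  | cons b B ih =>
    have hb' := isUnitSeries_lin hR0 (hB b (by simp))
    have hB' := isUnitSeries_linProd hR0 (A := B) fun c hc => hB c (by simp [hc])
    have e : linProd (b ::ₘ B) = (1 - C b * X) * linProd B := by
      rw [linProd, linProd, Multiset.map_cons, Multiset.prod_cons]
    rw [e, pairProd, Multiset.map_cons, Multiset.prod_cons]
    have h1 := (hasSzegoLimit_linProd_lin hR hA (hB b (by simp))).swap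
    simp only [mul_comm _ b] at h1
    exact h1.mul hR hb' hB' hA'.inv (ih fun c hc => hB c (by simp [hc]))

/-- The Szegő factor `∏_b (1 - b X) ^ (1 / 2) / ∏_a (1 - a X) ^ (1 / 2)`. -/
def szegoFactor (A B : Multiset ℂ) : PowerSeries ℂ := sqrtProd B * (sqrtProd A)⁻¹

theorem isUnitSeries_szegoFactor (hR : 0 ≤ R) (hA : ∀ a ∈ A, ‖a‖ * R < 1)
    (hB : ∀ b ∈ B, ‖b‖ * R < 1) : IsUnitSeries R (szegoFactor A B) :=
  (isUnitSeries_sqrtProd hR hB).mul hR (isUnitSeries_sqrtProd hR hA).inv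

theorem HasSzegoLimit.unique {u w : PowerSeries ℂ} {E E' : ℂ} (h : HasSzegoLimit u w E)
    (h' : HasSzegoLimit u w E') : E = E' := tendsto_nhds_unique h h'

/-- The fourth power of the limit belongs to the rational symbol `h² / h(1 / z)²`, for which the
limit follows from that of the linear factors by multiplicativity. -/
theorem szegoLimit_pow_four (hR : 1 < R) (hA : ∀ a ∈ A, ‖a‖ * R < 1)
    (hB : ∀ b ∈ B, ‖b‖ * R < 1) {E : ℂ}
    (hE : HasSzegoLimit (szegoFactor A B) (szegoFactor A B)⁻¹ E) :
    E ^ 4 = pairProd A A * pairProd B B / pairProd A B ^ 2 := by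
  have hR0 : 0 ≤ R := zero_le_one.trans hR.le
  have hA' := isUnitSeries_linProd hR0 hA
  have hB' := isUnitSeries_linProd hR0 hB
  have hh := isUnitSeries_szegoFactor hR0 hA hB
  have hinv2 : ∀ v : PowerSeries ℂ, (v⁻¹) ^ 2 = (v ^ 2)⁻¹ := fun v => by
    rw [sq, sq, PowerSeries.mul_inv_rev]
  have e1 : szegoFactor A B ^ 2 = linProd B * (linProd A)⁻¹ := by
    rw [szegoFactor, mul_pow, sqrtProd_sq, hinv2, sqrtProd_sq]
  have e2 : ((szegoFactor A B)⁻¹) ^ 2 = linProd A * (linProd B)⁻¹ := by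
    rw [hinv2, e1, PowerSeries.mul_inv_rev, hA'.inv_inv]
  have h1 : HasSzegoLimit (szegoFactor A B ^ 2) ((szegoFactor A B)⁻¹ ^ 2) (E ^ 4) := by
    have := ((hE.pow_left hR hh hh.inv).swap.pow_left hR hh.inv (hh.mul hR0 hh |> fun h => by
      rwa [← sq] at h)).swap
    rwa [← pow_mul] at this
  rw [e1, e2] at h1
  have hAA := hasSzegoLimit_linProd hR hA hA
  have hBB := (hasSzegoLimit_linProd hR hB hB).swap
  have hBA := (hasSzegoLimit_linProd hR hB hA).inv_left hR hB'.inv hA'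
  rw [hB'.inv_inv] at hBA
  have hAB := ((hasSzegoLimit_linProd hR hA hB).swap.inv_left hR hB' hA'.inv).swap
  have g1 := (hBA.mul hR hB' hA'.inv hA' hAA).swap
  have g2 := (hBB.mul hR hB' hA'.inv hB'.inv hAB).swap
  have g := (g1.mul hR hA' hB'.inv (hB'.mul hR0 hA'.inv) g2).swap
  rw [h1.unique g, pairProd_comm B A, div_eq_mul_inv, sq, mul_inv]
  ring

end SquareRoot

/-! ### The symbol on the unit circle -/

section Symbol

open PowerSeries

variable {t : ℤ →₀ ℝ}

theorem symbol_conj (t : ℤ →₀ ℝ) (z : ℂ) :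
    symbol t (starRingEnd ℂ z) = starRingEnd ℂ (symbol t z) := by
  simp [symbol, Finsupp.sum]

theorem coeff_numerator (t : ℤ →₀ ℝ) (n : ℕ) :
    (numerator t).coeff n = t ((n : ℤ) - poleOrder t) := by
  have hle : ∀ α ∈ t.support, (-α).toNat ≤ poleOrder t := fun α hα =>
    Finset.le_sup (f := fun α : ℤ => (-α).toNat) hα
  rw [numerator, Finsupp.sum, Polynomial.finsetSum_coeff]
  simp only [Polynomial.coeff_monomial]
  rw [Finset.sum_eq_single ((n : ℤ) - poleOrder t)]
  · rw [if_pos (by omega)]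
  · intro α hα hne
    have := hle α hα
    rw [if_neg (by omega)]
  · intro h
    rw [Finsupp.notMem_support_iff.mp h]
    simp

theorem numerator_ne_zero (ht : t ≠ 0) : numerator t ≠ 0 := by
  obtain ⟨α, hα⟩ := Finsupp.ne_iff.mp ht
  intro h
  have h1 := coeff_numerator t (α + poleOrder t).toNat
  have h2 : (-α).toNat ≤ poleOrder t :=
    Finset.le_sup (f := fun α : ℤ => (-α).toNat) (Finsupp.mem_support_iff.mpr hα)
  rw [h, Polynomial.coeff_zero, show ((α + poleOrder t).toNat : ℤ) - poleOrder t = α by omega] at h1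
  exact hα (by exact_mod_cast h1.symm)

theorem map_conj_roots_numerator (t : ℤ →₀ ℝ) :
    (numerator t).roots.map (starRingEnd ℂ) = (numerator t).roots := by
  have h1 : (numerator t).map (starRingEnd ℂ) = numerator t := by
    ext n
    rw [Polynomial.coeff_map, coeff_numerator, Complex.conj_ofReal]
  conv_rhs => rw [← h1]
  exact ((IsAlgClosed.splits (numerator t)).roots_map (starRingEnd ℂ)).symm

theorem map_conj_filter_roots (t : ℤ →₀ ℝ) (p : ℝ → Prop) [DecidablePred p] :
    ((numerator t).roots.filter fun z => p ‖z‖).map (starRingEnd ℂ) =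
      (numerator t).roots.filter fun z => p ‖z‖ := by
  conv_rhs => rw [← map_conj_roots_numerator t, Multiset.filter_map]
  simp

theorem map_conj_zerosInside (t : ℤ →₀ ℝ) :
    (zerosInside t).map (starRingEnd ℂ) = zerosInside t :=
  map_conj_filter_roots t fun x => x < 1

/-- The reciprocals of the zeros outside the unit circle. -/
def invOutside (t : ℤ →₀ ℝ) : Multiset ℂ := (zerosOutside t).map fun z => z⁻¹

theorem map_conj_invOutside (t : ℤ →₀ ℝ) :
    (invOutside t).map (starRingEnd ℂ) = invOutside t := by
  have h : (zerosOutside t).map (starRingEnd ℂ) = zerosOutside t :=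
    map_conj_filter_roots t fun x => 1 < x
  rw [invOutside, Multiset.map_map]
  conv_rhs => rw [← h, Multiset.map_map]
  simp

theorem norm_lt_one_of_mem_zerosInside {z : ℂ} (hz : z ∈ zerosInside t) : ‖z‖ < 1 :=
  (Multiset.mem_filter.mp hz).2

theorem norm_lt_one_of_mem_invOutside {z : ℂ} (hz : z ∈ invOutside t) : ‖z‖ < 1 := by
  obtain ⟨y, hy, rfl⟩ := Multiset.mem_map.mp hz
  rw [norm_inv]
  exact inv_lt_one_of_one_lt₀ (Multiset.mem_filter.mp hy).2

theorem roots_eq_inside_add_outside (hc : centralCharge t = 0) :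
    (numerator t).roots = zerosInside t + zerosOutside t := by
  have h0 : zerosOn t = 0 := by
    rw [← Multiset.card_eq_zero]
    rw [centralCharge] at hc
    exact_mod_cast (div_eq_zero_iff.mp hc).resolve_right two_ne_zero
  have h1 : ∀ z ∈ (numerator t).roots, ‖z‖ ≠ 1 := fun z hz h =>
    Multiset.eq_zero_iff_forall_notMem.mp h0 z (Multiset.mem_filter.mpr ⟨hz, h⟩)
  rw [zerosInside, zerosOutside]
  conv_lhs => rw [← Multiset.filter_add_not (fun z : ℂ => ‖z‖ < 1) (numerator t).roots]
  congr 1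
  refine Multiset.filter_congr fun z hz => ?_
  have := h1 z hz
  rw [not_lt]
  exact ⟨fun h => lt_of_le_of_ne h this.symm, le_of_lt⟩

theorem multiset_prod_product {α β : Type*} (A : Multiset α) (B : Multiset β) (f : α × β → ℂ) :
    ((A ×ˢ B).map f).prod = (A.map fun a => (B.map fun b => f (a, b)).prod).prod := by
  induction A using Multiset.induction with
  | empty => simp
  | cons a A ih => simp [Multiset.cons_product, ih, Multiset.map_map]

theorem zeroProduct_eq (t : ℤ →₀ ℝ) :
    zeroProduct t = pairProd (zerosInside t) (zerosInside t) *
      pairProd (invOutside t) (invOutside t) /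
        pairProd (zerosInside t) (invOutside t) ^ 2 := by
  rw [zeroProduct]
  simp only [multiset_prod_product, pairProd, invOutside, Multiset.map_map, Function.comp_def,
    Multiset.prod_map_pow, mul_inv, div_eq_mul_inv, one_mul]

theorem pairProd_ne_zero {A B : Multiset ℂ} (hA : ∀ a ∈ A, ‖a‖ < 1) (hB : ∀ b ∈ B, ‖b‖ < 1) :
    pairProd A B ≠ 0 := by
  refine Multiset.prod_ne_zero fun h => ?_
  obtain ⟨a, ha, h⟩ := Multiset.mem_map.mp h
  refine Multiset.prod_ne_zero (fun h => ?_) h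
  obtain ⟨b, hb, h⟩ := Multiset.mem_map.mp h
  have h1 : ‖a * b‖ = 1 := by rw [← sub_eq_zero.mp h, norm_one]
  rw [norm_mul] at h1
  nlinarith [hA a ha, hB b hb, norm_nonneg a, norm_nonneg b]

theorem zeroProduct_ne_zero (t : ℤ →₀ ℝ) : zeroProduct t ≠ 0 := by
  rw [zeroProduct_eq]
  have hi := fun z => norm_lt_one_of_mem_zerosInside (t := t) (z := z)
  have ho := fun z => norm_lt_one_of_mem_invOutside (t := t) (z := z)
  exact div_ne_zero (mul_ne_zero (pairProd_ne_zero hi hi) (pairProd_ne_zero ho ho))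
    (pow_ne_zero _ (pairProd_ne_zero hi ho))

theorem exists_radius {A : Multiset ℂ} (hA : ∀ a ∈ A, ‖a‖ < 1) :
    ∃ R : ℝ, 1 < R ∧ ∀ a ∈ A, ‖a‖ * R < 1 := by
  obtain ⟨r, hr0, hr1, hr⟩ : ∃ r : ℝ, 0 ≤ r ∧ r < 1 ∧ ∀ a ∈ A, ‖a‖ ≤ r := by
    induction A using Multiset.induction with
    | empty => exact ⟨0, le_rfl, one_pos, by simp⟩
    | cons a A ih =>
      obtain ⟨r, hr0, hr1, hr⟩ := ih fun b hb => hA b (by simp [hb])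
      refine ⟨max ‖a‖ r, le_max_of_le_right hr0, max_lt (hA a (by simp)) hr1, fun b hb => ?_⟩
      rcases Multiset.mem_cons.mp hb with rfl | hb
      · exact le_max_left _ _
      · exact (hr b hb).trans (le_max_right _ _)
  refine ⟨2 / (1 + r), by rw [one_lt_div (by positivity)]; linarith, fun a ha => ?_⟩
  rw [mul_div_assoc', div_lt_one (by positivity)]
  linarith [hr a ha]

variable {R : ℝ}

theorem norm_pow_le_one_of_norm_eq_one {z : ℂ} (hz : ‖z‖ = 1) (n : ℕ) : ‖z ^ n‖ ≤ 1 := by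
  rw [norm_pow, hz, one_pow]

theorem ev_linProd (hR : 1 ≤ R) {A : Multiset ℂ} (hA : ∀ a ∈ A, ‖a‖ * R < 1) {z : ℂ}
    (hz : ‖z‖ = 1) : ev (linProd A) z = (A.map fun a => 1 - a * z).prod := by
  have hR0 : 0 ≤ R := zero_le_one.trans hR
  induction A using Multiset.induction with
  | empty => simp [linProd, ev_one]
  | cons a A ih =>
    have hA' : ∀ c ∈ A, ‖c‖ * R < 1 := fun c hc => hA c (by simp [hc])
    have e : linProd (a ::ₘ A) = (1 - C a * X) * linProd A := by
      rw [linProd, linProd, Multiset.map_cons, Multiset.prod_cons]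
    rw [e, ev_mul hR (isUnitSeries_lin hR0 (hA a (by simp))).summable
      (isUnitSeries_linProd hR0 hA').summable (norm_pow_le_one_of_norm_eq_one hz), ih hA',
      ev_one_sub_C_mul_X, Multiset.map_cons, Multiset.prod_cons, smul_eq_mul]

theorem ev_conj {u : PowerSeries ℂ} (hu : PowerSeries.map (starRingEnd ℂ) u = u) (z : ℂ) :
    ev u (starRingEnd ℂ z) = starRingEnd ℂ (ev u z) := by
  rw [ev, ev, Complex.conj_tsum]
  refine tsum_congr fun n => ?_
  conv_lhs => rw [← hu]
  simp [coeff_map]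

theorem ev_sqrtProd_sq (hR : 1 ≤ R) {A : Multiset ℂ} (hA : ∀ a ∈ A, ‖a‖ * R < 1) {z : ℂ}
    (hz : ‖z‖ = 1) : ev (sqrtProd A) z ^ 2 = (A.map fun a => 1 - a * z).prod := by
  have hs := (isUnitSeries_sqrtProd (zero_le_one.trans hR) hA).summable
  rw [sq, ← ev_mul hR hs hs (norm_pow_le_one_of_norm_eq_one hz), ← sq, sqrtProd_sq,
    ev_linProd hR hA hz]

theorem ev_ne_zero (hR : 1 ≤ R) {u : PowerSeries ℂ} (hu : IsUnitSeries R u) {z : ℂ}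
    (hz : ‖z‖ = 1) : ev u z ≠ 0 := by
  have h := ev_mul hR hu.summable hu.summable_inv (norm_pow_le_one_of_norm_eq_one hz)
  rw [hu.mul_inv, ev_one] at h
  exact left_ne_zero_of_mul (h ▸ one_ne_zero)

theorem ev_inv (hR : 1 ≤ R) {u : PowerSeries ℂ} (hu : IsUnitSeries R u) {z : ℂ}
    (hz : ‖z‖ = 1) : ev u⁻¹ z = (ev u z)⁻¹ := by
  have h := ev_mul hR hu.summable hu.summable_inv (norm_pow_le_one_of_norm_eq_one hz)
  rw [hu.mul_inv, ev_one] at h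
  exact eq_inv_of_mul_eq_one_right h.symm

theorem map_conj_inv {u : PowerSeries ℂ} (h1 : constantCoeff u = 1)
    (hu : PowerSeries.map (starRingEnd ℂ) u = u) :
    PowerSeries.map (starRingEnd ℂ) u⁻¹ = u⁻¹ := by
  rw [PowerSeries.eq_inv_iff_mul_eq_one (by simp [h1])]
  nth_rewrite 2 [← hu]
  rw [← map_mul, PowerSeries.inv_mul_cancel _ (by simp [h1]), map_one]

/-- The Szegő factor `∏_j (1 - X / Z_j) ^ (1 / 2) / ∏_i (1 - z_i X) ^ (1 / 2)` of the symbol, where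
`z_i` and `Z_j` are the zeros inside and outside the unit circle. -/
def symbolFactor (t : ℤ →₀ ℝ) : PowerSeries ℂ := szegoFactor (zerosInside t) (invOutside t)

theorem map_conj_symbolFactor (t : ℤ →₀ ℝ) :
    PowerSeries.map (starRingEnd ℂ) (symbolFactor t) = symbolFactor t := by
  have h1 : constantCoeff (sqrtProd (zerosInside t)) = 1 := by
    simp [sqrtProd, map_multiset_prod, Multiset.map_map, sqrtSeries,
      constantCoeff_binomialPow]
  rw [symbolFactor, szegoFactor, map_mul, map_conj_sqrtProd (map_conj_invOutside t),
    map_conj_inv h1 (map_conj_sqrtProd (map_conj_zerosInside t))]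

/-- The zeros of the symbol determine it on the unit circle, up to a constant. -/
theorem symbol_eq_factorization (hR : 1 ≤ R) (hc : centralCharge t = 0)
    (hA : ∀ a ∈ zerosInside t, ‖a‖ * R < 1) (hB : ∀ b ∈ invOutside t, ‖b‖ * R < 1) :
    ∃ c : ℂ, ∀ z : ℂ, ‖z‖ = 1 → symbol t z = c * z ^ topologicalInvariant t *
      (ev (sqrtProd (invOutside t)) z ^ 2 *
        starRingEnd ℂ (ev (sqrtProd (zerosInside t)) z) ^ 2) := by
  refine ⟨(numerator t).leadingCoeff * ((zerosOutside t).map fun w => -w).prod, fun z hz => ?_⟩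
  have hz0 : z ≠ 0 := by rintro rfl; simp at hz
  have hconj : starRingEnd ℂ z = z⁻¹ := (Complex.inv_eq_conj hz).symm
  have h1 := eval_numerator t hz0
  rw [(IsAlgClosed.splits (numerator t)).eq_prod_roots, Polynomial.eval_mul, Polynomial.eval_C,
    Polynomial.eval_multiset_prod, Multiset.map_map, roots_eq_inside_add_outside hc,
    Multiset.map_add, Multiset.prod_add] at h1
  simp only [Function.comp_def, Polynomial.eval_sub, Polynomial.eval_X, Polynomial.eval_C] at h1
  have hin : ((zerosInside t).map fun a => z - a).prod =
      z ^ (zerosInside t).card * ((zerosInside t).map fun a => 1 - a * starRingEnd ℂ z).prod := by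
    rw [← Multiset.prod_replicate, ← Multiset.map_const', ← Multiset.prod_map_mul]
    congr 1
    refine Multiset.map_congr rfl fun a _ => ?_
    rw [hconj]
    field_simp
  have hout : ((zerosOutside t).map fun a => z - a).prod =
      ((zerosOutside t).map fun w => -w).prod * ((invOutside t).map fun b => 1 - b * z).prod := by
    rw [invOutside, Multiset.map_map, ← Multiset.prod_map_mul]
    congr 1
    refine Multiset.map_congr rfl fun a ha => ?_
    have ha0 : a ≠ 0 := by
      rintro rfl
      have := (Multiset.mem_filter.mp ha).2
      rw [norm_zero] at this
      linarith
    simp only [Function.comp_def]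
    field_simp
    ring
  have hzc : ‖starRingEnd ℂ z‖ = 1 := by rwa [RCLike.norm_conj]
  rw [hin, hout, ← ev_sqrtProd_sq hR hA hzc, ← ev_sqrtProd_sq hR hB hz,
    ev_conj (map_conj_sqrtProd (map_conj_zerosInside t))] at h1
  have h2 : z ^ poleOrder t * z ^ topologicalInvariant t = z ^ (zerosInside t).card := by
    rw [← zpow_natCast, ← zpow_natCast, ← zpow_add₀ hz0]
    congr 1
    rw [topologicalInvariant]
    ring
  refine mul_left_cancel₀ (pow_ne_zero (poleOrder t) hz0) ?_
  rw [← h1, ← h2]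
  ring

theorem symbol_ne_zero (ht : t ≠ 0) (hc : centralCharge t = 0) {z : ℂ} (hz : ‖z‖ = 1) :
    symbol t z ≠ 0 := by
  intro h
  have hz0 : z ≠ 0 := by rintro rfl; simp at hz
  have h1 := eval_numerator t hz0
  rw [h, mul_zero] at h1
  have h2 : z ∈ (numerator t).roots := (Polynomial.mem_roots (numerator_ne_zero ht)).mpr h1
  rw [roots_eq_inside_add_outside hc, Multiset.mem_add] at h2
  rcases h2 with h2 | h2
  · exact absurd hz (Multiset.mem_filter.mp h2).2.ne
  · exact absurd hz (Multiset.mem_filter.mp h2).2.ne'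

theorem symbol_one_im (t : ℤ →₀ ℝ) : (symbol t 1).im = 0 := by
  have h := symbol_conj t 1
  rw [map_one] at h
  exact Complex.conj_eq_iff_im.mp h.symm

theorem signInvariant_eq (ht : t ≠ 0) (hc : centralCharge t = 0) :
    signInvariant t = 1 ∨ signInvariant t = -1 := by
  have h : (symbol t 1).re ≠ 0 := fun h =>
    symbol_ne_zero ht hc norm_one (Complex.ext h (symbol_one_im t))
  exact (Real.sign_apply_eq_of_ne_zero _ h).symm

/-- The phase of the symbol is `σ z ^ ω h(z) / h(1 / z)` on the unit circle, with the Szegő factor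
`h`: the zeros inside and outside the circle contribute squares `s ^ 2`, and
`s ^ 2 / |s| ^ 2 = s / s̄`. -/
theorem symbol_eq_norm_mul_phase (hR : 1 ≤ R) (hc : centralCharge t = 0)
    (hA : ∀ a ∈ zerosInside t, ‖a‖ * R < 1) (hB : ∀ b ∈ invOutside t, ‖b‖ * R < 1) {z : ℂ}
    (hz : ‖z‖ = 1) : symbol t z = (‖symbol t z‖ : ℂ) * ((signInvariant t : ℂ) *
      z ^ topologicalInvariant t * (ev (symbolFactor t) z * ev (symbolFactor t)⁻¹ z⁻¹)) := by
  have hR0 : 0 ≤ R := zero_le_one.trans hR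
  obtain ⟨c, hfac⟩ := symbol_eq_factorization hR hc hA hB
  have uA := isUnitSeries_sqrtProd hR0 hA
  have uB := isUnitSeries_sqrtProd hR0 hB
  have cA := map_conj_sqrtProd (map_conj_zerosInside t)
  have cB := map_conj_sqrtProd (map_conj_invOutside t)
  set sA := sqrtProd (zerosInside t)
  set sB := sqrtProd (invOutside t)
  -- the value at `z = 1` identifies the phase of the constant
  have hconst : c = (‖c‖ : ℂ) * signInvariant t := by
    have h1 := hfac 1 norm_one
    have rA := ev_conj cA 1
    have rB := ev_conj cB 1
    rw [map_one] at rA rB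
    obtain ⟨a, ha⟩ := Complex.conj_eq_iff_real.mp rA.symm
    obtain ⟨b, hb⟩ := Complex.conj_eq_iff_real.mp rB.symm
    have ha0 : a ≠ 0 := by
      rintro rfl
      exact ev_ne_zero hR uA norm_one (by rw [ha]; simp)
    have hb0 : b ≠ 0 := by
      rintro rfl
      exact ev_ne_zero hR uB norm_one (by rw [hb]; simp)
    rw [one_zpow, mul_one, ← rA, ha, hb] at h1
    have hre : symbol t 1 = ((symbol t 1).re : ℂ) := by
      rw [← Complex.conj_eq_iff_re.mp (Complex.conj_eq_iff_im.mpr (symbol_one_im t))]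
      simp
    set x := (symbol t 1).re with hx
    have hpos : 0 < b ^ 2 * a ^ 2 := by positivity
    have hcx : c = ((x / (b ^ 2 * a ^ 2) : ℝ) : ℂ) := by
      rw [hre] at h1
      push_cast
      rw [eq_div_iff (by exact_mod_cast hpos.ne')]
      exact h1.symm
    rw [hcx, Complex.norm_real, Real.norm_eq_abs, signInvariant, ← hx, abs_div, abs_of_pos hpos]
    norm_cast
    rcases lt_trichotomy x 0 with h | h | h
    · rw [Real.sign_of_neg h, abs_of_neg h]
      ring
    · simp [h]
    · rw [Real.sign_of_pos h, abs_of_pos h]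
      ring
  have hzc : starRingEnd ℂ z = z⁻¹ := (Complex.inv_eq_conj hz).symm
  have hzi : ‖z⁻¹‖ = 1 := by rw [norm_inv, hz, inv_one]
  have nA := ev_ne_zero hR uA hz
  have nB := ev_ne_zero hR uB hz
  have uF : IsUnitSeries R (symbolFactor t) := isUnitSeries_szegoFactor hR0 hA hB
  have e1 : ev (symbolFactor t) z = ev sB z * (ev sA z)⁻¹ := by
    rw [symbolFactor, szegoFactor, ev_mul hR uB.summable uA.summable_inv
      (norm_pow_le_one_of_norm_eq_one hz), ev_inv hR uA hz]
  have e2 : ev (symbolFactor t)⁻¹ z⁻¹ = starRingEnd ℂ (ev sA z) * (starRingEnd ℂ (ev sB z))⁻¹ := by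
    rw [ev_inv hR uF hzi, ← hzc, ev_conj (map_conj_symbolFactor t), e1, map_mul, map_inv₀, mul_inv,
      inv_inv, mul_comm]
  have hnorm : ‖symbol t z‖ = ‖c‖ * (‖ev sB z‖ ^ 2 * ‖ev sA z‖ ^ 2) := by
    rw [hfac z hz, norm_mul, norm_mul, norm_mul, norm_pow, norm_pow, RCLike.norm_conj, norm_zpow,
      hz, one_zpow, mul_one]
  rw [hnorm, e1, e2, hfac z hz]
  push_cast
  rw [← Complex.mul_conj', ← Complex.mul_conj']
  have nA' : starRingEnd ℂ (ev sA z) ≠ 0 := by simpa using nA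
  have nB' : starRingEnd ℂ (ev sB z) ≠ 0 := by simpa using nB
  set a' := starRingEnd ℂ (ev sA z)
  set b' := starRingEnd ℂ (ev sB z)
  set a := ev sA z
  set b := ev sB z
  set q := z ^ topologicalInvariant t
  have hq : c * q * (b ^ 2 * a' ^ 2) =
      (‖c‖ * signInvariant t : ℂ) * q * (b ^ 2 * a' ^ 2) := by rw [← hconst]
  rw [hq]
  field_simp

end Symbol

/-! ### Finite chains and the thermodynamic limit -/

section FiniteSize

open PowerSeries

variable {R : ℝ} {u w : PowerSeries ℂ}

/-- The weight `(∑ |u_m| R ^ m) (∑ |w_n| R ^ n)`, which bounds the Laurent coefficients of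
`u(z) w(1 / z)` and their decay. -/
def pairWeight (R : ℝ) (u w : PowerSeries ℂ) : ℝ :=
  ∑' p : ℕ × ℕ, ‖coeff p.1 u‖ * R ^ p.1 * (‖coeff p.2 w‖ * R ^ p.2)

theorem summable_pairWeight (hR : 0 ≤ R) (hu : RSummable R u) (hw : RSummable R w) :
    Summable fun p : ℕ × ℕ => ‖coeff p.1 u‖ * R ^ p.1 * (‖coeff p.2 w‖ * R ^ p.2) :=
  Summable.mul_of_nonneg hu hw (fun _ => by positivity) fun _ => by positivity

theorem one_le_pairWeight (hR : 0 ≤ R) (hu : IsUnitSeries R u) (hw : IsUnitSeries R w) :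
    1 ≤ pairWeight R u w := by
  have h := (summable_pairWeight hR hu.summable hw.summable).le_tsum (0, 0)
    fun _ _ => by positivity
  rw [pairWeight]
  refine le_of_eq_of_le ?_ h
  simp [hu.const, hw.const]

theorem norm_coeff_mul_le (hR : 1 ≤ R) (p : ℕ × ℕ) :
    ‖coeff p.1 u * coeff p.2 w‖ ≤ ‖coeff p.1 u‖ * R ^ p.1 * (‖coeff p.2 w‖ * R ^ p.2) := by
  rw [norm_mul]
  exact mul_le_mul (le_mul_of_one_le_right (norm_nonneg _) (one_le_pow₀ hR))
    (le_mul_of_one_le_right (norm_nonneg _) (one_le_pow₀ hR)) (norm_nonneg _) (by positivity)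

theorem summable_norm_coeff_mul (hR : 1 ≤ R) (hu : RSummable R u) (hw : RSummable R w) :
    Summable fun p : ℕ × ℕ => ‖coeff p.1 u * coeff p.2 w‖ :=
  (summable_pairWeight (zero_le_one.trans hR) hu hw).of_nonneg_of_le (fun _ => norm_nonneg _)
    (norm_coeff_mul_le hR)

theorem summable_ite_coeff_mul (hR : 1 ≤ R) (hu : RSummable R u) (hw : RSummable R w)
    (P : ℕ × ℕ → Prop) [DecidablePred P] :
    Summable fun p : ℕ × ℕ => if P p then coeff p.1 u * coeff p.2 w else 0 := by
  refine Summable.of_norm ((summable_norm_coeff_mul hR hu hw).of_nonneg_of_le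
    (fun _ => norm_nonneg _) fun p => ?_)
  split_ifs
  · exact le_rfl
  · rw [norm_zero]
    exact norm_nonneg _

theorem sum_norm_toeplitzMatrix_le (hR : 1 ≤ R) (hu : RSummable R u) (hw : RSummable R w) (κ : ℤ)
    (N : ℕ) (j : Fin N) : ∑ i, ‖toeplitzMatrix u w κ N i j‖ ≤ pairWeight R u w := by
  have hs := summable_norm_coeff_mul hR hu hw
  have hd : ∀ d : ℤ, Summable fun p : ℕ × ℕ =>
      ‖if (p.1 : ℤ) - p.2 = d then coeff p.1 u * coeff p.2 w else 0‖ := fun d =>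
    (summable_ite_coeff_mul hR hu hw fun p => (p.1 : ℤ) - p.2 = d).norm
  have h1 : ∀ i : Fin N, ‖toeplitzMatrix u w κ N i j‖ ≤
      ∑' p : ℕ × ℕ, ‖if (p.1 : ℤ) - p.2 = ((j : ℕ) : ℤ) - ((i : ℕ) : ℤ) + κ then
        coeff p.1 u * coeff p.2 w else 0‖ := fun i => norm_tsum_le_tsum_norm (hd _)
  refine (Finset.sum_le_sum fun i _ => h1 i).trans ?_
  rw [← Summable.tsum_finsetSum fun i _ => hd _]
  refine Summable.tsum_le_tsum (fun p => ?_) (summable_sum fun i _ => hd _)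
    (summable_pairWeight (zero_le_one.trans hR) hu hw)
  refine le_trans ?_ (norm_coeff_mul_le hR p)
  by_cases h : ∃ i : Fin N, (p.1 : ℤ) - p.2 = ((j : ℕ) : ℤ) - ((i : ℕ) : ℤ) + κ
  · obtain ⟨i, hi⟩ := h
    rw [Finset.sum_eq_single i]
    · rw [if_pos hi]
    · intro i' _ hne
      rw [if_neg, norm_zero]
      intro h'
      exact hne (Fin.ext (by omega))
    · simp
  · rw [Finset.sum_eq_zero]
    · exact norm_nonneg _
    · intro i _
      rw [if_neg (not_exists.mp h i), norm_zero]

variable {L : ℕ} [NeZero L]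

/-- The discrete Fourier coefficients of `σ z ^ ω u(z) w(1 / z)` at the `L`-th roots of unity are
the periodisation of its Laurent coefficients. -/
theorem phaseCoeff_eq_tsum (hR : 1 ≤ R) (hu : RSummable R u) (hw : RSummable R w) {σ : ℂ} {ω : ℤ}
    {φ : Site L → ℂ}
    (hφ : ∀ k, φ k = σ * chi L k ^ ω * (ev u (chi L k) * ev w (chi L k)⁻¹)) (d : ℤ) :
    phaseCoeff φ (d : Site L) = σ * ∑' p : ℕ × ℕ,
      if (((p.1 : ℤ) - p.2 + ω - d : ℤ) : Site L) = 0 then coeff p.1 u * coeff p.2 w else 0 := by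
  have hL : (L : ℂ) ≠ 0 := Nat.cast_ne_zero.mpr (NeZero.ne L)
  have hs := summable_norm_coeff_mul hR hu hw
  have hterm : ∀ k, φ k * chi L (-(k * (d : Site L))) = σ * ∑' p : ℕ × ℕ,
      coeff p.1 u * coeff p.2 w * chi L (k * (((p.1 : ℤ) - p.2 + ω - d : ℤ) : Site L)) := by
    intro k
    have hz : ‖chi L k‖ = 1 := norm_chi k
    have hz0 : chi L k ≠ 0 := by
      intro h
      rw [h, norm_zero] at hz
      exact zero_ne_one hz
    have hzi : ‖(chi L k)⁻¹‖ = 1 := by rw [norm_inv, hz, inv_one]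
    rw [hφ, ev, ev, tsum_mul_tsum_of_summable_norm
      (summable_norm_ev hR hu (norm_pow_le_one_of_norm_eq_one hz))
      (summable_norm_ev hR hw (norm_pow_le_one_of_norm_eq_one hzi)), mul_assoc, mul_assoc]
    congr 1
    rw [← tsum_mul_right, ← tsum_mul_left]
    refine tsum_congr fun p => ?_
    have e : chi L (-(k * (d : Site L))) = chi L k ^ (-d) := by
      rw [chi_zpow]
      congr 1
      push_cast
      ring
    rw [e, ← chi_zpow, zpow_sub₀ hz0, zpow_add₀ hz0, zpow_sub₀ hz0, zpow_natCast, zpow_natCast,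
      zpow_neg, smul_eq_mul, smul_eq_mul, inv_pow]
    field_simp
  rw [phaseCoeff, Finset.sum_congr rfl fun k _ => hterm k, ← Finset.mul_sum,
    ← Summable.tsum_finsetSum]
  · rw [mul_left_comm, ← tsum_mul_left]
    congr 1
    refine tsum_congr fun p => ?_
    rw [← Finset.mul_sum, sum_chi_mul]
    split_ifs
    · field_simp
    · simp
  · intro k _
    refine Summable.of_norm (hs.congr fun p => ?_)
    rw [norm_mul _ (chi L _), norm_chi, mul_one]

/-- The Laurent coefficients that are folded onto a given one by the periodisation have distance at
least `L` from it, hence are exponentially small. -/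
theorem norm_phaseCoeff_sub_le (hR : 1 ≤ R) (hu : RSummable R u) (hw : RSummable R w) {σ : ℂ}
    (hσ : ‖σ‖ = 1) {ω : ℤ} {φ : Site L → ℂ}
    (hφ : ∀ k, φ k = σ * chi L k ^ ω * (ev u (chi L k) * ev w (chi L k)⁻¹)) {d : ℤ} {D : ℕ}
    (hD : |d - ω| ≤ D) :
    ‖phaseCoeff φ (d : Site L) - σ * toeplitzCoeff u w (d - ω)‖ ≤
      pairWeight R u w / R ^ (L - D) := by
  have hR0 : 0 < R := zero_lt_one.trans_le hR
  have h1 := summable_ite_coeff_mul hR hu hw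
    fun p => (((p.1 : ℤ) - p.2 + ω - d : ℤ) : Site L) = 0
  have h2 := summable_ite_coeff_mul hR hu hw fun p => (p.1 : ℤ) - p.2 = d - ω
  have hM := (summable_pairWeight hR0.le hu hw)
  rw [phaseCoeff_eq_tsum hR hu hw hφ, ← mul_sub, norm_mul, hσ, one_mul, toeplitzCoeff,
    ← h1.tsum_sub h2, pairWeight, ← tsum_div_const]
  have hle : ∀ p : ℕ × ℕ,
      ‖(if (((p.1 : ℤ) - p.2 + ω - d : ℤ) : Site L) = 0 then coeff p.1 u * coeff p.2 w else 0) -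
        (if (p.1 : ℤ) - p.2 = d - ω then coeff p.1 u * coeff p.2 w else 0)‖ ≤
      ‖coeff p.1 u‖ * R ^ p.1 * (‖coeff p.2 w‖ * R ^ p.2) / R ^ (L - D) := by
    intro p
    by_cases e : (p.1 : ℤ) - p.2 = d - ω
    · rw [if_pos e, if_pos (by rw [show (p.1 : ℤ) - p.2 + ω - d = 0 by omega, Int.cast_zero]),
        sub_self, norm_zero]
      positivity
    · rw [if_neg e, sub_zero]
      split_ifs with h0
      · have hdvd : (L : ℤ) ∣ (p.1 : ℤ) - p.2 + ω - d :=
          (ZMod.intCast_zmod_eq_zero_iff_dvd _ L).mp h0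
        have habs : (L : ℤ) ≤ |(p.1 : ℤ) - p.2 + ω - d| :=
          Int.le_of_dvd (abs_pos.mpr (by omega)) ((dvd_abs _ _).mpr hdvd)
        have hge : L - D ≤ p.1 + p.2 := by
          rcases abs_cases ((p.1 : ℤ) - p.2 + ω - d) with h | h <;>
          rcases abs_cases (d - ω) with h' | h' <;> omega
        rw [le_div_iff₀ (by positivity), norm_mul]
        calc ‖coeff p.1 u‖ * ‖coeff p.2 w‖ * R ^ (L - D)
            ≤ ‖coeff p.1 u‖ * ‖coeff p.2 w‖ * R ^ (p.1 + p.2) := by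
              gcongr
          _ = _ := by rw [pow_add]; ring
      · rw [norm_zero]
        positivity
  have hsum := hM.div_const (R ^ (L - D))
  have hn := hsum.of_nonneg_of_le (fun _ => norm_nonneg _) hle
  exact (norm_tsum_le_tsum_norm hn).trans (hn.tsum_le_tsum hle hsum)

/-- The determinant of the finite chain differs little from the Toeplitz determinant. -/
theorem norm_det_phaseCoeff_sub_le (hR : 1 ≤ R) (hu : IsUnitSeries R u) (hw : IsUnitSeries R w)
    {σ : ℂ} (hσ : ‖σ‖ = 1) {ω : ℤ} {φ : Site L → ℂ}
    (hφ : ∀ k, φ k = σ * chi L k ^ ω * (ev u (chi L k) * ev w (chi L k)⁻¹)) (α : ℤ) (N : ℕ) {e : ℝ}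
    (he : pairWeight R u w / R ^ (L - (N + (α - ω).natAbs)) ≤ e) :
    ‖(Matrix.of fun i j : Fin N =>
        phaseCoeff φ ((((j : ℕ) : ℤ) - ((i : ℕ) : ℤ) + α : ℤ) : Site L)).det -
      σ ^ N * (toeplitzMatrix u w (α - ω) N).det‖ ≤
      N * (N * e) * (pairWeight R u w + N * e) ^ N := by
  have hR0 : 0 < R := zero_lt_one.trans_le hR
  have hM1 := one_le_pairWeight hR0.le hu hw
  have he0 : 0 ≤ e := le_trans (by positivity) he
  set Φ : Matrix (Fin N) (Fin N) ℂ := Matrix.of fun i j : Fin N =>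
    phaseCoeff φ ((((j : ℕ) : ℤ) - ((i : ℕ) : ℤ) + α : ℤ) : Site L) with hΦ
  have hsub : ∀ i j, ‖Φ i j - (σ • toeplitzMatrix u w (α - ω) N) i j‖ ≤ e := by
    intro i j
    refine le_trans ?_ he
    have h := norm_phaseCoeff_sub_le hR hu.summable hw.summable hσ hφ
      (d := ((j : ℕ) : ℤ) - ((i : ℕ) : ℤ) + α) (D := N + (α - ω).natAbs) (by
        have hi := i.isLt
        have hj := j.isLt
        rw [abs_le]
        omega)
    rw [hΦ, Matrix.of_apply, Matrix.smul_apply, smul_eq_mul, toeplitzMatrix, Matrix.of_apply,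
      ← add_sub_assoc]
    exact h
  have hT : ∀ j, ∑ i, ‖(σ • toeplitzMatrix u w (α - ω) N) i j‖ ≤ pairWeight R u w := by
    intro j
    simp only [Matrix.smul_apply, smul_eq_mul, norm_mul, hσ, one_mul]
    exact sum_norm_toeplitzMatrix_le hR hu.summable hw.summable _ _ _
  have hcol : ∀ j, ∑ i, ‖Φ i j - (σ • toeplitzMatrix u w (α - ω) N) i j‖ ≤ N * e := by
    intro j
    refine (Finset.sum_le_sum fun i _ => hsub i j).trans ?_
    simp
  have hΦcol : ∀ j, ∑ i, ‖Φ i j‖ ≤ pairWeight R u w + N * e := by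
    intro j
    refine le_trans ?_ (add_le_add (hT j) (hcol j))
    rw [← Finset.sum_add_distrib]
    exact Finset.sum_le_sum fun i _ => norm_le_norm_add_norm_sub' _ _
  have hNe : 0 ≤ N * e := by positivity
  have key := norm_det_sub_det_le Φ (σ • toeplitzMatrix u w (α - ω) N)
    (fun _ => pairWeight R u w + N * e) (fun _ => by linarith) hΦcol
    (fun j => (hT j).trans (by linarith))
  rw [Matrix.det_smul, Fintype.card_fin, Finset.prod_const, Finset.card_univ,
    Fintype.card_fin] at key
  refine key.trans ?_
  gcongr
  refine (Finset.sum_le_sum fun j _ => hcol j).trans ?_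
  simp

/-- The finite-size error is uniformly small for long chains as long as `N / L` is small: it is at
most `N ^ 2 e (M + N e) ^ N` with `e ≤ M / R ^ (L / 2)`, and a small enough ratio `N / L` makes the
exponential growth of the last factor harmless. -/
theorem exists_finiteSize_bound {M R : ℝ} (hM : 1 ≤ M) (hR : 1 < R) (C : ℕ) {ε : ℝ} (hε : 0 < ε) :
    ∃ (L₀ K : ℕ), 4 ≤ K ∧ ∀ L N : ℕ, L₀ ≤ L → K * N ≤ L →
      N * (N * (M / R ^ (L - (N + C)))) * (M + N * (M / R ^ (L - (N + C)))) ^ N < ε := by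
  -- `R ^ (L / 2)` is at least `ρ ^ L * ρ ^ L`, where one factor absorbs the exponential growth and
  -- the other one outweighs `L ^ 2`
  obtain ⟨ρ, hρ, hρR⟩ : ∃ ρ : ℝ, 1 < ρ ∧ ρ ^ 8 = R :=
    ⟨R ^ ((8 : ℕ) : ℝ)⁻¹, Real.one_lt_rpow hR (by norm_num),
      Real.rpow_inv_natCast_pow (by linarith) (by norm_num)⟩
  have hρ0 : 0 < ρ := by linarith
  obtain ⟨K, hK⟩ := pow_unbounded_of_one_lt (2 * M) hρ
  have hlim : Tendsto (fun L : ℕ => (L : ℝ) ^ 2 * ρ⁻¹ ^ L) atTop (𝓝 0) :=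
    tendsto_pow_const_mul_const_pow_of_abs_lt_one 2 (by
      rw [abs_of_pos (by positivity)]
      exact inv_lt_one_of_one_lt₀ hρ)
  obtain ⟨L₀, hL₀⟩ := eventually_atTop.mp
    (hlim.eventually_lt_const (show 0 < min 1 (ε / M) by positivity))
  refine ⟨max L₀ (4 * C + 2), K + 4, by omega, fun L N hL hN => ?_⟩
  have hL0 := hL₀ L ((le_max_left _ _).trans hL)
  have hLC : 4 * C + 2 ≤ L := (le_max_right _ _).trans hL
  have hKN : K * N ≤ L := le_trans (Nat.mul_le_mul_right _ (by omega)) hN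
  have h4N : 4 * N ≤ L := le_trans (Nat.mul_le_mul_right _ (by omega)) hN
  rw [inv_pow, ← div_eq_mul_inv, div_lt_iff₀ (by positivity)] at hL0
  have hL1 : (1 : ℝ) ≤ L := by exact_mod_cast (by omega : 1 ≤ L)
  have hNL : (N : ℝ) ≤ L := by exact_mod_cast (by omega : N ≤ L)
  have hρL : 1 ≤ ρ ^ L := one_le_pow₀ hρ.le
  have hLρ : (L : ℝ) ≤ ρ ^ L := by
    have h1 : (L : ℝ) ^ 2 < 1 * ρ ^ L :=
      hL0.trans_le (mul_le_mul_of_nonneg_right (min_le_left _ _) (by positivity))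
    nlinarith
  have hRL : ρ ^ L * ρ ^ L ≤ R ^ (L - (N + C)) := by
    rw [← hρR, ← pow_mul, ← pow_add]
    exact pow_le_pow_right₀ hρ.le (by omega)
  set e := M / R ^ (L - (N + C)) with he
  have he0 : 0 ≤ e := by positivity
  have heρ : e * ρ ^ L ≤ M / ρ ^ L := by
    rw [le_div_iff₀ (by positivity), mul_assoc, he, div_mul_eq_mul_div,
      div_le_iff₀ (by positivity)]
    exact mul_le_mul_of_nonneg_left hRL (by linarith)
  have hNe : N * e ≤ M := by
    calc N * e ≤ ρ ^ L * e := by gcongr; exact hNL.trans hLρ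
      _ ≤ M / ρ ^ L := by rw [mul_comm]; exact heρ
      _ ≤ M := div_le_self (by linarith) hρL
  have hpow : (M + N * e) ^ N ≤ ρ ^ L := by
    calc (M + N * e) ^ N ≤ (ρ ^ K) ^ N := by
          gcongr
          linarith
      _ = ρ ^ (K * N) := (pow_mul _ _ _).symm
      _ ≤ ρ ^ L := pow_le_pow_right₀ hρ.le hKN
  calc N * (N * e) * (M + N * e) ^ N ≤ L * (L * e) * ρ ^ L := by gcongr
    _ = (L : ℝ) ^ 2 * (e * ρ ^ L) := by ring
    _ ≤ (L : ℝ) ^ 2 * (M / ρ ^ L) := by gcongr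
    _ < ε := by
      rw [← mul_div_assoc, div_lt_iff₀ (by positivity)]
      have h1 : (L : ℝ) ^ 2 < ε / M * ρ ^ L :=
        hL0.trans_le (mul_le_mul_of_nonneg_right (min_le_right _ _) (by positivity))
      rw [div_mul_eq_mul_div, lt_div_iff₀ (by linarith)] at h1
      exact h1

end FiniteSize

/-! ### The limiting correlators -/

section Correlator

variable {t : ℤ →₀ ℝ}

theorem isPolar_symbol {L : ℕ} [NeZero L] (ht : t ≠ 0) (hc : centralCharge t = 0) :
    IsPolar t (fun k : Site L => ‖symbol t (chi L k)‖)
      (fun k => symbol t (chi L k) / (‖symbol t (chi L k)‖ : ℂ)) := by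
  have hne : ∀ k : Site L, symbol t (chi L k) ≠ 0 := fun k => symbol_ne_zero ht hc (norm_chi k)
  have hn : ∀ k : Site L, (‖symbol t (chi L k)‖ : ℂ) ≠ 0 := fun k => by simpa using hne k
  have hneg : ∀ k : Site L, symbol t (chi L (-k)) = star (symbol t (chi L k)) := fun k => by
    rw [← star_chi]
    exact symbol_conj t _
  refine ⟨fun k => norm_pos_iff.mpr (hne k), fun k => ?_, fun k => ?_, fun k => ?_, fun k => ?_⟩
  · have h : star (symbol t (chi L k)) * symbol t (chi L k) = (‖symbol t (chi L k)‖ : ℂ) ^ 2 :=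
      Complex.conj_mul' _
    rw [star_div₀, show star (‖symbol t (chi L k)‖ : ℂ) = ‖symbol t (chi L k)‖ from
      Complex.conj_ofReal _, div_mul_div_comm, h, ← sq, div_self (pow_ne_zero 2 (hn k))]
  · simp only [hneg, norm_star]
  · simp only [hneg, norm_star]
    rw [star_div₀, show star (‖symbol t (chi L k)‖ : ℂ) = ‖symbol t (chi L k)‖ from
      Complex.conj_ofReal _]
  · exact (mul_div_cancel₀ _ (hn k)).symm

theorem exists_radius_zeros (t : ℤ →₀ ℝ) : ∃ R : ℝ, 1 < R ∧
    (∀ a ∈ zerosInside t, ‖a‖ * R < 1) ∧ ∀ b ∈ invOutside t, ‖b‖ * R < 1 := by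
  obtain ⟨R, hR, h⟩ := exists_radius (A := zerosInside t + invOutside t) fun a ha => by
    rcases Multiset.mem_add.mp ha with ha | ha
    · exact norm_lt_one_of_mem_zerosInside ha
    · exact norm_lt_one_of_mem_invOutside ha
  exact ⟨R, hR, fun a ha => h a (Multiset.mem_add.mpr (Or.inl ha)),
    fun b hb => h b (Multiset.mem_add.mpr (Or.inr hb))⟩

/-- The correlator of the infinite chain: up to signs, the Toeplitz determinant of the phase of the
symbol, the winding of which is shifted by `α`. -/
def limitCorrelator (t : ℤ →₀ ℝ) (α : ℤ) (N : ℕ) : ℂ :=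
  stringSign α N * ((-1) ^ N * ((signInvariant t : ℂ) ^ N *
    (toeplitzMatrix (symbolFactor t) (symbolFactor t)⁻¹ (α - topologicalInvariant t) N).det))

theorem norm_stringSign (α : ℤ) (N : ℕ) : ‖stringSign α N‖ = 1 := by
  rw [stringSign]
  split_ifs <;> simp

theorem norm_signInvariant (ht : t ≠ 0) (hc : centralCharge t = 0) :
    ‖(signInvariant t : ℂ)‖ = 1 := by
  rcases signInvariant_eq ht hc with h | h <;> simp [h]

/-- The finite-chain correlators are close to the limiting one uniformly in `N ≤ L / K`, which
covers both the thermodynamic and the double scaling limit. -/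
theorem exists_correlation_sub_limitCorrelator_lt (ht : t ≠ 0) (hc : centralCharge t = 0) (α : ℤ)
    {ε : ℝ} (hε : 0 < ε) : ∃ L₀ K : ℕ, 4 ≤ K ∧ ∀ (L N : ℕ) [NeZero L], L₀ ≤ L → K * N ≤ L →
      ∀ ψ : FockVec L, IsGroundState t ψ →
        ‖stringCorrelation ψ α N - limitCorrelator t α N‖ < ε := by
  obtain ⟨R, hR, hA, hB⟩ := exists_radius_zeros t
  have hu := isUnitSeries_szegoFactor (zero_le_one.trans hR.le) hA hB
  have hM := one_le_pairWeight (zero_le_one.trans hR.le) hu hu.inv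
  obtain ⟨L₀, K, hK, hbound⟩ :=
    exists_finiteSize_bound hM hR (α - topologicalInvariant t).natAbs hε
  refine ⟨max L₀ (2 * α.natAbs), K, hK, fun L N _ hL hN ψ hψ => ?_⟩
  have h2α := (le_max_right _ _).trans hL
  have h4N : 4 * N ≤ L := le_trans (Nat.mul_le_mul_right _ hK) hN
  have hne : ∀ k : Site L, (‖symbol t (chi L k)‖ : ℂ) ≠ 0 := fun k => by
    simpa using symbol_ne_zero ht hc (norm_chi k)
  have hφ : ∀ k : Site L, symbol t (chi L k) / (‖symbol t (chi L k)‖ : ℂ) =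
      (signInvariant t : ℂ) * chi L k ^ topologicalInvariant t *
        (ev (symbolFactor t) (chi L k) * ev (symbolFactor t)⁻¹ (chi L k)⁻¹) := fun k => by
    rw [div_eq_iff (hne k), mul_comm _ (‖symbol t (chi L k)‖ : ℂ)]
    exact symbol_eq_norm_mul_phase hR.le hc hA hB (norm_chi k)
  rw [stringCorrelation_eq_det (isPolar_symbol ht hc) hψ α N (by omega), limitCorrelator, ← mul_sub,
    ← mul_sub, norm_mul, norm_mul, norm_stringSign, one_mul, norm_pow, norm_neg, norm_one, one_pow,
    one_mul]
  have h := norm_det_phaseCoeff_sub_le hR.le hu hu.inv (norm_signInvariant ht hc) hφ α N le_rfl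
  exact h.trans_lt (hbound L N ((le_max_left _ _).trans hL) hN)

theorem isThermodynamicCorrelator_limitCorrelator (ht : t ≠ 0) (hc : centralCharge t = 0) (α : ℤ)
    (N : ℕ) : IsThermodynamicCorrelator t α N (limitCorrelator t α N) := by
  intro ε hε
  obtain ⟨L₀, K, -, h⟩ := exists_correlation_sub_limitCorrelator_lt ht hc α hε
  exact ⟨max L₀ (K * N), fun L _ hL => h L N ((le_max_left _ _).trans hL)
    ((le_max_right _ _).trans hL)⟩

theorem isDoubleScalingCorrelator_limitCorrelator (ht : t ≠ 0) (hc : centralCharge t = 0) (α : ℤ) :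
    IsDoubleScalingCorrelator t α (limitCorrelator t α) := by
  intro ε hε
  obtain ⟨L₀, K, hK, h⟩ := exists_correlation_sub_limitCorrelator_lt ht hc α hε
  have hK0 : (0 : ℝ) < K := by exact_mod_cast (by omega : 0 < K)
  refine ⟨L₀, (K : ℝ)⁻¹, by positivity, fun N L _ hN hNL => ?_⟩
  have h1 : K * N ≤ L := by
    rw [inv_mul_eq_div, le_div_iff₀ hK0, mul_comm] at hNL
    exact_mod_cast hNL
  have h2 : 4 * N ≤ L := le_trans (Nat.mul_le_mul_right _ hK) h1
  exact h L N (by omega) h1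

/-- The limit is real because the zeros come in conjugate pairs. -/
theorem exists_real_szegoLimit (t : ℤ →₀ ℝ) : ∃ E : ℝ, (E : ℂ) ^ 4 = zeroProduct t ∧
    HasSzegoLimit (symbolFactor t) (symbolFactor t)⁻¹ (E : ℂ) := by
  obtain ⟨R, hR, hA, hB⟩ := exists_radius_zeros t
  have hu : IsUnitSeries R (symbolFactor t) :=
    isUnitSeries_szegoFactor (zero_le_one.trans hR.le) hA hB
  obtain ⟨E, hE⟩ := exists_hasSzegoLimit hR hu hu.inv
  have hcu := map_conj_symbolFactor t
  have hcw := map_conj_inv hu.const hcu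
  have hreal : ∀ {u : PowerSeries ℂ}, PowerSeries.map (starRingEnd ℂ) u = u → ∀ n,
      starRingEnd ℂ (PowerSeries.coeff n u) = PowerSeries.coeff n u := fun h n => by
    rw [← PowerSeries.coeff_map, h]
  have hcoeff : ∀ d, starRingEnd ℂ (toeplitzCoeff (symbolFactor t) (symbolFactor t)⁻¹ d) =
      toeplitzCoeff (symbolFactor t) (symbolFactor t)⁻¹ d := by
    intro d
    rw [toeplitzCoeff, Complex.conj_tsum]
    refine tsum_congr fun p => ?_
    split_ifs
    · rw [map_mul, hreal hcu, hreal hcw]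
    · exact map_zero _
  have hconj : starRingEnd ℂ E = E := by
    have h1 : Tendsto (fun N => starRingEnd ℂ
        (toeplitzMatrix (symbolFactor t) (symbolFactor t)⁻¹ 0 N).det) atTop
        (𝓝 (starRingEnd ℂ E)) := (Complex.continuous_conj.tendsto E).comp hE
    refine tendsto_nhds_unique h1 (hE.congr fun N => ?_)
    rw [RingHom.map_det]
    congr 1
    ext i j
    exact (hcoeff _).symm
  obtain ⟨x, rfl⟩ := Complex.conj_eq_iff_real.mp hconj
  refine ⟨x, ?_, hE⟩
  rw [zeroProduct_eq]
  exact szegoLimit_pow_four hR hA hB hE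

theorem norm_limitCorrelator (ht : t ≠ 0) (hc : centralCharge t = 0) (α : ℤ) (N : ℕ) :
    ‖limitCorrelator t α N‖ = ‖(toeplitzMatrix (symbolFactor t) (symbolFactor t)⁻¹
      (α - topologicalInvariant t) N).det‖ := by
  rw [limitCorrelator, norm_mul, norm_mul, norm_mul, norm_stringSign, norm_pow, norm_pow,
    norm_signInvariant ht hc]
  simp

theorem tendsto_norm_limitCorrelator (ht : t ≠ 0) (hc : centralCharge t = 0) {E : ℝ}
    (hE : HasSzegoLimit (symbolFactor t) (symbolFactor t)⁻¹ (E : ℂ)) (α : ℤ) :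
    Tendsto (fun N => ‖limitCorrelator t α N‖) atTop
      (𝓝 (if α = topologicalInvariant t then |E| else 0)) := by
  simp only [norm_limitCorrelator ht hc]
  split_ifs with h
  · have h1 := Tendsto.norm hE
    rwa [Complex.norm_real, Real.norm_eq_abs, ← sub_eq_zero.mpr h] at h1
  · obtain ⟨R, hR, hA, hB⟩ := exists_radius_zeros t
    have hu : IsUnitSeries R (symbolFactor t) :=
      isUnitSeries_szegoFactor (zero_le_one.trans hR.le) hA hB
    have h1 := (tendsto_det_toeplitzMatrix_of_ne hR hu hu.inv (sub_ne_zero.mpr h)).norm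
    rwa [norm_zero] at h1

/-- Whether a sequence `s a ^ N D_N` with `a = ± 1` and `D_N` of non-zero limit oscillates is
decided by `a`. -/
theorem nonOscillating_iff {u D : ℕ → ℂ} {E s : ℂ} {a : ℝ} (ha : a = 1 ∨ a = -1) (hs : s ≠ 0)
    (hE : E ≠ 0) (hD : Tendsto D atTop (𝓝 E)) (hu : ∀ N, u N = s * ((a : ℂ) ^ N * D N)) :
    NonOscillating u ↔ a = 1 := by
  constructor
  · rintro ⟨B, -, hB⟩
    refine ha.resolve_right fun h => ?_
    subst h
    -- dividing by `s D` leaves the sequence `(-1) ^ N`, which has no limit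
    have h1 : Tendsto (fun N : ℕ => (-1 : ℂ) ^ N) atTop (𝓝 (B / (s * E))) := by
      refine (hB.div (hD.const_mul s) (mul_ne_zero hs hE)).congr' ?_
      filter_upwards [hD.eventually_ne hE] with N hN
      simp only [Pi.div_apply, hu]
      push_cast
      field_simp
    have h2 := h1.comp (tendsto_add_atTop_nat 1)
    have h3 : Tendsto (fun N : ℕ => -(-1 : ℂ) ^ N) atTop (𝓝 (B / (s * E))) :=
      h2.congr fun N => by simp [pow_succ]
    have h4 : B / (s * E) = 0 := self_eq_neg.mp (tendsto_nhds_unique h3 h1.neg).symm.symm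
    have h5 := h1.norm
    simp only [norm_pow, norm_neg, norm_one, one_pow, h4, norm_zero] at h5
    exact one_ne_zero (tendsto_nhds_unique tendsto_const_nhds h5)
  · rintro rfl
    refine ⟨s * E, mul_ne_zero hs hE, (hD.const_mul s).congr fun N => ?_⟩
    rw [hu]
    simp

theorem oscillating_iff {u D : ℕ → ℂ} {E s : ℂ} {a : ℝ} (ha : a = 1 ∨ a = -1) (hs : s ≠ 0)
    (hE : E ≠ 0) (hD : Tendsto D atTop (𝓝 E)) (hu : ∀ N, u N = s * ((a : ℂ) ^ N * D N)) :
    Oscillating u ↔ a = -1 := by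
  have h := nonOscillating_iff (u := fun N => (-1) ^ N * u N) (a := -a)
    (by rcases ha with rfl | rfl <;> simp) hs hE hD fun N => by
      rw [hu, Complex.ofReal_neg, neg_pow (a : ℂ)]
      ring
  rw [neg_eq_iff_eq_neg] at h
  exact h

theorem neg_one_zpow_eq (ω : ℤ) : (-1 : ℝ) ^ (ω - 1) = -(-1) ^ ω.natAbs := by
  rw [zpow_sub_one₀ (by norm_num)]
  have h : (-1 : ℝ) ^ ω = (-1) ^ ω.natAbs := by
    rcases Int.natAbs_eq ω with h | h
    · conv_lhs => rw [h, zpow_natCast]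
    · conv_lhs => rw [h, zpow_neg, zpow_natCast, ← inv_pow, inv_neg, inv_one]
  rw [h]
  norm_num

theorem limitCorrelator_topologicalInvariant (t : ℤ →₀ ℝ) (N : ℕ) :
    limitCorrelator t (topologicalInvariant t) N =
      stringSign (topologicalInvariant t) 0 *
        ((((-1) ^ (topologicalInvariant t - 1) * signInvariant t : ℝ) : ℂ) ^ N *
          (toeplitzMatrix (symbolFactor t) (symbolFactor t)⁻¹ 0 N).det) := by
  rw [limitCorrelator, sub_self, neg_one_zpow_eq]
  simp only [stringSign, mul_zero, pow_zero, mul_one, pow_mul]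
  push_cast
  rw [mul_pow, neg_pow ((-1 : ℂ) ^ _)]
  ring

end Correlator

end BDI

end

theorem mainTheorem2 (t : ℤ →₀ ℝ) (ω : ℤ) (σ : ℝ) (h : BDI.InGappedPhase t ω σ) :
    ∃ G : ℤ → ℕ → ℂ,
      (∀ (α : ℤ) (N : ℕ), BDI.IsThermodynamicCorrelator t α N (G α N)) ∧
      (∀ α : ℤ, BDI.IsDoubleScalingCorrelator t α (G α)) ∧
      (∃ A : ℝ, 0 < A ∧ (A : ℂ) ^ 4 = BDI.zeroProduct t ∧
        ∀ α : ℤ, Tendsto (fun N : ℕ => ‖G α N‖) atTop (𝓝 (if α = ω then A else 0))) ∧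
      (σ = 1 ∨ σ = -1) ∧
      (BDI.NonOscillating (G ω) ↔ σ = (-1 : ℝ) ^ (ω - 1)) ∧
      (BDI.Oscillating (G ω) ↔ σ = -(-1 : ℝ) ^ (ω - 1)) := by
  obtain ⟨ht, hc, rfl, rfl⟩ := h
  obtain ⟨E, hE4, hE⟩ := BDI.exists_real_szegoLimit t
  have hE0 : E ≠ 0 := by
    rintro rfl
    exact BDI.zeroProduct_ne_zero t (by rw [← hE4]; simp)
  have hsign := BDI.signInvariant_eq ht hc
  have hpow : (-1 : ℝ) ^ (BDI.topologicalInvariant t - 1) = 1 ∨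
      (-1 : ℝ) ^ (BDI.topologicalInvariant t - 1) = -1 := by
    rw [BDI.neg_one_zpow_eq]
    rcases neg_one_pow_eq_or ℝ (BDI.topologicalInvariant t).natAbs with h | h <;> simp [h]
  have hprod : (-1 : ℝ) ^ (BDI.topologicalInvariant t - 1) * BDI.signInvariant t = 1 ∨
      (-1 : ℝ) ^ (BDI.topologicalInvariant t - 1) * BDI.signInvariant t = -1 := by
    rcases hsign with h | h <;> rcases hpow with h' | h' <;> rw [h, h'] <;> norm_num
  have hs : BDI.stringSign (BDI.topologicalInvariant t) 0 ≠ 0 := by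
    rw [← norm_pos_iff, BDI.norm_stringSign]
    exact one_pos
  have hEc : (E : ℂ) ≠ 0 := Complex.ofReal_ne_zero.mpr hE0
  -- the limit `E` of the determinants is only known to be real, so `A = |E|`
  refine ⟨BDI.limitCorrelator t, BDI.isThermodynamicCorrelator_limitCorrelator ht hc,
    BDI.isDoubleScalingCorrelator_limitCorrelator ht hc,
    ⟨|E|, abs_pos.mpr hE0, ?_, BDI.tendsto_norm_limitCorrelator ht hc hE⟩, hsign, ?_, ?_⟩
  · rw [← hE4]
    exact_mod_cast (show Even 4 by decide).pow_abs E
  · rw [BDI.nonOscillating_iff hprod hs hEc hE (BDI.limitCorrelator_topologicalInvariant t)]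
    rcases hsign with h | h <;> rcases hpow with h' | h' <;> rw [h, h'] <;> norm_num
  · rw [BDI.oscillating_iff hprod hs hEc hE (BDI.limitCorrelator_topologicalInvariant t)]
    rcases hsign with h | h <;> rcases hpow with h' | h' <;> rw [h, h'] <;> norm_num
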